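/- Let $K$ be a field, let $q,Q\in K^\times$, and let $n,d\ge 0$ be integers. Let $I(n)=[-r,r]\cap\mathbb Z$ if $n=2r+1$ and $I(n)=([-r,r]\cap\mathbb Z)\setminus\{0\}$ if $n=2r$, and let $V=V(n)$ be the $K$-vector space with basis $\{v_i\mid i\in I(n)\}$, so that $V^{\otimes d}$ has the basis $v_\mu=v_{\mu_1}\otimes\cdots\otimes v_{\mu_d}$, $\mu\in I(n)^d$. Let $\mathcal H^{\mathrm B}_{Q,q}(d)$ be the $K$-algebra generated by $T_0,\dots,T_{d-1}$ subject to $T_iT_{i+1}T_i=T_{i+1}T_iT_{i+1}$ $(1\le i\le d-2)$, $(T_0T_1)^2=(T_1T_0)^2$, $T_iT_j=T_jT_i$ $(|i-j|>1)$, $T_0^2=(Q^{-1}-Q)T_0+1$ and $T_i^2=(q^{-1}-q)T_i+1$ $(1\le i\le d-1)$, and let $\mathcal H^{\mathrm A}_q(\Sigma_d)$ be the $K$-algebra generated by $T_1,\dots,T_{d-1}$ subject to those of the relations that do not involve $T_0$. For $1\le t\le d-1$ let $\mu\cdot s_t$ be $\mu$ with the entries $\mu_t,\mu_{t+1}$ interchanged,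 and let $\mu\cdot s_0=(-\mu_1,\mu_2,\dots,\mu_d)$. Then $\mathcal H^{\mathrm B}_{Q,q}(d)$ acts on $V^{\otimes d}$ from the right by \[ v_\mu T_t=\begin{cases} v_{\mu\cdot s_t}&\mu_t<\mu_{t+1},\\ q^{-1}v_{\mu\cdot s_t}&\mu_t=\mu_{t+1},\\ v_{\mu\cdot s_t}+(q^{-1}-q)v_\mu&\mu_t>\mu_{t+1},\end{cases} \qquad v_\mu T_0=\begin{cases} v_{\mu\cdot s_0}&0<\mu_1,\\ Q^{-1}v_{\mu\cdot s_0}&0=\mu_1,\\ v_{\mu\cdot s_0}+(Q^{-1}-Q)v_\mu&0>\mu_1,\end{cases} \] and $\mathcal H^{\mathrm A}_q(\Sigma_d)$ acts by the formulas for $T_1,\dots,T_{d-1}$. Put \[ S^{\mathrm A}_q(n,d)=\mathrm{End}_{\mathcal H^{\mathrm A}_q(\Sigma_d)}(V(n)^{\otimes d}),\qquad S^{\mathrm B}_{Q,q}(n,d)=\mathrm{End}_{\mathcal H^{\mathrm B}_{Q,q}(d)}(V(n)^{\otimes d}). \] Suppose that \[ f^{\mathrm B}_d(Q,q)=\prod_{i=1-d}^{d-1}\left(Q^{-2}+q^{2i}\right)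 \] is invertible in $K$. Then there is an isomorphism of $K$-algebras \[ S^{\mathrm B}_{Q,q}(n,d)\;\cong\;\bigoplus_{i=0}^{d} S^{\mathrm A}_q(\lceil n/2\rceil,i)\otimes_K S^{\mathrm A}_q(\lfloor n/2\rfloor,d-i). \] -/

import Mathlib

open scoped TensorProduct

noncomputable section

namespace QSchur

/-- The index set `I(n)`: the integers in `[-r, r]` if `n = 2r + 1`, and the nonzero integers in
`[-r, r]` if `n = 2r`. -/
def I (n : ℕ) : Finset ℤ :=
  (Finset.Icc (-((n / 2 : ℕ) : ℤ)) ((n / 2 : ℕ) : ℤ)).filter fun i => Even n → i ≠ 0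

/-- The involution `i ↦ -i` of `I(n)`. -/
def neg {n : ℕ} (i : I n) : I n :=
  ⟨-i.1, by
    have h := i.2
    simp only [I, Finset.mem_filter, Finset.mem_Icc] at h ⊢
    exact ⟨⟨by omega, by omega⟩, fun hn h0 => h.2 hn (by omega)⟩⟩

@[simp] theorem coe_neg {n : ℕ} (i : I n) : (neg i : ℤ) = -(i : ℤ) := rfl

@[simp] theorem neg_neg {n : ℕ} (i : I n) : neg (neg i) = i := Subtype.ext (by simp)

section TensorSpace

variable (K : Type*) [Field K] (n d : ℕ)

/-- The tensor space `V^{⊗ d}`, where `V = V(n)` is the vector space with basis indexed by `I(n)`. -/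
abbrev TensorSpace : Type _ := PiTensorProduct K fun _ : Fin d => (I n → K)

/-- The basis `v_μ = v_{μ_1} ⊗ ⋯ ⊗ v_{μ_d}`, `μ ∈ I(n)^d`, of `V^{⊗ d}`. -/
def v : Module.Basis (Fin d → I n) K (TensorSpace K n d) :=
  Basis.piTensorProduct fun _ => Pi.basisFun K (I n)

variable {K n d}

/-- The operator that acts on the (distinct) tensor positions `a`, `b` as `T_t` acts on the
positions `t`, `t + 1`. -/
def swapOp (q : Kˣ) (a b : Fin d) : Module.End K (TensorSpace K n d) :=
  (v K n d).constr K fun μ =>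
    if (μ a : ℤ) < μ b then v K n d (μ ∘ Equiv.swap a b)
    else if (μ a : ℤ) = μ b then (q : K)⁻¹ • v K n d (μ ∘ Equiv.swap a b)
    else v K n d (μ ∘ Equiv.swap a b) + ((q : K)⁻¹ - q) • v K n d μ

/-- The operator that acts on the tensor position `a` as `T_0` acts on the first position. -/
def signOp (Q : Kˣ) (a : Fin d) : Module.End K (TensorSpace K n d) :=
  (v K n d).constr K fun μ =>
    if 0 < (μ a : ℤ) then v K n d (Function.update μ a (neg (μ a)))
    else if 0 = (μ a : ℤ) then (Q : K)⁻¹ • v K n d (Function.update μ a (neg (μ a)))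
    else v K n d (Function.update μ a (neg (μ a))) + ((Q : K)⁻¹ - Q) • v K n d μ

theorem swapOp_lt (q : Kˣ) (a b : Fin d) (μ : Fin d → I n) (h : (μ a : ℤ) < μ b) :
    swapOp q a b (v K n d μ) = v K n d (μ ∘ Equiv.swap a b) := by
  rw [swapOp, Module.Basis.constr_basis, if_pos h]

theorem swapOp_eq (q : Kˣ) (a b : Fin d) (μ : Fin d → I n) (h : (μ a : ℤ) = μ b) :
    swapOp q a b (v K n d μ) = (q : K)⁻¹ • v K n d (μ ∘ Equiv.swap a b) := by
  rw [swapOp, Module.Basis.constr_basis, if_neg (by omega), if_pos h]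

theorem swapOp_gt (q : Kˣ) (a b : Fin d) (μ : Fin d → I n) (h : (μ b : ℤ) < μ a) :
    swapOp q a b (v K n d μ) =
      v K n d (μ ∘ Equiv.swap a b) + ((q : K)⁻¹ - q) • v K n d μ := by
  rw [swapOp, Module.Basis.constr_basis, if_neg (by omega), if_neg (by omega)]

theorem signOp_pos (Q : Kˣ) (a : Fin d) (μ : Fin d → I n) (h : 0 < (μ a : ℤ)) :
    signOp Q a (v K n d μ) = v K n d (Function.update μ a (neg (μ a))) := by
  rw [signOp, Module.Basis.constr_basis, if_pos h]

theorem signOp_zero (Q : Kˣ) (a : Fin d) (μ : Fin d → I n) (h : (μ a : ℤ) = 0) :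
    signOp Q a (v K n d μ) = (Q : K)⁻¹ • v K n d (Function.update μ a (neg (μ a))) := by
  rw [signOp, Module.Basis.constr_basis, if_neg (by omega), if_pos h.symm]

theorem signOp_neg (Q : Kˣ) (a : Fin d) (μ : Fin d → I n) (h : (μ a : ℤ) < 0) :
    signOp Q a (v K n d μ) =
      v K n d (Function.update μ a (neg (μ a))) + ((Q : K)⁻¹ - Q) • v K n d μ := by
  rw [signOp, Module.Basis.constr_basis, if_neg (by omega), if_neg (by omega)]

/-! The operators satisfy the defining relations of the Hecke algebras. -/

theorem swapOp_sq (q : Kˣ) (a b : Fin d) :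
    swapOp (n := n) q a b * swapOp q a b = ((q : K)⁻¹ - q) • swapOp q a b + 1 := by
  refine (v K n d).ext fun μ => ?_
  have hs : (μ ∘ Equiv.swap a b) ∘ Equiv.swap a b = μ := by
    funext i; simp
  have hq : (q : K) ≠ 0 := q.ne_zero
  simp only [Module.End.mul_apply, LinearMap.add_apply, LinearMap.smul_apply, Module.End.one_apply]
  rcases lt_trichotomy (μ a : ℤ) (μ b) with h | h | h
  · rw [swapOp_lt _ _ _ _ h, swapOp_gt _ _ _ _ (by simpa using h), hs]
    module
  · rw [swapOp_eq _ _ _ _ h, map_smul, swapOp_eq _ _ _ _ (by simpa using h.symm), hs]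
    have h2 : μ ∘ Equiv.swap a b = μ := by
      funext i
      have h' : μ a = μ b := Subtype.ext h
      simp only [Function.comp, Equiv.swap_apply_def]
      split_ifs <;> simp_all
    rw [h2]
    match_scalars
    field_simp
    ring
  · rw [swapOp_gt _ _ _ _ h, map_add, map_smul, swapOp_lt _ _ _ _ (by simpa using h),
      swapOp_gt _ _ _ _ h, hs]
    module

theorem signOp_sq (Q : Kˣ) (a : Fin d) :
    signOp (n := n) Q a * signOp Q a = ((Q : K)⁻¹ - Q) • signOp Q a + 1 := by
  refine (v K n d).ext fun μ => ?_
  have hQ : (Q : K) ≠ 0 := Q.ne_zero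
  simp only [Module.End.mul_apply, LinearMap.add_apply, LinearMap.smul_apply, Module.End.one_apply]
  rcases lt_trichotomy 0 (μ a : ℤ) with h | h | h
  · rw [signOp_pos _ _ _ h, signOp_neg _ _ _ (by simpa using h)]
    simp
    module
  · have h2 : neg (μ a) = μ a := Subtype.ext (by simp; omega)
    rw [signOp_zero _ _ _ h.symm, h2, Function.update_eq_self, map_smul, signOp_zero _ _ _ h.symm,
      h2, Function.update_eq_self]
    match_scalars
    field_simp
    ring
  · rw [signOp_neg _ _ _ h, map_add, map_smul, signOp_pos _ _ _ (by simpa using h),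
      signOp_neg _ _ _ h]
    simp
    module

theorem swapOp_comm (q : Kˣ) (a b c e : Fin d) (hac : a ≠ c) (hae : a ≠ e) (hbc : b ≠ c)
    (hbe : b ≠ e) :
    swapOp (n := n) q a b * swapOp q c e = swapOp q c e * swapOp q a b := by
  refine (v K n d).ext fun μ => ?_
  have hs : (μ ∘ Equiv.swap a b) ∘ Equiv.swap c e = (μ ∘ Equiv.swap c e) ∘ Equiv.swap a b := by
    funext i
    simp only [Function.comp, Equiv.swap_apply_def]
    congr 1
    split_ifs <;> simp_all
  have h1 : (μ ∘ Equiv.swap a b) c = μ c := by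
    simp [Equiv.swap_apply_of_ne_of_ne hac.symm hbc.symm]
  have h2 : (μ ∘ Equiv.swap a b) e = μ e := by
    simp [Equiv.swap_apply_of_ne_of_ne hae.symm hbe.symm]
  have h3 : (μ ∘ Equiv.swap c e) a = μ a := by
    simp [Equiv.swap_apply_of_ne_of_ne hac hae]
  have h4 : (μ ∘ Equiv.swap c e) b = μ b := by
    simp [Equiv.swap_apply_of_ne_of_ne hbc hbe]
  simp only [Module.End.mul_apply]
  rcases lt_trichotomy (μ a : ℤ) (μ b) with h | h | h <;>
  rcases lt_trichotomy (μ c : ℤ) (μ e) with h' | h' | h' <;>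
  simp (disch := (try simp only [h1, h2, h3, h4]); omega) only
    [swapOp_lt, swapOp_eq, swapOp_gt, map_add, map_smul, hs] <;> module

theorem signOp_comm (q Q : Kˣ) (a b c : Fin d) (hab : a ≠ b) (hac : a ≠ c) :
    signOp (n := n) Q a * swapOp q b c = swapOp q b c * signOp Q a := by
  refine (v K n d).ext fun μ => ?_
  have h1 : (μ ∘ Equiv.swap b c) a = μ a := by
    simp [Equiv.swap_apply_of_ne_of_ne hab hac]
  have hs : Function.update (μ ∘ Equiv.swap b c) a (neg (μ a)) =
      Function.update μ a (neg (μ a)) ∘ Equiv.swap b c := by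
    funext i
    simp only [Function.comp, Equiv.swap_apply_def, Function.update_apply]
    split_ifs <;> simp_all
  have h2 : Function.update μ a (neg (μ a)) b = μ b := by simp [hab.symm]
  have h3 : Function.update μ a (neg (μ a)) c = μ c := by simp [hac.symm]
  simp only [Module.End.mul_apply]
  rcases lt_trichotomy (μ b : ℤ) (μ c) with h | h | h <;>
  rcases lt_trichotomy (μ a : ℤ) 0 with h' | h' | h' <;>
  simp (disch := (try simp only [h1, h2, h3]); omega) only
    [swapOp_lt, swapOp_eq, swapOp_gt, signOp_pos, signOp_neg, signOp_zero, map_add, map_smul,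
      h1, hs] <;> module

/-- The index `μ` with the entries at the positions `a`, `b`, `c` replaced. -/
def put3 (μ : Fin d → I n) (a b c : Fin d) (x y z : I n) : Fin d → I n :=
  fun i => if i = a then x else if i = b then y else if i = c then z else μ i

theorem swapOp_braid (q : Kˣ) (a b c : Fin d) (hab : a ≠ b) (hac : a ≠ c) (hbc : b ≠ c) :
    swapOp (n := n) q a b * swapOp q b c * swapOp q a b =
      swapOp q b c * swapOp q a b * swapOp q b c := by
  refine (v K n d).ext fun μ => ?_
  have ha : ∀ x y z, put3 μ a b c x y z a = x := by intros; simp [put3]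
  have hb : ∀ x y z, put3 μ a b c x y z b = y := by intros; simp [put3, hab.symm]
  have hc : ∀ x y z, put3 μ a b c x y z c = z := by intros; simp [put3, hac.symm, hbc.symm]
  have h1 : ∀ x y z, put3 μ a b c x y z ∘ Equiv.swap a b = put3 μ a b c y x z := by
    intros; funext i; simp only [put3, Function.comp, Equiv.swap_apply_def]
    split_ifs <;> simp_all
  have h2 : ∀ x y z, put3 μ a b c x y z ∘ Equiv.swap b c = put3 μ a b c x z y := by
    intros; funext i; simp only [put3, Function.comp, Equiv.swap_apply_def]
    split_ifs <;> simp_all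
  have hμ : μ = put3 μ a b c (μ a) (μ b) (μ c) := by
    funext i; simp only [put3]; split_ifs <;> simp_all
  rw [hμ]
  generalize μ a = x, μ b = y, μ c = z
  simp only [Module.End.mul_apply]
  rcases lt_trichotomy (x : ℤ) y with h | h | h <;>
  rcases lt_trichotomy (y : ℤ) z with h' | h' | h' <;>
  rcases lt_trichotomy (x : ℤ) z with h'' | h'' | h'' <;>
  first
  | omega
  | (simp (disch := (try simp only [ha, hb, hc]); omega) only
      [swapOp_lt, swapOp_eq, swapOp_gt, map_add, map_smul, h1, h2]
     try rw [show x = y from Subtype.ext h]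
     try rw [show y = z from Subtype.ext h']
     try rw [show x = z from Subtype.ext h'']
     first
     | done
     | module
     | (match_scalars <;> field_simp <;> ring))

theorem signOp_braid (q Q : Kˣ) (a b : Fin d) (hab : a ≠ b) :
    signOp (n := n) Q a * swapOp q a b * (signOp Q a * swapOp q a b) =
      swapOp q a b * signOp Q a * (swapOp q a b * signOp Q a) := by
  refine (v K n d).ext fun μ => ?_
  have ha : ∀ x y z, put3 μ a b b x y z a = x := by intros; simp [put3]
  have hb : ∀ x y z, put3 μ a b b x y z b = y := by intros; simp [put3, hab.symm]
  have h1 : ∀ x y, put3 μ a b b x y y ∘ Equiv.swap a b = put3 μ a b b y x x := by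
    intros; funext i; simp only [put3, Function.comp, Equiv.swap_apply_def]
    split_ifs <;> simp_all
  have h2 : ∀ x y w, Function.update (put3 μ a b b x y y) a w = put3 μ a b b w y y := by
    intros; funext i; simp only [put3, Function.update_apply]
    split_ifs <;> simp_all
  have hμ : μ = put3 μ a b b (μ a) (μ b) (μ b) := by
    funext i; simp only [put3]; split_ifs <;> simp_all
  rw [hμ]
  generalize μ a = x, μ b = y
  simp only [Module.End.mul_apply]
  rcases lt_trichotomy (x : ℤ) 0 with h | h | h <;>
  rcases lt_trichotomy (y : ℤ) 0 with h' | h' | h' <;>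
  rcases lt_trichotomy (x : ℤ) y with h'' | h'' | h'' <;>
  rcases lt_trichotomy (x : ℤ) (-y) with h3 | h3 | h3 <;>
  first
  | omega
  | (simp (disch := (try simp only [ha, hb, coe_neg]); omega) only
      [swapOp_lt, swapOp_eq, swapOp_gt, signOp_pos, signOp_neg, signOp_zero, map_add, map_smul,
        h1, h2, ha, neg_neg]
     try rw [show x = y from Subtype.ext h'']
     try rw [show x = neg y from Subtype.ext h3]
     try rw [show neg y = y from Subtype.ext (by rw [coe_neg]; omega)]
     try rw [show neg x = x from Subtype.ext (by rw [coe_neg]; omega)]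
     try simp only [neg_neg]
     first
     | done
     | module
     | (match_scalars <;> field_simp <;> ring))

end TensorSpace

section Hecke

variable {K : Type*} [Field K]

/-- The defining relations of the Hecke algebra of type `B` on the generators `T_0, …, T_{d-1}`. -/
inductive RelB (q Q : Kˣ) (d : ℕ) : FreeAlgebra K (Fin d) → FreeAlgebra K (Fin d) → Prop
  | braid (i j : Fin d) (hi : 1 ≤ i.val) (hij : j.val = i.val + 1) :
      RelB q Q d (.ι K i * .ι K j * .ι K i) (.ι K j * .ι K i * .ι K j)
  | braidZero (i j : Fin d) (hi : i.val = 0) (hj : j.val = 1) :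
      RelB q Q d ((.ι K i * .ι K j) ^ 2) ((.ι K j * .ι K i) ^ 2)
  | comm (i j : Fin d) (hij : i.val + 1 < j.val) :
      RelB q Q d (.ι K i * .ι K j) (.ι K j * .ι K i)
  | quadZero (i : Fin d) (hi : i.val = 0) :
      RelB q Q d (.ι K i ^ 2) (((Q : K)⁻¹ - Q) • .ι K i + 1)
  | quad (i : Fin d) (hi : 1 ≤ i.val) :
      RelB q Q d (.ι K i ^ 2) (((q : K)⁻¹ - q) • .ι K i + 1)

/-- The two-parameter Hecke algebra `H^B_{Q,q}(d)` of type `B`. -/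
abbrev HeckeB (q Q : Kˣ) (d : ℕ) : Type _ := RingQuot (RelB q Q d)

/-- The defining relations of the Hecke algebra of the symmetric group `Σ_d` on the generators
`T_1, …, T_{d-1}`; the generator `T_{k+1}` is indexed by `k : Fin (d - 1)`. -/
inductive RelA (q : Kˣ) (d : ℕ) :
    FreeAlgebra K (Fin (d - 1)) → FreeAlgebra K (Fin (d - 1)) → Prop
  | braid (i j : Fin (d - 1)) (hij : j.val = i.val + 1) :
      RelA q d (.ι K i * .ι K j * .ι K i) (.ι K j * .ι K i * .ι K j)
  | comm (i j : Fin (d - 1)) (hij : i.val + 1 < j.val) :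
      RelA q d (.ι K i * .ι K j) (.ι K j * .ι K i)
  | quad (i : Fin (d - 1)) :
      RelA q d (.ι K i ^ 2) (((q : K)⁻¹ - q) • .ι K i + 1)

/-- The Hecke algebra `H^A_q(Σ_d)` of the symmetric group. -/
abbrev HeckeA (q : Kˣ) (d : ℕ) : Type _ := RingQuot (RelA q d)

/-- The operator `x ↦ x T_{k+1}` on `V^{⊗ d}` (positions are counted from zero). -/
def opA (q : Kˣ) (n d : ℕ) (k : Fin (d - 1)) : Module.End K (TensorSpace K n d) :=
  swapOp q ⟨k.val, by omega⟩ ⟨k.val + 1, by omega⟩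

/-- The operator `x ↦ x T_t` on `V^{⊗ d}`, `0 ≤ t ≤ d - 1`. -/
def opB (q Q : Kˣ) (n d : ℕ) (t : Fin d) : Module.End K (TensorSpace K n d) :=
  if t.val = 0 then signOp Q t else swapOp q ⟨t.val - 1, by omega⟩ t

/-- The right action of `H^A_q(Σ_d)` on `V^{⊗ d}`, as a homomorphism to the opposite of the algebra
of linear endomorphisms. -/
def actionA (q : Kˣ) (n d : ℕ) : HeckeA q d →ₐ[K] (Module.End K (TensorSpace K n d))ᵐᵒᵖ :=
  RingQuot.liftAlgHom K ⟨FreeAlgebra.lift K fun k => MulOpposite.op (opA q n d k), by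
    intro x y h
    apply MulOpposite.unop_injective
    induction h with
    | braid i j hij =>
      obtain ⟨j, hj⟩ := j
      obtain rfl : j = i.val + 1 := hij
      simp only [map_mul, FreeAlgebra.lift_ι_apply, MulOpposite.unop_mul, MulOpposite.unop_op,
        ← mul_assoc, opA]
      apply swapOp_braid <;> simp only [ne_eq, Fin.ext_iff] <;> omega
    | comm i j hij =>
      simp only [map_mul, FreeAlgebra.lift_ι_apply, MulOpposite.unop_mul, MulOpposite.unop_op, opA]
      apply swapOp_comm <;> simp only [ne_eq, Fin.ext_iff] <;> omega
    | quad i =>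
      rw [pow_two]
      simp only [map_mul, map_add, map_smul, map_one, FreeAlgebra.lift_ι_apply,
        MulOpposite.unop_mul, MulOpposite.unop_add, MulOpposite.unop_smul, MulOpposite.unop_one,
        MulOpposite.unop_op, opA]
      apply swapOp_sq⟩

/-- The right action of `H^B_{Q,q}(d)` on `V^{⊗ d}`, as a homomorphism to the opposite of the
algebra of linear endomorphisms. -/
def actionB (q Q : Kˣ) (n d : ℕ) : HeckeB q Q d →ₐ[K] (Module.End K (TensorSpace K n d))ᵐᵒᵖ :=
  RingQuot.liftAlgHom K ⟨FreeAlgebra.lift K fun t => MulOpposite.op (opB q Q n d t), by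
    intro x y h
    apply MulOpposite.unop_injective
    induction h with
    | braid i j hi hij =>
      have hj : (⟨j.val - 1, by omega⟩ : Fin d) = i := Fin.ext (by simp; omega)
      simp only [map_mul, FreeAlgebra.lift_ι_apply, MulOpposite.unop_mul, MulOpposite.unop_op,
        ← mul_assoc, opB]
      rw [if_neg (by omega), if_neg (by omega), hj]
      apply swapOp_braid <;> simp only [ne_eq, Fin.ext_iff] <;> omega
    | braidZero i j hi hj =>
      have hj' : (⟨j.val - 1, by omega⟩ : Fin d) = i := Fin.ext (by simp; omega)
      simp only [map_mul, FreeAlgebra.lift_ι_apply, MulOpposite.unop_mul,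
        MulOpposite.unop_op, opB, pow_two]
      rw [if_pos hi, if_neg (by omega), hj']
      exact (signOp_braid q Q i j (by simp only [ne_eq, Fin.ext_iff]; omega)).symm
    | comm i j hij =>
      simp only [map_mul, FreeAlgebra.lift_ι_apply, MulOpposite.unop_mul, MulOpposite.unop_op, opB]
      rw [if_neg (show ¬ j.val = 0 by omega)]
      split_ifs with hi
      · exact (signOp_comm q Q i _ j (by simp only [ne_eq, Fin.ext_iff]; omega)
          (by simp only [ne_eq, Fin.ext_iff]; omega)).symm
      · apply swapOp_comm <;> simp only [ne_eq, Fin.ext_iff] <;> omega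
    | quadZero i hi =>
      rw [pow_two]
      simp only [map_mul, map_add, map_smul, map_one, FreeAlgebra.lift_ι_apply,
        MulOpposite.unop_mul, MulOpposite.unop_add, MulOpposite.unop_smul, MulOpposite.unop_one,
        MulOpposite.unop_op, opB, if_pos hi]
      apply signOp_sq
    | quad i hi =>
      rw [pow_two]
      simp only [map_mul, map_add, map_smul, map_one, FreeAlgebra.lift_ι_apply,
        MulOpposite.unop_mul, MulOpposite.unop_add, MulOpposite.unop_smul, MulOpposite.unop_one,
        MulOpposite.unop_op, opB, if_neg (show ¬ i.val = 0 by omega)]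
      apply swapOp_sq⟩

/-- For a right action `ρ` of a `K`-algebra `H` on `M`, written `x · h = (ρ h).unop x`, the
`K`-algebra `End_H(M)` of endomorphisms `φ` with `φ (x · h) = φ x · h`. -/
def endRight {H M : Type*} [Ring H] [Algebra K H] [AddCommGroup M] [Module K M]
    (ρ : H →ₐ[K] (Module.End K M)ᵐᵒᵖ) : Subalgebra K (Module.End K M) where
  carrier := {φ | ∀ (h : H) (x : M), φ ((ρ h).unop x) = (ρ h).unop (φ x)}
  mul_mem' := by
    intro φ ψ hφ hψ h x
    rw [Module.End.mul_apply, Module.End.mul_apply, hψ, hφ]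
  add_mem' := by
    intro φ ψ hφ hψ h x
    rw [LinearMap.add_apply, LinearMap.add_apply, hψ, hφ, map_add]
  algebraMap_mem' := by
    intro r h x
    simp [Module.algebraMap_end_apply]

/-- The `q`-Schur algebra `S^A_q(n, d) = End_{H^A_q(Σ_d)}(V^{⊗ d})` of type `A`. -/
abbrev SchurA (q : Kˣ) (n d : ℕ) : Subalgebra K (Module.End K (TensorSpace K n d)) :=
  endRight (actionA q n d)

/-- The `q`-Schur algebra `S^B_{Q,q}(n, d) = End_{H^B_{Q,q}(d)}(V^{⊗ d})` of type `B`. -/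
abbrev SchurB (q Q : Kˣ) (n d : ℕ) : Subalgebra K (Module.End K (TensorSpace K n d)) :=
  endRight (actionB q Q n d)

/-- `f^B_d(Q, q) = ∏_{i = 1 - d}^{d - 1} (Q^{-2} + q^{2i})`. -/
def fB (q Q : Kˣ) (d : ℕ) : K :=
  ∏ i ∈ Finset.Icc (1 - (d : ℤ)) ((d : ℤ) - 1), ((Q : K) ^ (-2 : ℤ) + (q : K) ^ (2 * i))

end Hecke

end QSchur

end

noncomputable section

namespace QSchur

section Relations

variable {K A : Type*} [Field K] [Ring A] [Algebra K A]

/-- The elements `T 0, …, T (d - 1)` of an algebra satisfy the defining relations of the Hecke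
algebra of type `B`. -/
structure IsHeckeB (q Q : Kˣ) (d : ℕ) (T : ℕ → A) : Prop where
  quadZero : 0 < d → T 0 * T 0 = ((Q : K)⁻¹ - Q) • T 0 + 1
  quad : ∀ k, k + 1 < d → T (k + 1) * T (k + 1) = ((q : K)⁻¹ - q) • T (k + 1) + 1
  braidZero : 1 < d → T 0 * T 1 * (T 0 * T 1) = T 1 * T 0 * (T 1 * T 0)
  braid : ∀ k, k + 2 < d →
    T (k + 1) * T (k + 2) * T (k + 1) = T (k + 2) * T (k + 1) * T (k + 2)
  comm : ∀ i j, i + 1 < j → j < d → T i * T j = T j * T i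

/-- The Jucys–Murphy elements. -/
def jm (T : ℕ → A) : ℕ → A
  | 0 => T 0
  | k + 1 => T (k + 1) * jm T k * T (k + 1)

/-- The intertwiner of the positions `k`, `k + 1`. -/
def intw (q : Kˣ) (T : ℕ → A) (k : ℕ) : A :=
  T (k + 1) * (jm T k - jm T (k + 1)) + ((q : K)⁻¹ - q) • jm T (k + 1)

namespace IsHeckeB

variable {q Q : Kˣ} {d : ℕ} {T : ℕ → A} (h : IsHeckeB q Q d T)
include h

theorem jm_comm_of_lt {k j : ℕ} (hkj : k + 1 < j) (hj : j < d) : Commute (jm T k) (T j) := by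
  induction k with
  | zero => exact h.comm 0 j hkj hj
  | succ k ih =>
    have h1 : Commute (T (k + 1)) (T j) := h.comm _ _ hkj hj
    exact (h1.mul_left (ih (by omega))).mul_left h1

theorem jm_comm_of_gt {k j : ℕ} (hjk : j < k) (hk : k < d) : Commute (jm T k) (T j) := by
  induction k using Nat.strong_induction_on generalizing j with
  | _ k ih =>
    obtain _ | _ | k := k
    · omega
    · obtain rfl : j = 0 := by omega
      have := h.braidZero hk
      simp only [jm, Commute, SemiconjBy, zero_add]
      simp only [mul_assoc] at this ⊢
      exact this.symm
    · by_cases hj : j = k + 1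
      · subst hj
        have hb := h.braid k hk
        have hc : Commute (jm T k) (T (k + 2)) := h.jm_comm_of_lt (by omega) hk
        simp only [jm, Commute, SemiconjBy, add_assoc, Nat.reduceAdd]
        calc T (k + 2) * (T (k + 1) * jm T k * T (k + 1)) * T (k + 2) * T (k + 1)
            = T (k + 2) * T (k + 1) * jm T k * (T (k + 1) * T (k + 2) * T (k + 1)) := by
              simp only [mul_assoc]
          _ = T (k + 2) * T (k + 1) * (jm T k * T (k + 2)) * T (k + 1) * T (k + 2) := by
              rw [hb]; simp only [mul_assoc]
          _ = (T (k + 2) * T (k + 1) * T (k + 2)) * jm T k * T (k + 1) * T (k + 2) := by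
              rw [hc.eq]; simp only [mul_assoc]
          _ = _ := by rw [← hb]; simp only [mul_assoc]
      · have h1 : Commute (T (k + 2)) (T j) := (h.comm _ _ (by omega) hk).symm
        exact (h1.mul_left (ih (k + 1) (by omega) (by omega) (by omega))).mul_left h1

theorem jm_commute {i j : ℕ} (hi : i < d) (hj : j < d) : Commute (jm T i) (jm T j) := by
  have key : ∀ i k, i ≤ k → i < k → k < d → Commute (jm T k) (jm T i) := by
    intro i k
    induction i with
    | zero => intro _ h0 hk; exact h.jm_comm_of_gt h0 hk
    | succ i ih =>
      intro _ h0 hk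
      have h1 := h.jm_comm_of_gt h0 hk
      exact (h1.mul_right (ih (by omega) (by omega) hk)).mul_right h1
  rcases lt_trichotomy i j with h1 | rfl | h1
  · exact (key i j h1.le h1 hj).symm
  · exact Commute.refl _
  · exact key j i h1.le h1 hi

theorem T_mul_jm {k : ℕ} (hk : k + 1 < d) :
    T (k + 1) * jm T k = jm T (k + 1) * T (k + 1) - ((q : K)⁻¹ - q) • jm T (k + 1) := by
  simp only [jm, mul_assoc, h.quad k hk, mul_add, mul_smul_comm, mul_one]
  abel

theorem T_mul_jm_succ {k : ℕ} (hk : k + 1 < d) :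
    T (k + 1) * jm T (k + 1) = ((q : K)⁻¹ - q) • jm T (k + 1) + jm T k * T (k + 1) := by
  simp only [jm, ← mul_assoc, h.quad k hk, add_mul, smul_mul_assoc, one_mul]

theorem intw_mul_jm {k : ℕ} (hk : k + 1 < d) :
    intw q T k * jm T k = jm T (k + 1) * intw q T k := by
  have h1 := h.T_mul_jm hk
  have h2 := h.T_mul_jm_succ hk
  have h3 := (h.jm_commute (i := k) (j := k + 1) (by omega) hk).eq
  simp only [intw]
  generalize jm T k = x at *
  generalize jm T (k + 1) = y at *
  generalize T (k + 1) = t at *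
  generalize (q : K)⁻¹ - q = c at *
  have e1 : t * (x - y) * x = (t * x) * x - (t * x) * y := by
    rw [mul_assoc, sub_mul, ← h3, mul_sub, mul_assoc, mul_assoc]
  rw [add_mul, e1, mul_add, mul_sub, h1, h2]
  simp only [sub_mul, mul_sub, mul_add, mul_assoc, smul_mul_assoc, mul_smul_comm, h1, h2]
  abel

theorem T_commute_add {k : ℕ} (hk : k + 1 < d) :
    Commute (T (k + 1)) (jm T k + jm T (k + 1)) := by
  rw [Commute, SemiconjBy, mul_add, h.T_mul_jm hk, h.T_mul_jm_succ hk, add_mul]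
  abel

theorem T_commute_mul {k : ℕ} (hk : k + 1 < d) :
    Commute (T (k + 1)) (jm T k * jm T (k + 1)) := by
  rw [Commute, SemiconjBy, ← mul_assoc, h.T_mul_jm hk, sub_mul, mul_assoc, h.T_mul_jm_succ hk,
    mul_add, (h.jm_commute (i := k) (j := k + 1) (by omega) hk).eq, smul_mul_assoc, mul_smul_comm,
    mul_assoc]
  abel

theorem intw_mul_jm_succ {k : ℕ} (hk : k + 1 < d) :
    intw q T k * jm T (k + 1) = jm T k * intw q T k := by
  have h1 : Commute (intw q T k) (jm T k + jm T (k + 1)) := by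
    have hxy := h.jm_commute (i := k) (j := k + 1) (by omega) hk
    refine Commute.add_left (Commute.mul_left (h.T_commute_add hk) ?_) (Commute.smul_left ?_ _)
    · exact Commute.add_right ((Commute.refl _).sub_left hxy.symm)
        (hxy.sub_left (Commute.refl _))
    · exact Commute.add_right hxy.symm (Commute.refl _)
  have h2 := h1.eq
  rw [mul_add, add_mul, h.intw_mul_jm hk, add_comm (jm T k * _)] at h2
  exact add_left_cancel h2

theorem T_commute_jm {k j : ℕ} (hk : k + 1 < d) (hj : j < d) (h0 : j ≠ k) (h1 : j ≠ k + 1) :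
    Commute (T (k + 1)) (jm T j) := by
  rcases lt_or_gt_of_ne h1 with h2 | h2
  · exact (h.jm_comm_of_lt (by omega) hk).symm
  · exact (h.jm_comm_of_gt h2 hj).symm

theorem intw_mul_jm_of_ne {k j : ℕ} (hk : k + 1 < d) (hj : j < d) (h0 : j ≠ k) (h1 : j ≠ k + 1) :
    Commute (intw q T k) (jm T j) := by
  have hT := h.T_commute_jm hk hj h0 h1
  have h2 := h.jm_commute (i := k) (j := j) (by omega) hj
  have h3 := h.jm_commute hk hj
  exact (hT.mul_left (h2.sub_left h3)).add_left (h3.smul_left _)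

theorem intw_sq {k : ℕ} (hk : k + 1 < d) :
    intw q T k * intw q T k =
      -((jm T k - (q : K) ^ 2 • jm T (k + 1)) * (jm T k - ((q : K)⁻¹) ^ 2 • jm T (k + 1))) := by
  have h1 := h.T_mul_jm hk
  have h2 := h.T_mul_jm_succ hk
  have h3 := (h.jm_commute (i := k) (j := k + 1) (by omega) hk).eq
  have h4 := h.quad k hk
  have hq : (q : K) ≠ 0 := q.ne_zero
  simp only [intw]
  generalize jm T k = x at *
  generalize jm T (k + 1) = y at *
  generalize T (k + 1) = t at *
  have e1 : t * (x - y) = (y - x) * t - (2 * ((q : K)⁻¹ - q)) • y := by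
    rw [mul_sub, h1, h2, sub_mul]; module
  have e2 : t * (x - y) + ((q : K)⁻¹ - q) • y = (y - x) * t - ((q : K)⁻¹ - q) • y := by
    rw [e1]; module
  have e3 : ((y - x) * t - ((q : K)⁻¹ - q) • y) * (t * (x - y) + ((q : K)⁻¹ - q) • y) =
      (y - x) * ((t * t) * (x - y)) + ((q : K)⁻¹ - q) • ((y - x) * (t * y))
      - ((q : K)⁻¹ - q) • (y * (t * (x - y))) - ((q : K)⁻¹ - q) ^ 2 • (y * y) := by
    simp only [sub_mul, mul_add, smul_mul_assoc, mul_smul_comm, mul_assoc, smul_sub, smul_smul]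
    module
  nth_rw 1 [e2]
  rw [e3, h4, add_mul, smul_mul_assoc, e1, h2]
  simp only [sub_mul, mul_sub, mul_add, smul_mul_assoc, mul_smul_comm, one_mul, ← mul_assoc, h3]
  match_scalars <;> field_simp <;> ring

omit h in
/-- The braid relation between generators and intertwiners, in any algebra. -/
theorem braid_intw_aux {a b x y z : A} {c : K} (hxy : x * y = y * x) (hxz : x * z = z * x)
    (hyz : y * z = z * y) (hab : a * b * a = b * a * b) (ha : a * a = c • a + 1)
    (hb : b * b = c • b + 1) (hax : a * x = y * a - c • y) (hay : a * y = c • y + x * a)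
    (haz : a * z = z * a) (hbx : b * x = x * b) (hby : b * y = z * b - c • z)
    (hbz : b * z = c • z + y * b) :
    a * ((b * (y - z) + c • z) * (a * (x - y) + c • y)) =
        (b * (y - z) + c • z) * (a * (x - y) + c • y) * b ∧
      b * ((a * (x - y) + c • y) * (b * (y - z) + c • z)) =
        (a * (x - y) + c • y) * (b * (y - z) + c • z) * a := by
  have assoc {u w r : A} (e : u * w = r) (s : A) : u * (w * s) = r * s := by rw [← mul_assoc, e]
  have hab' : a * (b * a) = b * (a * b) := by simpa only [mul_assoc] using hab
  constructor <;>
  · simp only [mul_add, add_mul, mul_sub, sub_mul, smul_mul_assoc, mul_smul_comm, smul_add,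
      smul_sub, mul_assoc, hax, hay, haz, hby, hbz, hyz, assoc hax, assoc hay, assoc haz,
      assoc hbx, assoc hby, assoc hbz, assoc hxy, assoc hxz, assoc hyz, ha, hb, hab', mul_one]
    module

theorem T_mul_intw_mul_intw {k : ℕ} (hk : k + 2 < d) :
    T (k + 1) * (intw q T (k + 1) * intw q T k) = intw q T (k + 1) * intw q T k * T (k + 2) ∧
      T (k + 2) * (intw q T k * intw q T (k + 1)) = intw q T k * intw q T (k + 1) * T (k + 1) :=
  braid_intw_aux (h.jm_commute (by omega) (by omega)) (h.jm_commute (by omega) (by omega))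
    (h.jm_commute (by omega) (by omega)) (h.braid k hk) (h.quad k (by omega))
    (h.quad (k + 1) hk) (h.T_mul_jm (by omega)) (h.T_mul_jm_succ (by omega))
    (h.jm_comm_of_gt (by omega) hk).eq.symm (h.jm_comm_of_lt (by omega) hk).eq.symm
    (h.T_mul_jm hk) (h.T_mul_jm_succ hk)

theorem T_commute_intw {k j : ℕ} (hk : k + 1 < d) (hj : j + 1 < d) (hkj : k + 1 < j ∨ j + 1 < k) :
    Commute (T (k + 1)) (intw q T j) := by
  have h1 : Commute (T (k + 1)) (T (j + 1)) := by
    rcases hkj with h2 | h2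
    · exact h.comm _ _ (by omega) hj
    · exact (h.comm _ _ (by omega) hk).symm
  have h2 := h.T_commute_jm (k := k) (j := j) hk (by omega) (by omega) (by omega)
  have h3 := h.T_commute_jm (k := k) (j := j + 1) hk hj (by omega) (by omega)
  exact (h1.mul_right (h2.sub_right h3)).add_right (h3.smul_right _)

theorem intw_commute {k j : ℕ} (hk : k + 1 < d) (hj : j + 1 < d) (hkj : k + 1 < j ∨ j + 1 < k) :
    Commute (intw q T k) (intw q T j) := by
  have h1 := h.T_commute_intw hk hj hkj
  have h2 := h.intw_mul_jm_of_ne (k := j) (j := k) hj (by omega) (by omega) (by omega)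
  have h3 := h.intw_mul_jm_of_ne (k := j) (j := k + 1) hj hk (by omega) (by omega)
  exact (h1.mul_left (h2.sub_right h3).symm).add_left (h3.symm.smul_left _)

end IsHeckeB
end Relations
section LinearAlgebra

open Polynomial Module

variable {K : Type*} [Field K]

/-- An element annihilated by a nonzero split polynomial. -/
def IsSplit {A : Type*} [Ring A] [Algebra K A] (x : A) : Prop :=
  ∃ f : K[X], f ≠ 0 ∧ f.Splits ∧ aeval x f = 0

theorem exists_aeval_sub_eq {A : Type*} [Ring A] [Algebra K A] {x z : A} (hxz : Commute x z)
    (f : K[X]) :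
    ∃ w : A, (∀ s, Commute s x → Commute s z → Commute s w) ∧
      aeval x f - aeval z f = (x - z) * w := by
  induction f using Polynomial.induction_on' with
  | add f g hf hg =>
    obtain ⟨u, hu, hu'⟩ := hf
    obtain ⟨w, hw, hw'⟩ := hg
    refine ⟨u + w, fun s h1 h2 => (hu s h1 h2).add_right (hw s h1 h2), ?_⟩
    rw [map_add, map_add, mul_add, ← hu', ← hw']
    abel
  | monomial n a =>
    refine ⟨a • ∑ i ∈ Finset.range n, x ^ i * z ^ (n - 1 - i), fun s h1 h2 => ?_, ?_⟩
    · exact (Commute.sum_right _ _ _ fun i _ =>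
        (h1.pow_right _).mul_right (h2.pow_right _)).smul_right _
    · rw [mul_smul_comm, hxz.mul_geom_sum₂, aeval_monomial, aeval_monomial, ← mul_sub,
        Algebra.smul_def]

theorem aeval_semiconj {A : Type*} [Ring A] [Algebra K A] {x y φ : A} (h : φ * x = y * φ)
    (f : K[X]) : φ * aeval x f = aeval y f * φ := by
  induction f using Polynomial.induction_on' with
  | add f g hf hg => rw [map_add, map_add, mul_add, add_mul, hf, hg]
  | monomial n a =>
    have h' : SemiconjBy φ (x ^ n) (y ^ n) := SemiconjBy.pow_right h n
    rw [aeval_monomial, aeval_monomial, ← Algebra.smul_def, ← Algebra.smul_def, mul_smul_comm,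
      smul_mul_assoc, h'.eq]

theorem IsSplit.of_intertwine {A : Type*} [Ring A] [Algebra K A] {x y φ : A} {a b : K}
    (ha : a ≠ 0) (hb : b ≠ 0) (hxy : Commute x y) (h1 : φ * x = y * φ)
    (h2 : φ * φ = -((x - a • y) * (x - b • y))) (hx : IsSplit (K := K) x) :
    IsSplit (K := K) y := by
  obtain ⟨f, f0, fs, hf⟩ := hx
  have hcomp (c : K) : aeval y (f.comp (C c * X)) = aeval (c • y) f := by
    rw [aeval_comp]; simp [Algebra.smul_def]
  have hdeg (c : K) (hc : c ≠ 0) : (C c * X : K[X]).natDegree = 1 := by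
    simpa using natDegree_C_mul_X c hc
  have hne (c : K) (hc : c ≠ 0) : f.comp (C c * X) ≠ 0 := by
    intro h0
    rcases comp_eq_zero_iff.mp h0 with h | h
    · exact f0 h
    · have := congrArg natDegree h.2
      rw [hdeg c hc, natDegree_C] at this
      omega
  refine ⟨f * (f.comp (C a * X) * f.comp (C b * X)), mul_ne_zero f0
    (mul_ne_zero (hne a ha) (hne b hb)), ?_, ?_⟩
  · exact fs.mul ((fs.comp_of_natDegree_le_one (hdeg a ha).le).mul
      (fs.comp_of_natDegree_le_one (hdeg b hb).le))
  · obtain ⟨u, hu, hu'⟩ := exists_aeval_sub_eq (hxy.smul_right a) f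
    obtain ⟨w, hw, hw'⟩ := exists_aeval_sub_eq (hxy.smul_right b) f
    rw [hf, zero_sub] at hu' hw'
    have hux : Commute u (x - b • y) := by
      have h3 : Commute u x := (hu x (Commute.refl _) (hxy.smul_right a)).symm
      have h4 : Commute u y := (hu y hxy.symm ((Commute.refl _).smul_right a)).symm
      exact h3.sub_right (h4.smul_right b)
    have h5 : aeval (a • y) f * aeval (b • y) f = -(φ * φ) * (u * w) := by
      rw [← _root_.neg_neg (aeval (a • y) f), ← _root_.neg_neg (aeval (b • y) f), hu', hw', h2]
      simp only [neg_mul_neg, _root_.neg_neg]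
      rw [mul_assoc, ← mul_assoc u, hux.eq]
      simp only [mul_assoc]
    rw [map_mul, map_mul, hcomp, hcomp, h5, neg_mul, mul_neg, ← mul_assoc, ← mul_assoc,
      ← mul_assoc, ← aeval_semiconj h1, hf]
    simp

variable {M : Type*} [AddCommGroup M] [Module K M] [FiniteDimensional K M]

theorem map_eq_of_injOn {W : Submodule K M} {A : End K M} (hW : ∀ w ∈ W, A w ∈ W)
    (hA : ∀ w ∈ W, A w = 0 → w = 0) : W.map A = W := by
  have hinj : Function.Injective (A.restrict hW) := by
    rw [← LinearMap.ker_eq_bot, LinearMap.ker_eq_bot']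
    intro w hw
    exact Subtype.ext (hA w w.2 (by simpa using congrArg Subtype.val hw))
  have hsurj := LinearMap.surjective_of_injective hinj
  refine le_antisymm (Submodule.map_le_iff_le_comap.mpr hW) fun w hw => ?_
  obtain ⟨u, hu⟩ := hsurj ⟨w, hw⟩
  exact ⟨u, u.2, by simpa using congrArg Subtype.val hu⟩

theorem injOn_of_map_eq {W : Submodule K M} {A : End K M} (hW : W.map A = W) :
    ∀ w ∈ W, A w = 0 → w = 0 := by
  have hW' : ∀ w ∈ W, A w ∈ W := fun w hw => hW ▸ Submodule.mem_map_of_mem hw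
  have hsurj : Function.Surjective (A.restrict hW') := by
    rintro ⟨w, hw⟩
    obtain ⟨u, hu, rfl⟩ := hW.symm ▸ hw
    exact ⟨⟨u, hu⟩, rfl⟩
  have hinj := LinearMap.injective_iff_surjective.mpr hsurj
  intro w hw h0
  have : (⟨w, hw⟩ : W) = 0 := hinj (by rw [map_zero]; exact Subtype.ext h0)
  simpa using congrArg Subtype.val this

theorem map_sub_maxGenEigenspace (f : End K M) {μ c : K} (h : μ ≠ c) :
    (f.maxGenEigenspace μ).map (f - c • 1) = f.maxGenEigenspace μ := by
  refine map_eq_of_injOn (fun w hw => ?_) fun w hw h0 => ?_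
  · exact Submodule.sub_mem _ (End.mapsTo_maxGenEigenspace_of_comm (Commute.refl f) μ hw)
      (Submodule.smul_mem _ _ hw)
  · have h1 : w ∈ f.maxGenEigenspace c := (End.mem_maxGenEigenspace _ _ _).mpr ⟨1, by simpa using h0⟩
    exact (Submodule.disjoint_def.mp (End.disjoint_genEigenspace f h ⊤ ⊤)) w hw h1

theorem IsSplit.iSup_maxGenEigenspace {f : End K M} (hf : IsSplit (K := K) f) :
    ⨆ μ, f.maxGenEigenspace μ = ⊤ := by
  obtain ⟨p, p0, ps, hp⟩ := hf
  have key : ∀ (s : Multiset K) (m : M), aeval f (s.map fun a => X - C a).prod m = 0 →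
      m ∈ ⨆ μ, f.maxGenEigenspace μ := by
    intro s
    induction s using Multiset.induction_on with
    | empty => intro m hm; simp at hm; simp [hm]
    | cons c s ih =>
      intro m hm
      rw [Multiset.map_cons, Multiset.prod_cons, mul_comm, map_mul, End.mul_apply] at hm
      have h1 := ih _ hm
      have h2 : (⨆ μ, f.maxGenEigenspace μ) ≤
          (⨆ μ, f.maxGenEigenspace μ).map (f - c • 1) ⊔ f.maxGenEigenspace c := by
        refine iSup_le fun μ => ?_
        by_cases hμ : μ = c
        · subst hμ; exact le_sup_right
        · rw [← map_sub_maxGenEigenspace f hμ]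
          exact (Submodule.map_mono (le_iSup _ μ)).trans le_sup_left
      obtain ⟨_, ⟨u, hu, rfl⟩, w, hw, e⟩ := Submodule.mem_sup.mp (h2 h1)
      have h3 : m - u ∈ f.maxGenEigenspace c := by
        obtain ⟨k, hk⟩ := (End.mem_maxGenEigenspace _ _ _).mp hw
        refine (End.mem_maxGenEigenspace _ _ _).mpr ⟨k + 1, ?_⟩
        rw [pow_succ, End.mul_apply, map_sub]
        have : (f - c • 1) m = aeval f (X - C c) m := by simp [Algebra.smul_def]
        rw [this, ← e, add_sub_cancel_left, hk]
      have h4 := Submodule.add_mem _ (Submodule.mem_iSup_of_mem c h3) hu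
      simpa using h4
  rw [eq_top_iff]
  intro m _
  refine key p.roots m ?_
  rw [ps.eq_prod_roots, map_mul, aeval_C] at hp
  have h0 : p.leadingCoeff ≠ 0 := leadingCoeff_ne_zero.mpr p0
  have := congrArg (fun g : End K M => g m) hp
  simp only [End.mul_apply, Module.algebraMap_end_apply, LinearMap.zero_apply, smul_eq_zero,
    h0, false_or] at this
  exact this

variable {ι : Type*}

/-- A nonzero subspace stable under finitely many commuting triangularizable endomorphisms contains
a simultaneous eigenvector. -/
theorem exists_joint_eigenvector [Finite ι] {X : ι → End K M}
    (hX : ∀ i j, Commute (X i) (X j)) (hs : ∀ i, IsSplit (K := K) (X i)) {W : Submodule K M}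
    (hW : W ≠ ⊥) (hWX : ∀ i, ∀ w ∈ W, X i w ∈ W) :
    ∃ m ∈ W, m ≠ 0 ∧ ∃ x : ι → K, ∀ i, X i m = x i • m := by
  classical
  have := Fintype.ofFinite ι
  have key : ∀ s : Finset ι, ∃ W' ≤ W, W' ≠ ⊥ ∧ (∀ i, ∀ w ∈ W', X i w ∈ W') ∧
      ∃ x : ι → K, ∀ i ∈ s, ∀ w ∈ W', X i w = x i • w := by
    intro s
    induction s using Finset.induction_on with
    | empty => exact ⟨W, le_rfl, hW, hWX, 0, by simp⟩
    | insert a s ha ih =>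
      obtain ⟨W', h1, h2, h3, x, hx⟩ := ih
      have : Nontrivial W' := Submodule.nontrivial_iff_ne_bot.mpr h2
      have htop := End.genEigenspace_restrict_eq_top (h3 a) (hs a).iSup_maxGenEigenspace
      obtain ⟨c, hc⟩ := End.exists_hasEigenvalue_of_genEigenspace_eq_top ⊤ htop
      obtain ⟨w, hw, hw0⟩ := hc.exists_hasEigenvector
      refine ⟨W' ⊓ End.eigenspace (X a) c, inf_le_left.trans h1, ?_, ?_,
        Function.update x a c, ?_⟩
      · refine (Submodule.ne_bot_iff _).mpr ⟨w, ⟨w.2, ?_⟩, by simpa using hw0⟩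
        rw [SetLike.mem_coe, End.mem_eigenspace_iff]
        simpa using congrArg Subtype.val (End.mem_eigenspace_iff.mp hw)
      · rintro i u ⟨hu, hu'⟩
        refine ⟨h3 i u hu, ?_⟩
        rw [SetLike.mem_coe, End.mem_eigenspace_iff] at hu' ⊢
        rw [← End.mul_apply, (hX a i).eq, End.mul_apply, hu', map_smul]
      · rintro i hi u ⟨hu, hu'⟩
        by_cases hia : i = a
        · subst hia; simpa [End.mem_eigenspace_iff] using hu'
        · rw [Function.update_of_ne hia]
          exact hx i ((Finset.mem_insert.mp hi).resolve_left hia) u hu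
  obtain ⟨W', h1, h2, -, x, hx⟩ := key Finset.univ
  obtain ⟨m, hm, hm0⟩ := (Submodule.ne_bot_iff _).mp h2
  exact ⟨m, h1 hm, hm0, x, fun i => hx i (Finset.mem_univ i) m hm⟩

end LinearAlgebra
section Signs

variable {K : Type*} [Field K] {d : ℕ}

/-- The eigenvalue of a Jucys–Murphy element on a box of content `c` in the component `s`. -/
def ev (q Q : Kˣ) (s : Bool) (c : ℤ) : K :=
  if s then (Q : K)⁻¹ * (q : K) ^ (2 * c) else -(Q : K) * (q : K) ^ (2 * c)

/-- The number of positions before `k` with sign `s`. -/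
def cnt (δ : Fin d → Bool) (s : Bool) (k : ℕ) : ℕ :=
  (Finset.univ.filter fun j : Fin d => j.val < k ∧ δ j = s).card

/-- The sequence `x` is, up to position `k`, a sequence of eigenvalues of type `δ`. -/
def AdmTo (q Q : Kˣ) (k : ℕ) (δ : Fin d → Bool) (x : Fin d → K) : Prop :=
  ∀ j : Fin d, j.val < k → ∃ c : ℤ, |c| ≤ cnt δ (δ j) j ∧ x j = ev q Q (δ j) c

/-- The sequence `x` is a sequence of eigenvalues of type `δ`. -/
def Adm (q Q : Kˣ) (δ : Fin d → Bool) (x : Fin d → K) : Prop :=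
  ∀ j : Fin d, ∃ c : ℤ, |c| ≤ cnt δ (δ j) j ∧ x j = ev q Q (δ j) c

/-- The transposition of the positions `k` and `k + 1`. -/
abbrev sw (k : ℕ) (hk : k + 1 < d) : Equiv.Perm (Fin d) :=
  Equiv.swap ⟨k, by omega⟩ ⟨k + 1, hk⟩

theorem cnt_congr {δ δ' : Fin d → Bool} {k : ℕ} (h : ∀ j : Fin d, j.val < k → δ j = δ' j)
    (s : Bool) : cnt δ s k = cnt δ' s k := by
  unfold cnt
  congr 1
  ext j
  simp only [Finset.mem_filter, Finset.mem_univ, true_and]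
  constructor <;> rintro ⟨h1, h2⟩
  · exact ⟨h1, by rw [← h j h1, h2]⟩
  · exact ⟨h1, by rw [h j h1, h2]⟩

theorem cnt_succ (δ : Fin d → Bool) (s : Bool) {k : ℕ} (hk : k < d) :
    cnt δ s (k + 1) = cnt δ s k + if δ ⟨k, hk⟩ = s then 1 else 0 := by
  unfold cnt
  split_ifs with h
  · rw [← Finset.card_insert_of_notMem (a := (⟨k, hk⟩ : Fin d)) (by simp)]
    congr 1
    ext j
    simp only [Finset.mem_filter, Finset.mem_univ, true_and, Finset.mem_insert, Fin.ext_iff]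
    constructor
    · rintro ⟨h1, h2⟩
      by_cases hj : j.val = k
      · exact Or.inl hj
      · exact Or.inr ⟨by omega, h2⟩
    · rintro (h1 | ⟨h1, h2⟩)
      · obtain rfl : j = ⟨k, hk⟩ := Fin.ext h1
        exact ⟨by simp, h⟩
      · exact ⟨by omega, h2⟩
  · rw [add_zero]
    congr 1
    ext j
    simp only [Finset.mem_filter, Finset.mem_univ, true_and]
    constructor
    · rintro ⟨h1, h2⟩
      have hj : j.val ≠ k := by
        intro hj
        obtain rfl : j = ⟨k, hk⟩ := Fin.ext hj
        exact h h2
      exact ⟨by omega, h2⟩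
    · rintro ⟨h1, h2⟩
      exact ⟨by omega, h2⟩

theorem cnt_mono (δ : Fin d → Bool) (s : Bool) {k l : ℕ} (h : k ≤ l) : cnt δ s k ≤ cnt δ s l := by
  refine Finset.card_le_card fun j => ?_
  simp only [Finset.mem_filter, Finset.mem_univ, true_and]
  exact fun hj => ⟨hj.1.trans_le h, hj.2⟩

theorem cnt_add_cnt_le (δ : Fin d → Bool) (s : Bool) {k : ℕ} (hk : k ≤ d) :
    cnt δ s k + cnt δ (!s) k ≤ k := by
  induction k with
  | zero => simp [cnt]
  | succ k ih =>
    rw [cnt_succ δ s (by omega), cnt_succ δ (!s) (by omega)]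
    have := ih (by omega)
    cases δ ⟨k, by omega⟩ <;> cases s <;> simp at this ⊢ <;> omega

theorem sw_apply_of_lt {k : ℕ} (hk : k + 1 < d) {j : Fin d} (hj : j.val < k) : sw k hk j = j :=
  Equiv.swap_apply_of_ne_of_ne (by simp [Fin.ext_iff]; omega) (by simp [Fin.ext_iff]; omega)

theorem sw_apply_of_gt {k : ℕ} (hk : k + 1 < d) {j : Fin d} (hj : k + 1 < j.val) :
    sw k hk j = j :=
  Equiv.swap_apply_of_ne_of_ne (by simp [Fin.ext_iff]; omega) (by simp [Fin.ext_iff]; omega)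

theorem cnt_comp_sw (δ : Fin d → Bool) (s : Bool) {k : ℕ} (hk : k + 1 < d) {j : ℕ}
    (hj : j ≠ k + 1) : cnt (δ ∘ sw k hk) s j = cnt δ s j := by
  rcases Nat.lt_or_ge j (k + 1) with h | h
  · refine cnt_congr (fun i hi => ?_) s
    rw [Function.comp_apply, sw_apply_of_lt hk (by omega)]
  · refine Finset.card_bij (fun i _ => sw k hk i) ?_ ?_ ?_
    · intro i hi
      simp only [Finset.mem_filter, Finset.mem_univ, true_and, Function.comp_apply] at hi ⊢
      refine ⟨?_, hi.2⟩
      simp only [sw, Equiv.swap_apply_def]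
      split_ifs with h1 h2 <;> (try simp only [Fin.ext_iff] at *) <;> omega
    · intro i _ i' _ e
      exact (sw k hk).injective e
    · intro i hi
      refine ⟨sw k hk i, ?_, by simp [sw]⟩
      simp only [Finset.mem_filter, Finset.mem_univ, true_and, Function.comp_apply] at hi ⊢
      refine ⟨?_, by simpa [sw] using hi.2⟩
      simp only [sw, Equiv.swap_apply_def]
      split_ifs with h1 h2 <;> (try simp only [Fin.ext_iff] at *) <;> omega

variable {q Q : Kˣ}

theorem ev_ne (hf : IsUnit (fB q Q d)) {s s' : Bool} (hs : s ≠ s') {c c' : ℤ}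
    (hc : |c - c'| < d) : ev q Q s c ≠ ev q Q s' c' := by
  have hq : (q : K) ≠ 0 := q.ne_zero
  have hQ : (Q : K) ≠ 0 := Q.ne_zero
  have key : ∀ c c' : ℤ, |c - c'| < d → ev q Q true c ≠ ev q Q false c' := by
    intro c c' hc e
    have h0 := Finset.prod_ne_zero_iff.mp hf.ne_zero (c' - c) (by
      rw [Finset.mem_Icc]; rw [abs_lt] at hc; constructor <;> omega)
    apply h0
    simp only [ev, if_true, Bool.false_eq_true, if_false] at e
    have e1 : (q : K) ^ (2 * (c' - c)) = (q : K) ^ (2 * c') * ((q : K) ^ (2 * c))⁻¹ := by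
      rw [mul_sub, zpow_sub₀ hq, div_eq_mul_inv]
    have hqc : (q : K) ^ (2 * c) ≠ 0 := zpow_ne_zero _ hq
    rw [e1, zpow_neg, show (Q : K) ^ (2 : ℤ) = Q * Q by rw [zpow_two]]
    field_simp at e ⊢
    linear_combination e
  cases s <;> cases s'
  · exact absurd rfl hs
  · exact (key c' c (by rwa [abs_sub_comm])).symm
  · exact key c c' hc
  · exact absurd rfl hs

theorem AdmTo.eq_comp (hf : IsUnit (fB q Q d)) {δ δ' : Fin d → Bool} {x : Fin d → K}
    {σ : Fin d → Fin d} {k : ℕ}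
    (hσ : ∀ j : Fin d, j.val < k → ∀ s, cnt δ s (σ j) + cnt (δ ∘ σ) (!s) j < d)
    (hδ : ∀ j : Fin d, j.val < k → ∃ c : ℤ, |c| ≤ cnt δ (δ (σ j)) (σ j) ∧
      x (σ j) = ev q Q (δ (σ j)) c)
    (hδ' : AdmTo q Q k δ' (x ∘ σ)) : ∀ j : Fin d, j.val < k → δ' j = δ (σ j) := by
  intro ⟨j, hjd⟩
  induction j using Nat.strong_induction_on with
  | _ j ih =>
    intro hj
    by_contra hne
    obtain ⟨c, hc, hxc⟩ := hδ ⟨j, hjd⟩ hj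
    obtain ⟨c', hc', hxc'⟩ := hδ' ⟨j, hjd⟩ hj
    have h1 : δ' ⟨j, hjd⟩ = !(δ (σ ⟨j, hjd⟩)) := Bool.eq_not_of_ne hne
    have h2 : cnt δ' (δ' ⟨j, hjd⟩) j = cnt (δ ∘ σ) (!(δ (σ ⟨j, hjd⟩))) j := by
      rw [h1]
      exact cnt_congr (fun i hi => ih i hi i.2 (lt_trans hi hj)) _
    have h3 := hσ ⟨j, hjd⟩ hj (δ (σ ⟨j, hjd⟩))
    refine ev_ne hf (Ne.symm hne) (c := c) (c' := c') ?_ (hxc.symm.trans hxc')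
    simp only at hc' h3
    rw [h2] at hc'
    have := abs_sub c c'
    omega

theorem AdmTo.unique (hf : IsUnit (fB q Q d)) {δ δ' : Fin d → Bool} {x : Fin d → K} {k : ℕ}
    (hδ : AdmTo q Q k δ x) (hδ' : AdmTo q Q k δ' x) : ∀ j : Fin d, j.val < k → δ' j = δ j :=
  AdmTo.eq_comp hf (σ := id) (fun j _ s => (cnt_add_cnt_le δ s j.2.le).trans_lt j.2) hδ hδ'

theorem Adm.unique (hf : IsUnit (fB q Q d)) {δ δ' : Fin d → Bool} {x : Fin d → K}
    (hδ : Adm q Q δ x) (hδ' : Adm q Q δ' x) : δ' = δ :=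
  funext fun j => AdmTo.unique (k := d) hf (fun j _ => hδ j) (fun j _ => hδ' j) j j.2

theorem Adm.eq_comp_sw (hf : IsUnit (fB q Q d)) {δ δ' : Fin d → Bool} {x : Fin d → K} {k : ℕ}
    (hk : k + 1 < d) (hδ : Adm q Q δ x) (hδ' : Adm q Q δ' (x ∘ sw k hk)) : δ' = δ ∘ sw k hk := by
  refine funext fun j => AdmTo.eq_comp (k := d) hf (σ := sw k hk) (fun j _ s => ?_)
    (fun j _ => hδ _) (fun j _ => hδ' j) j j.2
  rcases lt_trichotomy j.val k with h | h | h
  · rw [sw_apply_of_lt hk h, cnt_comp_sw _ _ _ (by omega)]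
    exact (cnt_add_cnt_le δ s j.2.le).trans_lt j.2
  · have hk' : k < d := by omega
    obtain rfl : j = ⟨k, hk'⟩ := Fin.ext h
    rw [cnt_comp_sw _ _ _ (by simp), sw, Equiv.swap_apply_left]
    simp only
    rw [cnt_succ δ s (by omega)]
    have := cnt_add_cnt_le δ s (k := k) (by omega)
    split_ifs <;> omega
  · by_cases h1 : j.val = k + 1
    · obtain rfl : j = ⟨k + 1, hk⟩ := Fin.ext h1
      rw [sw, Equiv.swap_apply_right]
      simp only
      rw [cnt_succ _ _ (by omega), cnt_comp_sw _ _ _ (by omega)]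
      have := cnt_add_cnt_le δ s (k := k) (by omega)
      split_ifs <;> omega
    · rw [sw_apply_of_gt hk (by omega), cnt_comp_sw _ _ _ h1]
      exact (cnt_add_cnt_le δ s j.2.le).trans_lt j.2

theorem ev_mul_zpow (s : Bool) (c e : ℤ) :
    ev q Q s c * (q : K) ^ (2 * e) = ev q Q s (c + e) := by
  have hq : (q : K) ≠ 0 := q.ne_zero
  simp only [ev]
  split_ifs <;> rw [mul_add, zpow_add₀ hq, mul_assoc]

theorem Adm.ne_mul (hf : IsUnit (fB q Q d)) {δ : Fin d → Bool} {x : Fin d → K} {k : ℕ}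
    (hk : k + 1 < d) (hδ : Adm q Q δ x) (hs : δ ⟨k, by omega⟩ ≠ δ ⟨k + 1, hk⟩) {e : ℤ}
    (he : |e| ≤ 1) : x ⟨k, by omega⟩ ≠ (q : K) ^ (2 * e) * x ⟨k + 1, hk⟩ := by
  obtain ⟨c, hc, hxc⟩ := hδ ⟨k, by omega⟩
  obtain ⟨c', hc', hxc'⟩ := hδ ⟨k + 1, hk⟩
  rw [hxc, hxc', mul_comm, ev_mul_zpow]
  refine ev_ne hf hs ?_
  simp only at hc hc'
  rw [cnt_succ _ _ (by omega), if_neg hs] at hc'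
  rw [Bool.eq_not_of_ne hs.symm] at hc'
  have := cnt_add_cnt_le δ (δ ⟨k, by omega⟩) (k := k) (by omega)
  rw [abs_le] at *
  rw [abs_lt]
  constructor <;> omega

end Signs
section WeightSpaces

open Module

variable {K : Type*} [Field K] {d : ℕ} {q Q : Kˣ}
  {M : Type*} [AddCommGroup M] [Module K M] {T : ℕ → End K M}

/-- The simultaneous generalized eigenspace of the Jucys–Murphy elements for the eigenvalues `x`. -/
def wtSp (T : ℕ → End K M) (x : Fin d → K) : Submodule K M :=
  ⨅ j : Fin d, (jm T j).maxGenEigenspace (x j)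

/-- The sum of the simultaneous generalized eigenspaces of type `δ`. -/
def sgnSp (q Q : Kˣ) (T : ℕ → End K M) (δ : Fin d → Bool) : Submodule K M :=
  ⨆ x ∈ {x | Adm q Q δ x}, wtSp T x

theorem mem_wtSp {x : Fin d → K} {m : M} :
    m ∈ wtSp T x ↔ ∀ j : Fin d, ∃ k : ℕ, ((jm T j - x j • 1) ^ k) m = 0 := by
  simp [wtSp, End.mem_maxGenEigenspace]

theorem mem_wtSp_of_eigen {x : Fin d → K} {m : M} (h : ∀ j : Fin d, jm T j m = x j • m) :
    m ∈ wtSp T x :=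
  mem_wtSp.mpr fun j => ⟨1, by simp [h j]⟩

theorem wtSp_le_sgnSp {δ : Fin d → Bool} {x : Fin d → K} (h : Adm q Q δ x) :
    wtSp T x ≤ sgnSp q Q T δ :=
  le_iSup₂_of_le x h le_rfl

theorem pow_semiconj {M' : Type*} [AddCommGroup M'] [Module K M'] {φ : M →ₗ[K] M'} {f : End K M}
    {g : End K M'} (h : ∀ m, φ (f m) = g (φ m)) (c : K) (k : ℕ) (m : M) :
    φ (((f - c • 1) ^ k) m) = ((g - c • 1) ^ k) (φ m) := by
  induction k generalizing m with
  | zero => simp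
  | succ k ih => rw [pow_succ, pow_succ, End.mul_apply, End.mul_apply, ih]; simp [h]

theorem jm_semiconj {M' : Type*} [AddCommGroup M'] [Module K M'] {T' : ℕ → End K M'}
    {φ : M →ₗ[K] M'} (h : ∀ j < d, ∀ m, φ (T j m) = T' j (φ m)) :
    ∀ j < d, ∀ m, φ (jm T j m) = jm T' j (φ m) := by
  intro j
  induction j with
  | zero => exact h 0
  | succ j ih =>
    intro hj m
    simp only [jm, End.mul_apply]
    rw [h _ hj, ih (by omega), h _ hj]

/-- Sign spaces are functorial. -/
theorem map_mem_sgnSp {M' : Type*} [AddCommGroup M'] [Module K M'] {T' : ℕ → End K M'}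
    {φ : M →ₗ[K] M'} (h : ∀ j < d, ∀ m, φ (jm T j m) = jm T' j (φ m)) {δ : Fin d → Bool} {m : M}
    (hm : m ∈ sgnSp q Q T δ) : φ m ∈ sgnSp q Q T' δ := by
  suffices h1 : sgnSp q Q T δ ≤ (sgnSp q Q T' δ).comap φ from h1 hm
  refine iSup₂_le fun x hx m hm => wtSp_le_sgnSp hx (mem_wtSp.mpr fun j => ?_)
  obtain ⟨k, hk⟩ := mem_wtSp.mp hm j
  exact ⟨k, by rw [← pow_semiconj (h j j.2), hk, map_zero]⟩

namespace IsHeckeB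

variable (h : IsHeckeB q Q d T)
include h

theorem isSplit_jm {k : ℕ} (hk : k < d) : IsSplit (K := K) (jm T k) := by
  have hq : (q : K) ≠ 0 := q.ne_zero
  induction k with
  | zero =>
    have hQ : (Q : K) ≠ 0 := Q.ne_zero
    open Polynomial in
    refine ⟨(X - C (Q : K)⁻¹) * (X - C (-(Q : K))), mul_ne_zero (X_sub_C_ne_zero _)
      (X_sub_C_ne_zero _), (Splits.X_sub_C _).mul (Splits.X_sub_C _), ?_⟩
    have := h.quadZero hk
    simp only [jm, map_mul, map_sub, Polynomial.aeval_X, Polynomial.aeval_C, sub_mul, mul_sub,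
      this, Algebra.algebraMap_eq_smul_one, smul_mul_assoc, mul_smul_comm, one_mul, mul_one]
    match_scalars <;> field_simp <;> ring
  | succ k ih =>
    exact IsSplit.of_intertwine (pow_ne_zero 2 hq) (pow_ne_zero 2 (inv_ne_zero hq))
      (h.jm_commute (by omega) hk) (h.intw_mul_jm hk) (h.intw_sq hk) (ih (by omega))

theorem jm_mem_wtSp {x : Fin d → K} {m : M} (hm : m ∈ wtSp T x) {j : ℕ} (hj : j < d) :
    jm T j m ∈ wtSp T x := by
  simp only [wtSp, Submodule.mem_iInf] at hm ⊢
  exact fun i => End.mapsTo_maxGenEigenspace_of_comm (h.jm_commute i.2 hj) _ (hm i)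

theorem jm_mem_sgnSp {δ : Fin d → Bool} {m : M} (hm : m ∈ sgnSp q Q T δ) {j : ℕ} (hj : j < d) :
    jm T j m ∈ sgnSp q Q T δ := by
  suffices h1 : sgnSp q Q T δ ≤ (sgnSp q Q T δ).comap (jm T j) from h1 hm
  exact iSup₂_le fun x hx m hm => wtSp_le_sgnSp hx (h.jm_mem_wtSp hm hj)

theorem intw_mul_jm_sw {k : ℕ} (hk : k + 1 < d) (j : Fin d) :
    intw q T k * jm T (sw k hk j) = jm T j * intw q T k := by
  have hkd : k < d := by omega
  rcases lt_trichotomy j.val k with h1 | h1 | h1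
  · rw [sw_apply_of_lt hk h1]
    exact h.intw_mul_jm_of_ne hk j.2 (by omega) (by omega)
  · obtain rfl : j = ⟨k, hkd⟩ := Fin.ext h1
    rw [sw, Equiv.swap_apply_left]
    exact h.intw_mul_jm_succ hk
  · by_cases h2 : j.val = k + 1
    · obtain rfl : j = ⟨k + 1, hk⟩ := Fin.ext h2
      rw [sw, Equiv.swap_apply_right]
      exact h.intw_mul_jm hk
    · rw [sw_apply_of_gt hk (by omega)]
      exact h.intw_mul_jm_of_ne hk j.2 (by omega) (by omega)

theorem intw_mem_wtSp {x : Fin d → K} {m : M} (hm : m ∈ wtSp T x) {k : ℕ} (hk : k + 1 < d) :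
    intw q T k m ∈ wtSp T (x ∘ sw k hk) := by
  rw [mem_wtSp] at hm ⊢
  intro j
  obtain ⟨N, hN⟩ := hm (sw k hk j)
  refine ⟨N, ?_⟩
  rw [Function.comp_apply,
    ← pow_semiconj (φ := intw q T k) (f := jm T (sw k hk j)) (fun m => ?_), hN, map_zero]
  rw [← End.mul_apply, ← End.mul_apply]
  congr 1
  exact h.intw_mul_jm_sw hk j

/-- The eigenvalues of a simultaneous eigenvector have a type. -/
theorem exists_admTo (hf : IsUnit (fB q Q d)) {k : ℕ} (hk : k ≤ d) {m : M} (hm : m ≠ 0)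
    {x : Fin d → K} (hx : ∀ j : Fin d, jm T j m = x j • m) :
    ∃ δ : Fin d → Bool, AdmTo q Q k δ x := by
  induction k generalizing m x with
  | zero => exact ⟨fun _ => true, fun j hj => absurd hj (by omega)⟩
  | succ k ih =>
    obtain _ | k := k
    · have h1 := h.quadZero hk
      have h2 : T 0 m = x ⟨0, hk⟩ • m := hx ⟨0, hk⟩
      have h3 := congrArg (fun A : End K M => A m) h1
      simp only [End.mul_apply, LinearMap.add_apply, LinearMap.smul_apply, End.one_apply, h2,
        map_smul, smul_smul] at h3
      have hQ : (Q : K) ≠ 0 := Q.ne_zero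
      set a := x ⟨0, hk⟩ with ha
      have h4 : ((a - (Q : K)⁻¹) * (a + Q)) • m = 0 := by
        have : ((a - (Q : K)⁻¹) * (a + Q)) = a * a - (((Q : K)⁻¹ - Q) * a + 1) := by
          field_simp; ring
        rw [this, sub_smul, h3, add_smul, one_smul, sub_self]
      have h5 := (smul_eq_zero.mp h4).resolve_right hm
      have hj0 (j : Fin d) (hj : j.val < 0 + 1) : x j = a := by
        rw [ha]; congr 1; exact Fin.ext (by simp; omega)
      rcases mul_eq_zero.mp h5 with h6 | h6
      · refine ⟨fun _ => true, fun j hj => ⟨0, by simp, ?_⟩⟩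
        rw [hj0 j hj, sub_eq_zero.mp h6]; simp [ev]
      · refine ⟨fun _ => false, fun j hj => ⟨0, by simp, ?_⟩⟩
        rw [hj0 j hj, eq_neg_of_add_eq_zero_left h6]; simp [ev]
    · obtain ⟨δ, hδ⟩ := ih (by omega) hm hx
      have hkd : k < d := by omega
      by_cases h0 : intw q T k m = 0
      · have h1 := congrArg (fun A : End K M => A m) (h.intw_sq hk)
        have hx1 : jm T k m = x ⟨k, hkd⟩ • m := hx ⟨k, hkd⟩
        have hx2 : jm T (k + 1) m = x ⟨k + 1, hk⟩ • m := hx ⟨k + 1, hk⟩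
        simp only [End.mul_apply, h0, map_zero, LinearMap.neg_apply, LinearMap.sub_apply,
          LinearMap.smul_apply, hx1, hx2, map_smul, smul_smul, ← sub_smul] at h1
        have h2 := (smul_eq_zero.mp (neg_eq_zero.mp h1.symm)).resolve_right hm
        have h3 : (x ⟨k, hkd⟩ - (q : K) ^ 2 * x ⟨k + 1, hk⟩) *
            (x ⟨k, hkd⟩ - ((q : K)⁻¹) ^ 2 * x ⟨k + 1, hk⟩) = 0 := by
          rw [← h2]; ring
        have hq : (q : K) ≠ 0 := q.ne_zero
        obtain ⟨c, hc, hxc⟩ := hδ ⟨k, hkd⟩ (by simp)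
        have h4 : ∃ e : ℤ, |e| ≤ 1 ∧ x ⟨k + 1, hk⟩ = ev q Q (δ ⟨k, hkd⟩) (c + e) := by
          rcases mul_eq_zero.mp h3 with h4 | h4
          · refine ⟨-1, by simp, ?_⟩
            rw [← ev_mul_zpow, ← hxc, sub_eq_zero.mp h4]
            simp only [mul_neg, mul_one, zpow_neg]
            rw [show (q : K) ^ (2 : ℤ) = (q : K) ^ 2 by norm_cast]
            field_simp
          · refine ⟨1, by simp, ?_⟩
            rw [← ev_mul_zpow, ← hxc, sub_eq_zero.mp h4]
            simp only [mul_one]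
            rw [show (q : K) ^ (2 : ℤ) = (q : K) ^ 2 by norm_cast]
            field_simp
        obtain ⟨e, he, hxe⟩ := h4
        refine ⟨Function.update δ ⟨k + 1, hk⟩ (δ ⟨k, hkd⟩), fun j hj => ?_⟩
        have hcnt : ∀ s i, i ≤ k + 1 →
            cnt (Function.update δ ⟨k + 1, hk⟩ (δ ⟨k, hkd⟩)) s i = cnt δ s i := by
          intro s i hi
          refine cnt_congr (fun l hl => Function.update_of_ne ?_ _ _) s
          simp [Fin.ext_iff]; omega
        rw [hcnt _ _ (by omega)]
        by_cases hj1 : j.val = k + 1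
        · obtain rfl : j = ⟨k + 1, hk⟩ := Fin.ext hj1
          refine ⟨c + e, ?_, by rw [Function.update_self, hxe]⟩
          rw [Function.update_self]
          simp only at hc ⊢
          rw [cnt_succ _ _ hkd, if_pos rfl]
          have := abs_add_le c e
          push_cast
          omega
        · rw [Function.update_of_ne (by simpa [Fin.ext_iff] using hj1)]
          exact hδ j (by omega)
      · have hx' : ∀ j : Fin d, jm T j (intw q T k m) = (x ∘ sw k hk) j • intw q T k m := by
          intro j
          rw [Function.comp_apply, ← map_smul, ← hx (sw k hk j), ← End.mul_apply, ← End.mul_apply]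
          congr 1
          exact (h.intw_mul_jm_sw hk j).symm
        obtain ⟨δ', hδ'⟩ := ih (by omega) h0 hx'
        have hpre : ∀ j : Fin d, j.val < k → δ' j = δ j := by
          refine AdmTo.unique hf (k := k) (x := x) (fun j hj => hδ j (by omega)) fun j hj => ?_
          have := hδ' j (by omega)
          rwa [Function.comp_apply, sw_apply_of_lt hk hj] at this
        refine ⟨Function.update δ ⟨k + 1, hk⟩ (δ' ⟨k, hkd⟩), fun j hj => ?_⟩
        have hcnt : ∀ s i, i ≤ k + 1 →
            cnt (Function.update δ ⟨k + 1, hk⟩ (δ' ⟨k, hkd⟩)) s i = cnt δ s i := by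
          intro s i hi
          refine cnt_congr (fun l hl => Function.update_of_ne ?_ _ _) s
          simp [Fin.ext_iff]; omega
        rw [hcnt _ _ (by omega)]
        by_cases hj1 : j.val = k + 1
        · obtain rfl : j = ⟨k + 1, hk⟩ := Fin.ext hj1
          obtain ⟨c, hc, hxc⟩ := hδ' ⟨k, hkd⟩ (by simp)
          refine ⟨c, ?_, ?_⟩
          · rw [Function.update_self]
            simp only at hc ⊢
            rw [cnt_congr hpre] at hc
            have := cnt_mono δ (δ' ⟨k, hkd⟩) (show k ≤ k + 1 by omega)
            omega
          · rw [Function.update_self, ← hxc, Function.comp_apply, sw, Equiv.swap_apply_left]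
        · rw [Function.update_of_ne (by simpa [Fin.ext_iff] using hj1)]
          exact hδ j (by omega)

theorem iSupIndep_sgnSp (hf : IsUnit (fB q Q d)) :
    iSupIndep fun δ : Fin d → Bool => sgnSp q Q T δ := by
  have h1 : iSupIndep fun x : Fin d → K => wtSp T x :=
    End.independent_iInf_maxGenEigenspace_of_forall_mapsTo (fun j : Fin d => jm T j)
      fun i j φ => End.mapsTo_maxGenEigenspace_of_comm (h.jm_commute j.2 i.2) φ
  intro δ
  refine (h1.disjoint_biSup_biSup (s := {x | Adm q Q δ x}) (t := {x | ¬ Adm q Q δ x})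
    (Set.disjoint_left.mpr fun x hx hx' => hx' hx)).mono_right ?_
  refine iSup₂_le fun δ' hδ' => iSup₂_le fun x hx => le_iSup₂_of_le x ?_ le_rfl
  exact fun hx' => hδ' (hx'.unique hf hx)

variable [FiniteDimensional K M]

theorem exists_eigenvector {W : Submodule K M} (hW : W ≠ ⊥)
    (hWX : ∀ j < d, ∀ w ∈ W, jm T j w ∈ W) :
    ∃ m ∈ W, m ≠ 0 ∧ ∃ x : Fin d → K, ∀ j : Fin d, jm T j m = x j • m :=
  exists_joint_eigenvector (X := fun j : Fin d => jm T j) (fun i j => h.jm_commute i.2 j.2)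
    (fun i => h.isSplit_jm i.2) hW fun i => hWX i i.2

theorem exists_eigenvector_wtSp {x : Fin d → K} {W : Submodule K M} (hWx : W ≤ wtSp T x)
    (hW : W ≠ ⊥) (hWX : ∀ j < d, ∀ w ∈ W, jm T j w ∈ W) :
    ∃ m ∈ W, m ≠ 0 ∧ ∀ j : Fin d, jm T j m = x j • m := by
  obtain ⟨m, hm, hm0, y, hy⟩ := h.exists_eigenvector hW hWX
  have hxy : x = y := by
    by_contra hne
    have := End.disjoint_iInf_maxGenEigenspace (fun j : Fin d => jm T j) hne
    exact hm0 (Submodule.disjoint_def.mp this m (hWx hm) (mem_wtSp_of_eigen hy))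
  subst hxy
  exact ⟨m, hm, hm0, hy⟩

theorem exists_adm (hf : IsUnit (fB q Q d)) {x : Fin d → K} (hx : wtSp T x ≠ ⊥) :
    ∃ δ, Adm q Q δ x := by
  obtain ⟨m, -, hm0, hm⟩ := h.exists_eigenvector_wtSp le_rfl hx fun j hj w hw =>
    h.jm_mem_wtSp hw hj
  obtain ⟨δ, hδ⟩ := h.exists_admTo hf le_rfl hm0 hm
  exact ⟨δ, fun j => hδ j j.2⟩

theorem iSup_sgnSp (hf : IsUnit (fB q Q d)) : ⨆ δ : Fin d → Bool, sgnSp q Q T δ = ⊤ := by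
  have h1 := End.iSup_iInf_maxGenEigenspace_eq_top_of_iSup_maxGenEigenspace_eq_top_of_commute
    (fun j : Fin d => jm T j) (fun i j _ => h.jm_commute i.2 j.2)
    fun i => (h.isSplit_jm i.2).iSup_maxGenEigenspace
  rw [eq_top_iff, ← h1]
  refine iSup_le fun x => ?_
  change wtSp T x ≤ _
  by_cases hx : wtSp T x = ⊥
  · rw [hx]; exact bot_le
  · obtain ⟨δ, hδ⟩ := h.exists_adm hf hx
    exact le_iSup_of_le δ (wtSp_le_sgnSp hδ)

theorem isInternal_sgnSp (hf : IsUnit (fB q Q d)) :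
    DirectSum.IsInternal fun δ : Fin d → Bool => sgnSp q Q T δ :=
  (DirectSum.isInternal_submodule_iff_iSupIndep_and_iSup_eq_top _).mpr
    ⟨h.iSupIndep_sgnSp hf, h.iSup_sgnSp hf⟩

theorem adm_of_eigenvector (hf : IsUnit (fB q Q d)) {δ : Fin d → Bool} {m : M}
    (hm : m ∈ sgnSp q Q T δ) (hm0 : m ≠ 0) {x : Fin d → K}
    (hx : ∀ j : Fin d, jm T j m = x j • m) : Adm q Q δ x := by
  have h1 := mem_wtSp_of_eigen hx
  obtain ⟨δ', hδ'⟩ := h.exists_adm hf ((Submodule.ne_bot_iff _).mpr ⟨m, h1, hm0⟩)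
  by_cases hne : δ = δ'
  · rwa [hne]
  · exact absurd (Submodule.disjoint_def.mp ((h.iSupIndep_sgnSp hf).pairwiseDisjoint hne) m hm
      (wtSp_le_sgnSp hδ' h1)) hm0

theorem map_jm_sub_wtSp {x : Fin d → K} {i j : Fin d} {c : K} (hx : x i ≠ c * x j) :
    (wtSp T x).map (jm T i - c • jm T j) = wtSp T x := by
  refine map_eq_of_injOn (fun w hw => Submodule.sub_mem _ (h.jm_mem_wtSp hw i.2)
    (Submodule.smul_mem _ _ (h.jm_mem_wtSp hw j.2))) ?_
  have hW : wtSp T x ⊓ LinearMap.ker (jm T i - c • jm T j) = ⊥ := by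
    by_contra hne
    obtain ⟨m, hm, hm0, hmx⟩ := h.exists_eigenvector_wtSp inf_le_left hne (by
      rintro l hl w ⟨hw, hw'⟩
      refine ⟨h.jm_mem_wtSp hw hl, ?_⟩
      have hc : Commute (jm T i - c • jm T j) (jm T l) :=
        (h.jm_commute i.2 hl).sub_left ((h.jm_commute j.2 hl).smul_left c)
      rw [SetLike.mem_coe, LinearMap.mem_ker] at hw' ⊢
      rw [← End.mul_apply, hc.eq, End.mul_apply, hw', map_zero])
    have h1 := LinearMap.mem_ker.mp hm.2
    simp only [LinearMap.sub_apply, LinearMap.smul_apply, hmx, smul_smul, ← sub_smul] at h1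
    exact hx (sub_eq_zero.mp ((smul_eq_zero.mp h1).resolve_right hm0))
  intro w hw h0
  exact (Submodule.eq_bot_iff _).mp hW w ⟨hw, h0⟩

theorem map_jm_sub_sgnSp (hf : IsUnit (fB q Q d)) {δ : Fin d → Bool} {k : ℕ} (hk : k + 1 < d)
    (hs : δ ⟨k, by omega⟩ ≠ δ ⟨k + 1, hk⟩) {e : ℤ} (he : |e| ≤ 1) :
    (sgnSp q Q T δ).map (jm T k - (q : K) ^ (2 * e) • jm T (k + 1)) = sgnSp q Q T δ := by
  rw [sgnSp, Submodule.map_iSup]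
  refine iSup_congr fun x => ?_
  rw [Submodule.map_iSup]
  refine iSup_congr fun hx => ?_
  exact h.map_jm_sub_wtSp (i := ⟨k, by omega⟩) (j := ⟨k + 1, hk⟩) (Adm.ne_mul hf hk hx hs he)

theorem T_mem_wtSp {x : Fin d → K} {m : M} (hm : m ∈ wtSp T x) {k : ℕ} (hk : k + 1 < d) :
    T (k + 1) m ∈ wtSp T x ⊔ wtSp T (x ∘ sw k hk) := by
  have hkd : k < d := by omega
  by_cases hx : x ⟨k, hkd⟩ = x ⟨k + 1, hk⟩
  · refine Submodule.mem_sup_left (mem_wtSp.mpr fun j => ?_)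
    set a := x ⟨k, hkd⟩ with ha
    set u : End K M := jm T k - a • 1 with hu
    set w : End K M := jm T (k + 1) - a • 1 with hw
    have huw : Commute u w := by
      have := h.jm_commute hkd hk
      exact (this.sub_right ((Commute.one_right _).smul_right a)).sub_left
        ((Commute.one_left _).smul_left a)
    have hadd : Commute (T (k + 1)) (u + w) := by
      have e : u + w = (jm T k + jm T (k + 1)) - (2 * a) • 1 := by rw [hu, hw]; module
      rw [e]
      exact (h.T_commute_add hk).sub_right ((Commute.one_right _).smul_right _)
    have hmul : Commute (T (k + 1)) (u * w) := by
      have e : u * w = jm T k * jm T (k + 1) - a • (jm T k + jm T (k + 1)) + (a * a) • 1 := by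
        rw [hu, hw]
        simp only [sub_mul, mul_sub, smul_mul_assoc, mul_smul_comm, one_mul, mul_one]
        module
      rw [e]
      exact ((h.T_commute_mul hk).sub_right ((h.T_commute_add hk).smul_right _)).add_right
        ((Commute.one_right _).smul_right _)
    obtain ⟨N₁, hN₁⟩ := mem_wtSp.mp hm ⟨k, hkd⟩
    obtain ⟨N₂, hN₂⟩ := mem_wtSp.mp hm ⟨k + 1, hk⟩
    rw [← hx] at hN₂
    change (u ^ N₁) m = 0 at hN₁
    change (w ^ N₂) m = 0 at hN₂
    have nil_add : ∀ {f g : End K M} {m : M} {n₁ n₂ : ℕ}, Commute f g → (f ^ n₁) m = 0 →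
        (g ^ n₂) m = 0 → ((f + g) ^ (n₁ + n₂)) m = 0 := by
      intro f g m n₁ n₂ hfg h1 h2
      rw [hfg.add_pow', LinearMap.sum_apply]
      refine Finset.sum_eq_zero fun ⟨i, j⟩ hij => ?_
      rw [Finset.HasAntidiagonal.mem_antidiagonal] at hij
      simp only at hij ⊢
      rw [LinearMap.smul_apply]
      rcases Nat.lt_or_ge i n₁ with h3 | h3
      · obtain ⟨r, rfl⟩ : ∃ r, j = r + n₂ := ⟨j - n₂, by omega⟩
        rw [pow_add g, End.mul_apply, End.mul_apply, h2, map_zero, map_zero, smul_zero]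
      · obtain ⟨r, rfl⟩ : ∃ r, i = r + n₁ := ⟨i - n₁, by omega⟩
        rw [(hfg.pow_pow _ _).eq, pow_add f, End.mul_apply, End.mul_apply, h1, map_zero, map_zero,
          smul_zero]
    have hA : ((u + w) ^ (N₁ + N₂)) (T (k + 1) m) = 0 := by
      rw [← End.mul_apply, ← (hadd.pow_right _).eq, End.mul_apply, nil_add huw hN₁ hN₂, map_zero]
    have hB : ((u * w) ^ N₁) (T (k + 1) m) = 0 := by
      rw [← End.mul_apply, ← (hmul.pow_right _).eq, End.mul_apply, huw.mul_pow, huw.pow_pow N₁ N₁,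
        End.mul_apply, hN₁, map_zero, map_zero]
    have nil_sq : ∀ {f g : End K M}, Commute f g → f * g = u * w → f + g = u + w →
        ∃ N, (f ^ N) (T (k + 1) m) = 0 := by
      intro f g hfg e1 e2
      have e3 : f * f = (u + w) * f + -(u * w) := by
        rw [← e1, ← e2, add_mul, hfg.eq]; abel
      have c1 : Commute (u + w) f := e2 ▸ (Commute.refl f).add_left hfg.symm
      have c2 : Commute (u * w) f := e1 ▸ (Commute.refl f).mul_left hfg.symm
      have c3 : Commute (u * w) (u + w) :=
        ((Commute.refl u).add_right huw).mul_left (huw.symm.add_right (Commute.refl w))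
      refine ⟨2 * (N₁ + N₂ + N₁), ?_⟩
      rw [pow_mul, pow_two, e3]
      refine nil_add (c3.symm.mul_left c2.symm).neg_right ?_ ?_
      · rw [c1.mul_pow, (c1.pow_pow _ _).eq, End.mul_apply, hA, map_zero]
      · rw [neg_pow, End.mul_apply, hB, map_zero]
    rcases lt_trichotomy j.val k with h1 | h1 | h1
    · obtain ⟨N, hN⟩ := mem_wtSp.mp hm j
      refine ⟨N, ?_⟩
      have hc := h.T_commute_jm hk j.2 (by omega) (by omega)
      rw [← pow_semiconj (φ := T (k + 1)) (f := jm T j), hN, map_zero]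
      intro m
      rw [← End.mul_apply, hc.eq, End.mul_apply]
    · obtain rfl : j = ⟨k, hkd⟩ := Fin.ext h1
      exact nil_sq huw rfl rfl
    · by_cases h2 : j.val = k + 1
      · obtain rfl : j = ⟨k + 1, hk⟩ := Fin.ext h2
        rw [← hx]
        exact nil_sq huw.symm huw.eq.symm (add_comm _ _)
      · obtain ⟨N, hN⟩ := mem_wtSp.mp hm j
        refine ⟨N, ?_⟩
        have hc := h.T_commute_jm hk j.2 (by omega) (by omega)
        rw [← pow_semiconj (φ := T (k + 1)) (f := jm T j), hN, map_zero]
        intro m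
        rw [← End.mul_apply, hc.eq, End.mul_apply]
  · have h1 := h.map_jm_sub_wtSp (i := ⟨k, hkd⟩) (j := ⟨k + 1, hk⟩) (c := 1) (by simpa using hx)
    obtain ⟨u, hu, rfl⟩ := h1.symm ▸ hm
    have h2 : T (k + 1) ((jm T k - jm T (k + 1)) u) =
        intw q T k u - ((q : K)⁻¹ - q) • jm T (k + 1) u := by
      rw [intw, LinearMap.add_apply, End.mul_apply, LinearMap.smul_apply, add_sub_cancel_right]
    rw [one_smul]
    change T (k + 1) ((jm T k - jm T (k + 1)) u) ∈ _
    rw [h2]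
    exact Submodule.sub_mem _ (Submodule.mem_sup_right (h.intw_mem_wtSp hu hk))
      (Submodule.mem_sup_left (Submodule.smul_mem _ _ (h.jm_mem_wtSp hu hk)))

theorem wtSp_comp_sw_le (hf : IsUnit (fB q Q d)) {δ : Fin d → Bool} {x : Fin d → K}
    (hx : Adm q Q δ x) {k : ℕ} (hk : k + 1 < d) :
    wtSp T (x ∘ sw k hk) ≤ sgnSp q Q T (δ ∘ sw k hk) := by
  by_cases hb : wtSp T (x ∘ sw k hk) = ⊥
  · rw [hb]; exact bot_le
  · obtain ⟨δ', hδ'⟩ := h.exists_adm hf hb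
    rw [← hx.eq_comp_sw hf hk hδ']
    exact wtSp_le_sgnSp hδ'

theorem intw_mem_sgnSp (hf : IsUnit (fB q Q d)) {δ : Fin d → Bool} {m : M}
    (hm : m ∈ sgnSp q Q T δ) {k : ℕ} (hk : k + 1 < d) :
    intw q T k m ∈ sgnSp q Q T (δ ∘ sw k hk) := by
  suffices h1 : sgnSp q Q T δ ≤ (sgnSp q Q T (δ ∘ sw k hk)).comap (intw q T k) from h1 hm
  exact iSup₂_le fun x hx m hm => h.wtSp_comp_sw_le hf hx hk (h.intw_mem_wtSp hm hk)

theorem T_mem_sgnSp_sup (hf : IsUnit (fB q Q d)) {δ : Fin d → Bool} {m : M}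
    (hm : m ∈ sgnSp q Q T δ) {k : ℕ} (hk : k + 1 < d) :
    T (k + 1) m ∈ sgnSp q Q T δ ⊔ sgnSp q Q T (δ ∘ sw k hk) := by
  suffices h1 : sgnSp q Q T δ ≤
    (sgnSp q Q T δ ⊔ sgnSp q Q T (δ ∘ sw k hk)).comap (T (k + 1)) from h1 hm
  exact iSup₂_le fun x hx m hm => sup_le_sup (wtSp_le_sgnSp hx) (h.wtSp_comp_sw_le hf hx hk)
    (h.T_mem_wtSp hm hk)

end IsHeckeB
end WeightSpaces
section Projections

open Module

variable {K M ι : Type*} [Field K] [AddCommGroup M] [Module K M] [DecidableEq ι]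
  {S : ι → Submodule K M}

theorem bijective_coeLinearMap (hS : DirectSum.IsInternal S) :
    Function.Bijective (DirectSum.coeLinearMap S) :=
  hS

/-- The projection to a summand of an internal direct sum. -/
def proj (hS : DirectSum.IsInternal S) (i : ι) : End K M :=
  (S i).subtype ∘ₗ DirectSum.component K ι (fun i => S i) i ∘ₗ
    (LinearEquiv.ofBijective _ (bijective_coeLinearMap hS)).symm.toLinearMap

theorem proj_mem (hS : DirectSum.IsInternal S) (i : ι) (m : M) : proj hS i m ∈ S i :=
  Submodule.coe_mem _

theorem proj_apply_of_mem (hS : DirectSum.IsInternal S) {i j : ι} {m : M} (hm : m ∈ S j) :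
    proj hS i m = if i = j then m else 0 := by
  have h1 : (LinearEquiv.ofBijective _ (bijective_coeLinearMap hS)).symm m =
      DirectSum.lof K ι (fun i => S i) j ⟨m, hm⟩ := by
    rw [LinearEquiv.symm_apply_eq]
    simp
  simp only [proj, LinearMap.comp_apply, LinearEquiv.coe_coe, h1, DirectSum.component.of]
  split_ifs with h2 h3 h3
  · subst h2; simp
  · exact absurd h2.symm h3
  · exact absurd h3.symm h2
  · simp

theorem proj_self (hS : DirectSum.IsInternal S) {i : ι} {m : M} (hm : m ∈ S i) :
    proj hS i m = m := by
  rw [proj_apply_of_mem hS hm, if_pos rfl]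

theorem proj_of_ne (hS : DirectSum.IsInternal S) {i j : ι} (hij : i ≠ j) {m : M} (hm : m ∈ S j) :
    proj hS i m = 0 := by
  rw [proj_apply_of_mem hS hm, if_neg hij]

theorem linearMap_ext_of_isInternal {M' : Type*} [AddCommGroup M'] [Module K M']
    (hS : DirectSum.IsInternal S) {f g : M →ₗ[K] M'} (h : ∀ i, ∀ m ∈ S i, f m = g m) : f = g := by
  refine LinearMap.ext fun m => ?_
  have h1 : (⊤ : Submodule K M) ≤ LinearMap.eqLocus f g := by
    rw [← hS.submodule_iSup_eq_top]
    exact iSup_le fun i m hm => h i m hm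
  exact h1 Submodule.mem_top

theorem sum_proj [Fintype ι] (hS : DirectSum.IsInternal S) (m : M) : ∑ i, proj hS i m = m := by
  have h1 : ∑ i, proj hS i = LinearMap.id := by
    refine linearMap_ext_of_isInternal hS fun i m hm => ?_
    rw [LinearMap.sum_apply, Finset.sum_eq_single i]
    · exact proj_self hS hm
    · exact fun j _ hj => proj_of_ne hS hj hm
    · simp
  simpa using congrArg (fun f : End K M => f m) h1

theorem proj_comm (hS : DirectSum.IsInternal S) {i : ι} {A : End K M} (h1 : ∀ m ∈ S i, A m ∈ S i)
    (h2 : ∀ j, j ≠ i → ∀ m ∈ S j, proj hS i (A m) = 0) (m : M) :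
    proj hS i (A m) = A (proj hS i m) := by
  have : proj hS i ∘ₗ A = A ∘ₗ proj hS i := by
    refine linearMap_ext_of_isInternal hS fun j m hm => ?_
    by_cases hj : j = i
    · subst hj
      simp [proj_self hS hm, proj_self hS (h1 m hm)]
    · simp [proj_of_ne hS (Ne.symm hj) hm, h2 j hj m hm]
  exact congrArg (fun f : End K M => f m) this

theorem proj_comm_of_forall_mem (hS : DirectSum.IsInternal S) {A : End K M}
    (h : ∀ i, ∀ m ∈ S i, A m ∈ S i) (i : ι) (m : M) : proj hS i (A m) = A (proj hS i m) :=
  proj_comm hS (h i) (fun j hj m hm => proj_of_ne hS hj.symm (h j m hm)) m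

end Projections

section Family

open Module

variable {K : Type*} [Field K] {d : ℕ} {q Q : Kˣ}
  {M : Type*} [AddCommGroup M] [Module K M] {T : ℕ → End K M}

theorem comp_sw_sw (δ : Fin d → Bool) {k : ℕ} (hk : k + 1 < d) :
    (δ ∘ sw k hk) ∘ sw k hk = δ := by
  funext j; simp [sw]

theorem comp_sw_left (δ : Fin d → Bool) {k : ℕ} (hk : k + 1 < d) :
    (δ ∘ sw k hk) ⟨k, by omega⟩ = δ ⟨k + 1, hk⟩ := by
  simp [sw]

theorem comp_sw_right (δ : Fin d → Bool) {k : ℕ} (hk : k + 1 < d) :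
    (δ ∘ sw k hk) ⟨k + 1, hk⟩ = δ ⟨k, by omega⟩ := by
  simp [sw]

theorem comp_sw_of_ne (δ : Fin d → Bool) {k : ℕ} (hk : k + 1 < d) {j : ℕ} (hj : j < d)
    (h1 : j ≠ k) (h2 : j ≠ k + 1) : (δ ∘ sw k hk) ⟨j, hj⟩ = δ ⟨j, hj⟩ := by
  rw [Function.comp_apply, sw, Equiv.swap_apply_of_ne_of_ne] <;> simpa [Fin.ext_iff]

theorem comp_sw_comm (δ : Fin d → Bool) {k l : ℕ} (hk : k + 1 < d) (hl : l + 1 < d)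
    (hkl : k + 1 < l ∨ l + 1 < k) : (δ ∘ sw k hk) ∘ sw l hl = (δ ∘ sw l hl) ∘ sw k hk := by
  have hc : Commute (sw k hk) (sw l hl) :=
    (Equiv.Perm.disjoint_swap_swap (by simp [Fin.ext_iff]; omega)).commute
  rw [Function.comp_assoc, Function.comp_assoc, ← Equiv.Perm.coe_mul, hc.eq, Equiv.Perm.coe_mul]

theorem comp_sw_of_eq (δ : Fin d → Bool) {k : ℕ} (hk : k + 1 < d)
    (h : δ ⟨k, by omega⟩ = δ ⟨k + 1, hk⟩) : δ ∘ sw k hk = δ := by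
  funext j
  simp only [Function.comp_apply, sw, Equiv.swap_apply_def]
  split_ifs with h1 h2
  · rw [h1, h]
  · rw [h2, h]
  · rfl

/-- The sign sequence of `i` plus signs followed by minus signs. -/
def dom (d i : ℕ) : Fin d → Bool := fun p => decide (p.val < i)

@[simp] theorem dom_apply (d i : ℕ) (p : Fin d) : dom d i p = decide (p.val < i) := rfl

/-- The position `k` is a descent: a minus sign followed by a plus sign. -/
def IsDesc (δ : Fin d → Bool) (k : ℕ) : Prop :=
  ∃ hk : k + 1 < d, δ ⟨k, by omega⟩ = false ∧ δ ⟨k + 1, hk⟩ = true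

/-- The sum of the positions of the plus signs. -/
def plusSum (δ : Fin d → Bool) : ℕ := ∑ j : Fin d, if δ j then j.val else 0

theorem plusSum_comp_sw_lt {δ : Fin d → Bool} {k : ℕ} (h : IsDesc δ k) :
    plusSum (δ ∘ sw k h.1) < plusSum δ := by
  obtain ⟨hk, h1, h2⟩ := h
  have e : plusSum (δ ∘ sw k hk) = ∑ j : Fin d, if δ j then (sw k hk j).val else 0 := by
    rw [plusSum, ← Equiv.sum_comp (sw k hk)]
    simp [sw]
  rw [e, plusSum]
  refine Finset.sum_lt_sum (fun j _ => ?_) ⟨⟨k + 1, hk⟩, Finset.mem_univ _, ?_⟩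
  · split_ifs with hj
    · have hjk : j ≠ ⟨k, by omega⟩ := by rintro rfl; simp [h1] at hj
      simp only [sw, Equiv.swap_apply_def, if_neg hjk]
      split_ifs with h3
      · simp [h3]
      · exact le_rfl
    · exact le_rfl
  · simp [h2, sw]

theorem exists_isDesc_or (δ : Fin d → Bool) :
    (∃ k, IsDesc δ k) ∨ ∃ i ≤ d, δ = dom d i := by
  by_cases h : ∃ k, IsDesc δ k
  · exact Or.inl h
  · right
    have hstep : ∀ k (hk : k + 1 < d), δ ⟨k + 1, hk⟩ = true → δ ⟨k, by omega⟩ = true := by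
      intro k hk h1
      by_contra h2
      exact h ⟨k, hk, by simpa using h2, h1⟩
    have hdown : ∀ k l (hl : l < d) (hkl : k ≤ l), δ ⟨l, hl⟩ = true →
        δ ⟨k, by omega⟩ = true := by
      intro k l hl hkl
      induction l, hkl using Nat.le_induction with
      | base => exact id
      | succ l hkl ih => exact fun h1 => ih (by omega) (hstep l hl h1)
    by_cases hall : ∀ p, δ p = true
    · exact ⟨d, le_rfl, funext fun p => by simp [hall p]⟩
    · push Not at hall
      obtain ⟨p, hp⟩ := hall
      have hex : ∃ i, ∃ hi : i < d, δ ⟨i, hi⟩ ≠ true := ⟨p, p.2, hp⟩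
      classical
      obtain ⟨hid, hi⟩ := Nat.find_spec hex
      refine ⟨Nat.find hex, hid.le, funext fun p => ?_⟩
      by_cases hpi : p.val < Nat.find hex
      · have := Nat.find_min hex hpi
        push Not at this
        rw [dom_apply, decide_eq_true hpi]
        exact this p.2
      · rw [dom_apply, decide_eq_false hpi]
        by_contra h3
        exact hi (hdown _ p.val p.2 (by omega) (by simpa using h3))

open Classical in
/-- The family of subspaces generated by given subspaces under the intertwiners. -/
def fam (q : Kˣ) (T : ℕ → End K M) (Z : (Fin d → Bool) → Submodule K M) (δ : Fin d → Bool) :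
    Submodule K M :=
  if h : ∃ k, IsDesc δ k then
    (fam q T Z (δ ∘ sw h.choose h.choose_spec.1)).map (intw q T h.choose)
  else Z δ
termination_by plusSum δ
decreasing_by exact plusSum_comp_sw_lt h.choose_spec

theorem fam_of_not_isDesc (Z : (Fin d → Bool) → Submodule K M) {δ : Fin d → Bool}
    (h : ¬ ∃ k, IsDesc δ k) : fam q T Z δ = Z δ := by
  rw [fam, dif_neg h]

namespace IsHeckeB

variable (h : IsHeckeB q Q d T)
include h

theorem fam_of_isDesc (Z : (Fin d → Bool) → Submodule K M) {δ : Fin d → Bool} {k : ℕ}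
    (hk : IsDesc δ k) : fam q T Z δ = (fam q T Z (δ ∘ sw k hk.1)).map (intw q T k) := by
  induction hn : plusSum δ using Nat.strong_induction_on generalizing δ k with
  | _ n ih =>
    subst hn
    have hex : ∃ k, IsDesc δ k := ⟨k, hk⟩
    rw [fam, dif_pos hex]
    suffices key : ∀ l (hl : IsDesc δ l), (fam q T Z (δ ∘ sw l hl.1)).map (intw q T l) =
      (fam q T Z (δ ∘ sw k hk.1)).map (intw q T k) from key _ hex.choose_spec
    intro l hl
    by_cases hkl : k = l
    · subst hkl; rfl
    · obtain ⟨k1, k2, k3⟩ := id hk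
      obtain ⟨l1, l2, l3⟩ := id hl
      have hfar : k + 1 < l ∨ l + 1 < k := by
        by_contra hc
        rcases (by omega : l = k + 1 ∨ k = l + 1) with rfl | rfl
        · rw [k3] at l2; exact absurd l2 (by simp)
        · rw [l3] at k2; exact absurd k2 (by simp)
      have e1 : IsDesc (δ ∘ sw l l1) k :=
        ⟨k1, by rw [comp_sw_of_ne _ _ _ (by omega) (by omega), k2],
          by rw [comp_sw_of_ne _ _ _ (by omega) (by omega), k3]⟩
      have e2 : IsDesc (δ ∘ sw k k1) l :=
        ⟨l1, by rw [comp_sw_of_ne _ _ _ (by omega) (by omega), l2],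
          by rw [comp_sw_of_ne _ _ _ (by omega) (by omega), l3]⟩
      rw [ih _ (plusSum_comp_sw_lt hl) e1 rfl, ih _ (plusSum_comp_sw_lt hk) e2 rfl,
        comp_sw_comm δ l1 k1 (by omega), ← Submodule.map_comp, ← Submodule.map_comp]
      congr 1
      exact (h.intw_commute l1 k1 (by omega)).eq

/-- The square of an intertwiner preserves subspaces stable under the Jucys–Murphy elements. -/
theorem intw_intw_mem {W : Submodule K M} (hW : ∀ j < d, ∀ w ∈ W, jm T j w ∈ W) {k : ℕ}
    (hk : k + 1 < d) {w : M} (hw : w ∈ W) : intw q T k (intw q T k w) ∈ W := by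
  rw [← End.mul_apply, h.intw_sq hk, LinearMap.neg_apply, End.mul_apply]
  have key : ∀ (c : K) w, w ∈ W → (jm T k - c • jm T (k + 1)) w ∈ W := fun c w hw =>
    Submodule.sub_mem _ (hW _ (by omega) _ hw) (Submodule.smul_mem _ _ (hW _ hk _ hw))
  exact Submodule.neg_mem _ (key _ _ (key _ _ hw))

variable [FiniteDimensional K M]

theorem injOn_jm_sub (hf : IsUnit (fB q Q d)) {δ : Fin d → Bool} {k : ℕ} (hk : k + 1 < d)
    (hs : δ ⟨k, by omega⟩ ≠ δ ⟨k + 1, hk⟩) {m : M} (hm : m ∈ sgnSp q Q T δ)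
    (h0 : (jm T k - jm T (k + 1)) m = 0) : m = 0 := by
  have := injOn_of_map_eq (h.map_jm_sub_sgnSp hf hk hs (e := 0) (by simp)) m hm
  exact this (by simpa using h0)

theorem injOn_intw (hf : IsUnit (fB q Q d)) {δ : Fin d → Bool} {k : ℕ} (hk : k + 1 < d)
    (hs : δ ⟨k, by omega⟩ ≠ δ ⟨k + 1, hk⟩) {m : M} (hm : m ∈ sgnSp q Q T δ)
    (h0 : intw q T k m = 0) : m = 0 := by
  have h1 := congrArg (fun A : End K M => A m) (h.intw_sq hk)
  simp only [End.mul_apply, h0, map_zero, LinearMap.neg_apply] at h1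
  have e1 := injOn_of_map_eq (h.map_jm_sub_sgnSp hf hk hs (e := 1) (by simp))
  have e2 := injOn_of_map_eq (h.map_jm_sub_sgnSp hf hk hs (e := -1) (by simp))
  have e3 : (q : K) ^ (2 * 1 : ℤ) = (q : K) ^ 2 := by norm_cast
  have e4 : (q : K) ^ (2 * (-1) : ℤ) = ((q : K)⁻¹) ^ 2 := by
    rw [mul_neg, mul_one, zpow_neg, inv_pow]; norm_cast
  rw [e3] at e1
  rw [e4] at e2
  refine e2 m hm (e1 _ ?_ (neg_eq_zero.mp h1.symm))
  exact Submodule.sub_mem _ (h.jm_mem_sgnSp hm (by omega))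
    (Submodule.smul_mem _ _ (h.jm_mem_sgnSp hm hk))

theorem map_intw_sq (hf : IsUnit (fB q Q d)) {δ : Fin d → Bool} {k : ℕ} (hk : k + 1 < d)
    (hs : δ ⟨k, by omega⟩ ≠ δ ⟨k + 1, hk⟩) {W : Submodule K M} (hWδ : W ≤ sgnSp q Q T δ)
    (hW : ∀ j < d, ∀ w ∈ W, jm T j w ∈ W) : W.map (intw q T k * intw q T k) = W := by
  refine map_eq_of_injOn (fun w hw => h.intw_intw_mem hW hk hw) fun w hw h0 => ?_
  refine h.injOn_intw hf hk hs (hWδ hw) (h.injOn_intw hf hk (δ := δ ∘ sw k hk) ?_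
    (h.intw_mem_sgnSp hf (hWδ hw) hk) h0)
  rw [comp_sw_left, comp_sw_right]
  exact hs.symm

theorem exists_intw_eq (hf : IsUnit (fB q Q d)) {δ : Fin d → Bool} {k : ℕ} (hk : k + 1 < d)
    (hs : δ ⟨k, by omega⟩ ≠ δ ⟨k + 1, hk⟩) {m : M} (hm : m ∈ sgnSp q Q T δ) :
    ∃ m' ∈ sgnSp q Q T (δ ∘ sw k hk), intw q T k m' = m := by
  have h1 := h.map_intw_sq hf hk hs le_rfl fun j hj w hw => h.jm_mem_sgnSp hw hj
  obtain ⟨u, hu, rfl⟩ := h1.symm ▸ hm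
  exact ⟨_, h.intw_mem_sgnSp hf hu hk, rfl⟩

theorem T_zero_apply (hf : IsUnit (fB q Q d)) (hd : 0 < d) {δ : Fin d → Bool} {m : M}
    (hm : m ∈ sgnSp q Q T δ) : T 0 m = ev q Q (δ ⟨0, hd⟩) 0 • m := by
  set s := δ ⟨0, hd⟩ with hs
  have hinj : sgnSp q Q T δ ⊓ End.eigenspace (T 0) (ev q Q (!s) 0) = ⊥ := by
    by_contra hne
    obtain ⟨m, hm, hm0, x, hx⟩ := h.exists_eigenvector hne (by
      rintro j hj w ⟨hw, hw'⟩
      refine ⟨h.jm_mem_sgnSp hw hj, ?_⟩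
      rw [SetLike.mem_coe, End.mem_eigenspace_iff] at hw' ⊢
      rw [← End.mul_apply, show T 0 * jm T j = jm T j * T 0 from h.jm_commute hd hj,
        End.mul_apply, hw', map_smul])
    obtain ⟨c, hc, hxc⟩ := h.adm_of_eigenvector hf hm.1 hm0 hx ⟨0, hd⟩
    have hc0 : c = 0 := by simpa [cnt] using hc
    have h1 : x ⟨0, hd⟩ • m = ev q Q (!s) 0 • m := by
      rw [← hx ⟨0, hd⟩]; exact End.mem_eigenspace_iff.mp hm.2
    have h2 := smul_left_injective K hm0 h1
    rw [hxc, hc0, ← hs] at h2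
    exact ev_ne hf (by simp) (by simpa using hd) h2
  have h1 : T 0 m - ev q Q s 0 • m ∈ sgnSp q Q T δ ⊓ End.eigenspace (T 0) (ev q Q (!s) 0) := by
    refine ⟨Submodule.sub_mem _ (h.jm_mem_sgnSp hm (j := 0) hd) (Submodule.smul_mem _ _ hm), ?_⟩
    rw [SetLike.mem_coe, End.mem_eigenspace_iff, map_sub, map_smul, ← End.mul_apply, h.quadZero hd]
    simp only [LinearMap.add_apply, LinearMap.smul_apply, End.one_apply]
    have hQ : (Q : K) ≠ 0 := Q.ne_zero
    cases s <;> simp only [ev, Bool.not_true, Bool.not_false, if_true, Bool.false_eq_true,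
      if_false, mul_zero, zpow_zero, mul_one] <;> match_scalars <;> field_simp <;> ring
  rw [hinj, Submodule.mem_bot] at h1
  exact sub_eq_zero.mp h1

/-- The Jucys–Murphy element at the first minus sign acts by a scalar. -/
theorem jm_apply_of_first (hf : IsUnit (fB q Q d)) {k : ℕ} (hk : k < d) {δ : Fin d → Bool}
    (hδ : ∀ j : Fin d, j.val < k → δ j = true) (hδk : δ ⟨k, hk⟩ = false) {m : M}
    (hm : m ∈ sgnSp q Q T δ) : jm T k m = ev q Q false 0 • m := by
  induction k generalizing δ m with
  | zero => rw [← hδk]; exact h.T_zero_apply hf hk hm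
  | succ k ih =>
    have hkd : k < d := by omega
    have h1 : δ ⟨k, hkd⟩ = true := hδ _ (by simp)
    obtain ⟨m', hm', rfl⟩ := h.exists_intw_eq hf hk (by rw [h1, hδk]; simp) hm
    rw [← End.mul_apply, ← h.intw_mul_jm hk, End.mul_apply, ih hkd (δ := δ ∘ sw k hk) ?_ ?_ hm',
      map_smul]
    · intro j hj
      rw [Function.comp_apply, sw_apply_of_lt hk hj]
      exact hδ j (by omega)
    · rw [comp_sw_left, hδk]

/-- A subspace of the dominant sign space stable under the parabolic generators is stable under
the Jucys–Murphy elements. -/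
theorem jm_mem_of_dominant (hf : IsUnit (fB q Q d)) {i : ℕ} {Z : Submodule K M}
    (hZ : Z ≤ sgnSp q Q T (dom d i))
    (hT : ∀ k, k + 1 < d → k + 1 ≠ i → ∀ z ∈ Z, T (k + 1) z ∈ Z) :
    ∀ j < d, ∀ z ∈ Z, jm T j z ∈ Z := by
  intro j
  induction j with
  | zero =>
    intro hd z hz
    change T 0 z ∈ Z
    rw [h.T_zero_apply hf hd (hZ hz)]
    exact Submodule.smul_mem _ _ hz
  | succ j ih =>
    intro hj z hz
    by_cases hi : j + 1 = i
    · rw [h.jm_apply_of_first hf hj (fun l hl => by simp; omega) (by simp; omega) (hZ hz)]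
      exact Submodule.smul_mem _ _ hz
    · exact hT j hj hi _ (ih (by omega) _ (hT j hj hi z hz))

variable (hf : IsUnit (fB q Q d)) {Z : (Fin d → Bool) → Submodule K M}
  (hZ : ∀ i ≤ d, Z (dom d i) ≤ sgnSp q Q T (dom d i))
  (hT : ∀ i ≤ d, ∀ k, k + 1 < d → k + 1 ≠ i → ∀ z ∈ Z (dom d i),
    T (k + 1) z ∈ Z (dom d i))
include hf hZ

theorem fam_le (δ : Fin d → Bool) : fam q T Z δ ≤ sgnSp q Q T δ := by
  induction hn : plusSum δ using Nat.strong_induction_on generalizing δ with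
  | _ n ih =>
    subst hn
    rcases exists_isDesc_or δ with ⟨k, hk⟩ | ⟨i, hi, rfl⟩
    · rw [h.fam_of_isDesc Z hk, Submodule.map_le_iff_le_comap]
      intro m hm
      have := h.intw_mem_sgnSp hf (ih _ (plusSum_comp_sw_lt hk) _ rfl hm) hk.1
      rwa [comp_sw_sw] at this
    · rw [fam_of_not_isDesc]
      · exact hZ i hi
      · rintro ⟨k, hk, h1, h2⟩
        simp at h1 h2
        omega

include hT

theorem jm_mem_fam (δ : Fin d → Bool) :
    ∀ j < d, ∀ z ∈ fam q T Z δ, jm T j z ∈ fam q T Z δ := by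
  induction hn : plusSum δ using Nat.strong_induction_on generalizing δ with
  | _ n ih =>
    subst hn
    intro j hj z hz
    rcases exists_isDesc_or δ with ⟨k, hk⟩ | ⟨i, hi, rfl⟩
    · rw [h.fam_of_isDesc Z hk] at hz ⊢
      obtain ⟨u, hu, rfl⟩ := hz
      have e := h.intw_mul_jm_sw hk.1 ⟨j, hj⟩
      refine ⟨jm T (sw k hk.1 ⟨j, hj⟩) u,
        ih _ (plusSum_comp_sw_lt hk) _ rfl _ (Fin.is_lt _) u hu, ?_⟩
      rw [← End.mul_apply, e, End.mul_apply]
    · rw [fam_of_not_isDesc] at hz ⊢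
      · exact h.jm_mem_of_dominant hf (hZ i hi) (hT i hi) j hj z hz
      all_goals
        rintro ⟨k, hk, h1, h2⟩
        simp at h1 h2
        omega

omit [FiniteDimensional K M] hf hZ in
theorem T_mem_fam (δ : Fin d → Bool) {k : ℕ} (hk : k + 1 < d)
    (hδ : δ ⟨k, by omega⟩ = δ ⟨k + 1, hk⟩) {z : M} (hz : z ∈ fam q T Z δ) :
    T (k + 1) z ∈ fam q T Z δ := by
  induction hn : plusSum δ using Nat.strong_induction_on generalizing δ k z with
  | _ n ih =>
    subst hn
    rcases exists_isDesc_or δ with ⟨l, hl⟩ | ⟨i, hi, rfl⟩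
    · obtain ⟨l1, l2, l3⟩ := id hl
      have hne : l ≠ k := by
        rintro rfl
        rw [l2, l3] at hδ
        exact absurd hδ (by simp)
      by_cases hfar : k + 1 < l ∨ l + 1 < k
      · rw [h.fam_of_isDesc Z hl] at hz ⊢
        obtain ⟨u, hu, rfl⟩ := hz
        refine ⟨T (k + 1) u, ih _ (plusSum_comp_sw_lt hl) _ hk ?_ hu rfl, ?_⟩
        · rw [comp_sw_of_ne _ _ _ (by omega) (by omega), comp_sw_of_ne _ _ _ (by omega) (by omega),
            hδ]
        · rw [← End.mul_apply, ← (h.T_commute_intw hk l1 hfar).eq, End.mul_apply]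
      · rcases (by omega : l = k + 1 ∨ k = l + 1) with rfl | rfl
        · have hd1 : IsDesc (δ ∘ sw (k + 1) l1) k := by
            refine ⟨hk, ?_, ?_⟩
            · rw [comp_sw_of_ne _ _ _ (by omega) (by omega), hδ, l2]
            · rw [comp_sw_left, l3]
          rw [h.fam_of_isDesc Z hl, h.fam_of_isDesc Z hd1] at hz ⊢
          obtain ⟨_, ⟨u, hu, rfl⟩, rfl⟩ := hz
          refine ⟨_, ⟨T (k + 2) u, ih _ ((plusSum_comp_sw_lt hd1).trans (plusSum_comp_sw_lt hl)) _
            l1 ?_ hu rfl, rfl⟩, ?_⟩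
          · rw [comp_sw_right, comp_sw_of_ne _ _ _ (by omega) (by omega),
              comp_sw_of_ne _ _ _ (by omega) (by omega), comp_sw_right, hδ]
          · exact congrArg (fun A : End K M => A u) (h.T_mul_intw_mul_intw l1).1.symm
        · have hd1 : IsDesc (δ ∘ sw l l1) (l + 1) := by
            refine ⟨hk, ?_, ?_⟩
            · rw [comp_sw_right, l2]
            · rw [comp_sw_of_ne _ _ _ (by omega) (by omega), ← hδ, l3]
          rw [h.fam_of_isDesc Z hl, h.fam_of_isDesc Z hd1] at hz ⊢
          obtain ⟨_, ⟨u, hu, rfl⟩, rfl⟩ := hz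
          refine ⟨_, ⟨T (l + 1) u, ih _ ((plusSum_comp_sw_lt hd1).trans (plusSum_comp_sw_lt hl)) _
            l1 ?_ hu rfl, rfl⟩, ?_⟩
          · rw [comp_sw_left _ hk, comp_sw_of_ne _ hk _ (by omega) (by omega), comp_sw_left _ l1,
              comp_sw_of_ne _ l1 _ (by omega) (by omega), hδ]
          · exact congrArg (fun A : End K M => A u) (h.T_mul_intw_mul_intw hk).2.symm
    · rw [fam_of_not_isDesc] at hz ⊢
      · refine hT i hi k hk ?_ z hz
        rintro rfl
        simp at hδ
      all_goals
        rintro ⟨k, hk, h1, h2⟩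
        simp at h1 h2
        omega

theorem intw_mem_fam (δ : Fin d → Bool) {k : ℕ} (hk : k + 1 < d)
    (hδ : δ ⟨k, by omega⟩ ≠ δ ⟨k + 1, hk⟩) {z : M} (hz : z ∈ fam q T Z δ) :
    intw q T k z ∈ fam q T Z (δ ∘ sw k hk) := by
  by_cases h1 : δ ⟨k, by omega⟩ = true
  · have hd : IsDesc (δ ∘ sw k hk) k := by
      refine ⟨hk, ?_, ?_⟩
      · rw [comp_sw_left]; rw [h1] at hδ; simpa using hδ.symm
      · rw [comp_sw_right, h1]
    rw [h.fam_of_isDesc Z hd, comp_sw_sw]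
    exact ⟨z, hz, rfl⟩
  · have h2 : δ ⟨k, by omega⟩ = false := by simpa using h1
    have hd : IsDesc δ k := ⟨hk, h2, by rw [h2] at hδ; simpa using hδ.symm⟩
    rw [h.fam_of_isDesc Z hd] at hz
    obtain ⟨u, hu, rfl⟩ := hz
    exact h.intw_intw_mem (h.jm_mem_fam hf hZ hT _) hk hu

/-- The sum of the family is stable under the Hecke algebra. -/
theorem T_mem_iSup_fam {j : ℕ} (hj : j < d) {z : M} (hz : z ∈ ⨆ δ, fam q T Z δ) :
    T j z ∈ ⨆ δ, fam q T Z δ := by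
  suffices h1 : (⨆ δ, fam q T Z δ) ≤ (⨆ δ, fam q T Z δ).comap (T j) from h1 hz
  refine iSup_le fun δ z hz => ?_
  rw [Submodule.mem_comap]
  obtain _ | k := j
  · exact Submodule.mem_iSup_of_mem δ (h.jm_mem_fam hf hZ hT δ 0 hj z hz)
  · by_cases hδ : δ ⟨k, by omega⟩ = δ ⟨k + 1, hj⟩
    · exact Submodule.mem_iSup_of_mem δ (h.T_mem_fam hT δ hj hδ hz)
    · have h1 : (fam q T Z δ).map (jm T k - jm T (k + 1)) = fam q T Z δ := by
        refine map_eq_of_injOn (fun w hw => Submodule.sub_mem _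
          (h.jm_mem_fam hf hZ hT δ k (by omega) w hw) (h.jm_mem_fam hf hZ hT δ (k + 1) hj w hw)) ?_
        exact fun w hw h0 => h.injOn_jm_sub hf hj hδ (h.fam_le hf hZ δ hw) h0
      obtain ⟨u, hu, rfl⟩ := h1.symm ▸ hz
      have h2 : T (k + 1) ((jm T k - jm T (k + 1)) u) =
          intw q T k u - ((q : K)⁻¹ - q) • jm T (k + 1) u := by
        rw [intw, LinearMap.add_apply, End.mul_apply, LinearMap.smul_apply, add_sub_cancel_right]
      rw [h2]
      exact Submodule.sub_mem _ (Submodule.mem_iSup_of_mem _ (h.intw_mem_fam hf hZ hT δ hj hδ hu))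
        (Submodule.smul_mem _ _ (Submodule.mem_iSup_of_mem _
          (h.jm_mem_fam hf hZ hT δ (k + 1) hj u hu)))

end IsHeckeB
end Family
section Extension

open Module

variable {K : Type*} [Field K] {d : ℕ} {q Q : Kˣ}
  {M : Type*} [AddCommGroup M] [Module K M] {T : ℕ → End K M}

theorem cnt_dom {i : ℕ} (hi : i ≤ d) : cnt (dom d i) true d = i := by
  have key : ∀ k ≤ d, cnt (dom d i) true k = min k i := by
    intro k
    induction k with
    | zero => simp [cnt]
    | succ k ih =>
      intro hk
      rw [cnt_succ _ _ hk, ih (by omega), dom_apply]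
      by_cases h : k < i <;> simp [h] <;> omega
  rw [key d le_rfl, min_eq_right hi]

theorem dom_eq_dom {i k : ℕ} (hk : k + 1 < d) (hi : k + 1 ≠ i) :
    dom d i ⟨k, by omega⟩ = dom d i ⟨k + 1, hk⟩ := by
  rw [dom_apply, dom_apply]
  congr 1
  simp only [eq_iff_iff]
  omega

theorem intw_semiconj {M' : Type*} [AddCommGroup M'] [Module K M'] {T' : ℕ → End K M'}
    {φ : M →ₗ[K] M'} (h : ∀ j < d, ∀ m, φ (T j m) = T' j (φ m)) {k : ℕ} (hk : k + 1 < d) (m : M) :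
    φ (intw q T k m) = intw q T' k (φ m) := by
  have h1 := jm_semiconj h
  simp only [intw, LinearMap.add_apply, End.mul_apply, LinearMap.smul_apply, LinearMap.sub_apply,
    map_add, map_smul, map_sub, h _ hk, h1 k (by omega), h1 (k + 1) hk]

namespace IsHeckeB

/-- The diagonal action on a product. -/
theorem prodMap (h : IsHeckeB q Q d T) :
    IsHeckeB q Q d fun j => ((T j).prodMap (T j) : End K (M × M)) where
  quadZero hd := by
    rw [LinearMap.prodMap_mul, h.quadZero hd]; ext <;> simp
  quad k hk := by
    rw [LinearMap.prodMap_mul, h.quad k hk]; ext <;> simp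
  braidZero hd := by
    simp only [LinearMap.prodMap_mul, h.braidZero hd]
  braid k hk := by
    simp only [LinearMap.prodMap_mul, h.braid k hk]
  comm i j hij hj := by
    simp only [LinearMap.prodMap_mul, h.comm i j hij hj]

variable (h : IsHeckeB q Q d T) [FiniteDimensional K M] (hf : IsUnit (fB q Q d))
include h hf

theorem T_mem_sgnSp {δ : Fin d → Bool} {k : ℕ} (hk : k + 1 < d)
    (hδ : δ ⟨k, by omega⟩ = δ ⟨k + 1, hk⟩) {m : M} (hm : m ∈ sgnSp q Q T δ) :
    T (k + 1) m ∈ sgnSp q Q T δ := by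
  have := h.T_mem_sgnSp_sup hf hm hk
  rwa [comp_sw_of_eq δ hk hδ, sup_idem] at this

theorem proj_jm (δ : Fin d → Bool) {j : ℕ} (hj : j < d) (m : M) :
    proj (h.isInternal_sgnSp hf) δ (jm T j m) = jm T j (proj (h.isInternal_sgnSp hf) δ m) :=
  proj_comm_of_forall_mem _ (fun _ _ hm => h.jm_mem_sgnSp hm hj) δ m

theorem proj_T {δ : Fin d → Bool} {k : ℕ} (hk : k + 1 < d)
    (hδ : δ ⟨k, by omega⟩ = δ ⟨k + 1, hk⟩) (m : M) :
    proj (h.isInternal_sgnSp hf) δ (T (k + 1) m) =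
      T (k + 1) (proj (h.isInternal_sgnSp hf) δ m) := by
  refine proj_comm _ (fun m hm => h.T_mem_sgnSp hf hk hδ hm) (fun δ' hδ' m hm => ?_) m
  obtain ⟨a, ha, b, hb, e⟩ := Submodule.mem_sup.mp (h.T_mem_sgnSp_sup hf hm hk)
  have hne : δ ≠ δ' ∘ sw k hk := by
    intro e'
    apply hδ'
    rw [← comp_sw_sw δ' hk, ← e', comp_sw_of_eq δ hk hδ]
  rw [← e, map_add, proj_of_ne _ hδ'.symm ha, proj_of_ne _ hne hb, add_zero]

theorem proj_intw (δ : Fin d → Bool) {k : ℕ} (hk : k + 1 < d) (m : M) :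
    proj (h.isInternal_sgnSp hf) (δ ∘ sw k hk) (intw q T k m) =
      intw q T k (proj (h.isInternal_sgnSp hf) δ m) := by
  have : proj (h.isInternal_sgnSp hf) (δ ∘ sw k hk) ∘ₗ intw q T k =
      intw q T k ∘ₗ proj (h.isInternal_sgnSp hf) δ := by
    refine linearMap_ext_of_isInternal (h.isInternal_sgnSp hf) fun δ' m hm => ?_
    have h1 := h.intw_mem_sgnSp hf hm hk
    by_cases hδ : δ = δ'
    · subst hδ
      simp [proj_self _ hm, proj_self _ h1]
    · have hne : δ ∘ sw k hk ≠ δ' ∘ sw k hk := fun e => hδ (by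
        rw [← comp_sw_sw δ hk, e, comp_sw_sw])
      simp [proj_of_ne _ hδ hm, proj_of_ne _ hne h1]
  exact congrArg (fun f : End K M => f m) this

theorem proj_mem_fam {Z : (Fin d → Bool) → Submodule K M}
    (hZ : ∀ i ≤ d, Z (dom d i) ≤ sgnSp q Q T (dom d i)) (δ : Fin d → Bool) {z : M}
    (hz : z ∈ ⨆ δ, fam q T Z δ) : proj (h.isInternal_sgnSp hf) δ z ∈ fam q T Z δ := by
  suffices h1 : (⨆ δ, fam q T Z δ) ≤ (fam q T Z δ).comap (proj (h.isInternal_sgnSp hf) δ) from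
    h1 hz
  refine iSup_le fun δ' z hz => ?_
  rw [Submodule.mem_comap, proj_apply_of_mem _ (h.fam_le hf hZ δ' hz)]
  split_ifs with e
  · rwa [e]
  · exact Submodule.zero_mem _

/-- The dominant sign spaces generate the module. -/
theorem eq_top_of_dom_le {W : Submodule K M} (hW : ∀ j < d, ∀ w ∈ W, T j w ∈ W)
    (hdom : ∀ i ≤ d, sgnSp q Q T (dom d i) ≤ W) : W = ⊤ := by
  have hjm : ∀ j < d, ∀ w ∈ W, jm T j w ∈ W := by
    intro j
    induction j with
    | zero => exact hW 0
    | succ j ih => exact fun hj w hw => hW _ hj _ (ih (by omega) _ (hW _ hj _ hw))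
  rw [eq_top_iff, ← h.iSup_sgnSp hf]
  refine iSup_le fun δ => ?_
  induction hn : plusSum δ using Nat.strong_induction_on generalizing δ with
  | _ n ih =>
    subst hn
    rcases exists_isDesc_or δ with ⟨k, hk⟩ | ⟨i, hi, rfl⟩
    · intro m hm
      obtain ⟨m', hm', rfl⟩ := h.exists_intw_eq hf hk.1 (by rw [hk.2.1, hk.2.2]; simp) hm
      have h1 := ih _ (plusSum_comp_sw_lt hk) _ rfl hm'
      rw [intw, LinearMap.add_apply, End.mul_apply, LinearMap.smul_apply]
      refine Submodule.add_mem _ (hW _ hk.1 _ (Submodule.sub_mem _ ?_ ?_))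
        (Submodule.smul_mem _ _ ?_)
      · exact hjm _ (by have := hk.1; omega) _ h1
      · exact hjm _ hk.1 _ h1
      · exact hjm _ hk.1 _ h1
    · exact hdom i hi

/-- Endomorphisms of the dominant sign spaces that commute with the parabolic generators extend to
the whole module. -/
theorem exists_extension {ψ : ℕ → End K M}
    (hψ : ∀ i ≤ d, ∀ m ∈ sgnSp q Q T (dom d i), ψ i m ∈ sgnSp q Q T (dom d i))
    (hψT : ∀ i ≤ d, ∀ k, k + 1 < d → k + 1 ≠ i → ∀ m ∈ sgnSp q Q T (dom d i),
      ψ i (T (k + 1) m) = T (k + 1) (ψ i m)) :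
    ∃ φ : End K M, (∀ j < d, ∀ m, φ (T j m) = T j (φ m)) ∧
      ∀ i ≤ d, ∀ m ∈ sgnSp q Q T (dom d i), φ m = ψ i m := by
  set T' : ℕ → End K (M × M) := fun j => (T j).prodMap (T j) with hT'
  have h' : IsHeckeB q Q d T' := h.prodMap
  have hfst : ∀ j < d, ∀ z, LinearMap.fst K M M (T' j z) = T j (LinearMap.fst K M M z) :=
    fun j _ z => rfl
  have hinl : ∀ j < d, ∀ m, LinearMap.inl K M M (T j m) = T' j (LinearMap.inl K M M m) :=
    fun j _ m => by simp [hT']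
  have hinr : ∀ j < d, ∀ m, LinearMap.inr K M M (T j m) = T' j (LinearMap.inr K M M m) :=
    fun j _ m => by simp [hT']
  set Z : (Fin d → Bool) → Submodule K (M × M) := fun δ =>
    (sgnSp q Q T δ).map (LinearMap.prod LinearMap.id (ψ (cnt δ true d))) with hZdef
  have hZ' : ∀ i ≤ d, Z (dom d i) =
      (sgnSp q Q T (dom d i)).map (LinearMap.prod LinearMap.id (ψ i)) := by
    intro i hi; rw [hZdef]; simp only; rw [cnt_dom hi]
  have hZ : ∀ i ≤ d, Z (dom d i) ≤ sgnSp q Q T' (dom d i) := by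
    intro i hi
    rw [hZ' i hi]
    rintro _ ⟨m, hm, rfl⟩
    have h1 := map_mem_sgnSp (q := q) (Q := Q) (jm_semiconj hinl) hm
    have h2 := map_mem_sgnSp (q := q) (Q := Q) (jm_semiconj hinr) (hψ i hi m hm)
    simpa using Submodule.add_mem _ h1 h2
  have hT : ∀ i ≤ d, ∀ k, k + 1 < d → k + 1 ≠ i → ∀ z ∈ Z (dom d i),
      T' (k + 1) z ∈ Z (dom d i) := by
    intro i hi k hk hki z hz
    rw [hZ' i hi] at hz ⊢
    obtain ⟨m, hm, rfl⟩ := hz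
    refine ⟨T (k + 1) m, h.T_mem_sgnSp hf hk (dom_eq_dom hk hki) hm, ?_⟩
    simp [hT', hψT i hi k hk hki m hm]
  have hdomG : ∀ i ≤ d, Z (dom d i) ≤ ⨆ δ, fam q T' Z δ := by
    intro i hi
    rw [← fam_of_not_isDesc (q := q) (T := T') Z (δ := dom d i)]
    · exact le_iSup _ _
    · rintro ⟨k, hk, h1, h2⟩
      simp at h1 h2
      omega
  set G := ⨆ δ, fam q T' Z δ with hG
  have hGT : ∀ j < d, ∀ z ∈ G, T' j z ∈ G := fun j hj z hz => h'.T_mem_iSup_fam hf hZ hT hj hz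
  have hsurj : G.map (LinearMap.fst K M M) = ⊤ := by
    refine h.eq_top_of_dom_le hf ?_ ?_
    · rintro j hj _ ⟨z, hz, rfl⟩
      exact ⟨T' j z, hGT j hj z hz, rfl⟩
    · intro i hi m hm
      refine ⟨(m, ψ i m), hdomG i hi ?_, rfl⟩
      rw [hZ' i hi]
      exact ⟨m, hm, rfl⟩
  have hfam : ∀ δ, ∀ z ∈ fam q T' Z δ, z.1 = 0 → z = 0 := by
    intro δ
    induction hn : plusSum δ using Nat.strong_induction_on generalizing δ with
    | _ n ih =>
      subst hn
      intro z hz hz0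
      rcases exists_isDesc_or δ with ⟨k, hk⟩ | ⟨i, hi, rfl⟩
      · rw [h'.fam_of_isDesc Z hk] at hz
        obtain ⟨u, hu, rfl⟩ := hz
        have h1 : intw q T k u.1 = 0 := by
          rw [← hz0]; exact (intw_semiconj hfst hk.1 u).symm
        have h2 : u.1 ∈ sgnSp q Q T (δ ∘ sw k hk.1) :=
          map_mem_sgnSp (jm_semiconj hfst) (h'.fam_le hf hZ _ hu)
        have h3 := h.injOn_intw hf hk.1 (by
          rw [comp_sw_left, comp_sw_right, hk.2.1, hk.2.2]; simp) h2 h1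
        rw [ih _ (plusSum_comp_sw_lt hk) _ rfl u hu h3, map_zero]
      · rw [fam_of_not_isDesc, hZ' i hi] at hz
        · obtain ⟨m, hm, rfl⟩ := hz
          have : m = 0 := hz0
          rw [this, map_zero]
        · rintro ⟨k, hk, h1, h2⟩
          simp at h1 h2
          omega
  have hinj : ∀ z ∈ G, z.1 = 0 → z = 0 := by
    intro z hz hz0
    have hproj : ∀ δ, (proj (h'.isInternal_sgnSp hf) δ z).1 =
        proj (h.isInternal_sgnSp hf) δ z.1 := by
      intro δ
      have : LinearMap.fst K M M ∘ₗ proj (h'.isInternal_sgnSp hf) δ =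
          proj (h.isInternal_sgnSp hf) δ ∘ₗ LinearMap.fst K M M := by
        refine linearMap_ext_of_isInternal (h'.isInternal_sgnSp hf) fun δ' z hz => ?_
        have h1 : z.1 ∈ sgnSp q Q T δ' := map_mem_sgnSp (jm_semiconj hfst) hz
        by_cases e : δ = δ'
        · subst e
          simp [proj_self _ hz, proj_self _ h1]
        · simp [proj_of_ne _ e hz, proj_of_ne _ e h1]
      exact congrArg (fun f : M × M →ₗ[K] M => f z) this
    rw [← sum_proj (h'.isInternal_sgnSp hf) z]
    refine Finset.sum_eq_zero fun δ _ => hfam δ _ (h'.proj_mem_fam hf hZ δ hz) ?_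
    rw [hproj, hz0, map_zero]
  have hbij : Function.Bijective ((LinearMap.fst K M M).domRestrict G) := by
    constructor
    · rw [← LinearMap.ker_eq_bot, LinearMap.ker_eq_bot']
      exact fun z hz => Subtype.ext (hinj z z.2 hz)
    · intro m
      obtain ⟨z, hz, e⟩ := hsurj.symm ▸ (Submodule.mem_top : m ∈ ⊤)
      exact ⟨⟨z, hz⟩, e⟩
  set e := LinearEquiv.ofBijective _ hbij with he
  set φ : End K M := LinearMap.snd K M M ∘ₗ G.subtype ∘ₗ e.symm.toLinearMap with hφ
  have hmem : ∀ m, (m, φ m) ∈ G := by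
    intro m
    have h1 : (e.symm m : M × M) = (m, φ m) := by
      refine Prod.ext ?_ rfl
      exact e.apply_symm_apply m
    rw [← h1]
    exact (e.symm m).2
  have huniq : ∀ m y, (m, y) ∈ G → φ m = y := by
    intro m y hy
    have h1 := hinj _ (Submodule.sub_mem _ (hmem m) hy) (by simp)
    exact sub_eq_zero.mp (congrArg Prod.snd h1)
  refine ⟨φ, fun j hj m => huniq _ _ (hGT j hj _ (hmem m)), fun i hi m hm => huniq _ _ ?_⟩
  refine hdomG i hi ?_
  rw [hZ' i hi]
  exact ⟨m, hm, rfl⟩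

theorem eq_of_eqOn_dom {φ φ' : End K M} (hφ : ∀ j < d, ∀ m, φ (T j m) = T j (φ m))
    (hφ' : ∀ j < d, ∀ m, φ' (T j m) = T j (φ' m))
    (he : ∀ i ≤ d, ∀ m ∈ sgnSp q Q T (dom d i), φ m = φ' m) : φ = φ' := by
  have h1 : LinearMap.eqLocus φ φ' = ⊤ := by
    refine h.eq_top_of_dom_le hf (fun j hj w hw => ?_) fun i hi m hm => he i hi m hm
    rw [LinearMap.mem_eqLocus] at hw ⊢
    rw [hφ j hj, hφ' j hj, hw]
  exact LinearMap.ext fun m => (h1.symm ▸ Submodule.mem_top : m ∈ LinearMap.eqLocus φ φ')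

end IsHeckeB
end Extension
section Letters

theorem mem_I {n : ℕ} {x : ℤ} : x ∈ I n ↔ (-((n / 2 : ℕ) : ℤ) ≤ x ∧ x ≤ ((n / 2 : ℕ) : ℤ)) ∧
    (Even n → x ≠ 0) := by
  simp [I]

theorem card_filter_pos (n : ℕ) : ((I n).filter fun x => 0 < x).card = n / 2 := by
  have : (I n).filter (fun x => 0 < x) = Finset.Icc 1 ((n / 2 : ℕ) : ℤ) := by
    ext x
    simp only [Finset.mem_filter, mem_I, Finset.mem_Icc]
    constructor
    · rintro ⟨⟨h1, h2⟩, h3⟩; omega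
    · rintro ⟨h1, h2⟩
      exact ⟨⟨⟨by omega, by omega⟩, fun _ => by omega⟩, by omega⟩
  rw [this, Int.card_Icc]
  omega

theorem card_filter_nonneg (n : ℕ) : ((I n).filter fun x => 0 ≤ x).card = (n + 1) / 2 := by
  rcases Nat.even_or_odd n with hn | hn
  · have : (I n).filter (fun x => 0 ≤ x) = (I n).filter fun x => 0 < x := by
      refine Finset.filter_congr fun x hx => ?_
      have := (mem_I.mp hx).2 hn
      omega
    rw [this, card_filter_pos]
    obtain ⟨r, rfl⟩ := hn
    omega
  · have : (I n).filter (fun x => 0 ≤ x) = Finset.Icc 0 ((n / 2 : ℕ) : ℤ) := by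
      ext x
      simp only [Finset.mem_filter, mem_I, Finset.mem_Icc]
      constructor
      · rintro ⟨⟨h1, h2⟩, h3⟩; omega
      · rintro ⟨h1, h2⟩
        exact ⟨⟨⟨by omega, by omega⟩, fun h => absurd h (Nat.not_even_iff_odd.mpr hn)⟩, h1⟩
    rw [this]
    obtain ⟨r, rfl⟩ := hn
    simp
    omega

theorem card_I (n : ℕ) : (I n).card = n := by
  have h1 : ((I n).filter fun x => ¬ 0 ≤ x).card = ((I n).filter fun x => 0 < x).card := by
    refine Finset.card_bij (fun x _ => -x) ?_ ?_ ?_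
    · intro x hx
      simp only [Finset.mem_filter, mem_I] at hx ⊢
      exact ⟨⟨⟨by omega, by omega⟩, fun h => by have := hx.1.2 h; omega⟩, by omega⟩
    · intro x _ y _ e; simpa using e
    · intro x hx
      simp only [Finset.mem_filter, mem_I] at hx
      refine ⟨-x, ?_, by simp⟩
      simp only [Finset.mem_filter, mem_I]
      exact ⟨⟨⟨by omega, by omega⟩, fun h => by have := hx.1.2 h; omega⟩, by omega⟩
  have h2 := Finset.card_filter_add_card_filter_not (s := I n) (fun x => 0 ≤ x)
  rw [h1, card_filter_nonneg, card_filter_pos] at h2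
  omega

/-- The order isomorphism of `I ⌈n/2⌉` with the nonnegative letters of `I n`. -/
def nonnegIso (n : ℕ) : I ((n + 1) / 2) ≃o (I n).filter fun x => 0 ≤ x :=
  ((I ((n + 1) / 2)).orderIsoOfFin (card_I _)).symm.trans
    (Finset.orderIsoOfFin _ (card_filter_nonneg n))

/-- The order isomorphism of `I ⌊n/2⌋` with the positive letters of `I n`. -/
def posIso (n : ℕ) : I (n / 2) ≃o (I n).filter fun x => 0 < x :=
  ((I (n / 2)).orderIsoOfFin (card_I _)).symm.trans
    (Finset.orderIsoOfFin _ (card_filter_pos n))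

/-- The embedding of the letters of `I ⌈n/2⌉` as nonnegative letters. -/
def nonnegEmb (n : ℕ) (x : I ((n + 1) / 2)) : I n :=
  ⟨nonnegIso n x, (Finset.mem_filter.mp (nonnegIso n x).2).1⟩

/-- The embedding of the letters of `I ⌊n/2⌋` as positive letters. -/
def posEmb (n : ℕ) (x : I (n / 2)) : I n :=
  ⟨posIso n x, (Finset.mem_filter.mp (posIso n x).2).1⟩

theorem nonnegEmb_lt {n : ℕ} {x y : I ((n + 1) / 2)} :
    (nonnegEmb n x : ℤ) < nonnegEmb n y ↔ (x : ℤ) < y :=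
  (nonnegIso n).lt_iff_lt

theorem posEmb_lt {n : ℕ} {x y : I (n / 2)} : (posEmb n x : ℤ) < posEmb n y ↔ (x : ℤ) < y :=
  (posIso n).lt_iff_lt

theorem exists_nonnegEmb {n : ℕ} {x : I n} (hx : 0 ≤ (x : ℤ)) : ∃ y, nonnegEmb n y = x :=
  ⟨(nonnegIso n).symm ⟨x, Finset.mem_filter.mpr ⟨x.2, hx⟩⟩, by simp [nonnegEmb]⟩

theorem exists_posEmb {n : ℕ} {x : I n} (hx : 0 < (x : ℤ)) : ∃ y, posEmb n y = x :=
  ⟨(posIso n).symm ⟨x, Finset.mem_filter.mpr ⟨x.2, hx⟩⟩, by simp [posEmb]⟩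

end Letters

section Words

open Module

variable {K : Type*} [Field K] {q Q : Kˣ} {n d : ℕ}

/-- The operators `T_0, …, T_{d-1}` on tensor space, indexed by natural numbers. -/
def opT (q Q : Kˣ) (n d j : ℕ) : End K (TensorSpace K n d) :=
  if hj : j < d then opB q Q n d ⟨j, hj⟩ else 0

theorem opT_zero (hd : 0 < d) : opT q Q n d 0 = signOp Q ⟨0, hd⟩ := by
  simp [opT, opB, hd]

theorem opT_succ {k : ℕ} (hk : k + 1 < d) :
    opT q Q n d (k + 1) = swapOp q ⟨k, by omega⟩ ⟨k + 1, hk⟩ := by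
  simp [opT, opB, hk]

theorem isHeckeB_opT : IsHeckeB q Q d (opT q Q n d) where
  quadZero hd := by rw [opT_zero hd]; exact signOp_sq _ _
  quad k hk := by rw [opT_succ hk]; exact swapOp_sq _ _ _
  braidZero hd := by
    rw [opT_zero (by omega), show opT q Q n d 1 = _ from opT_succ (k := 0) hd]
    exact signOp_braid _ _ _ _ (by simp)
  braid k hk := by
    rw [opT_succ (by omega), show opT q Q n d (k + 2) = _ from opT_succ (k := k + 1) hk]
    exact swapOp_braid _ _ _ _ (by simp) (by simp [Fin.ext_iff]; omega) (by simp)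
  comm i j hij hj := by
    obtain _ | j := j
    · omega
    obtain _ | i := i
    · rw [opT_zero (by omega), opT_succ hj]
      exact signOp_comm _ _ _ _ _ (by simp [Fin.ext_iff]; omega) (by simp [Fin.ext_iff])
    · rw [opT_succ (by omega), opT_succ hj]
      apply swapOp_comm <;> simp [Fin.ext_iff] <;> omega

instance : FiniteDimensional K (TensorSpace K n d) := Module.Basis.finiteDimensional_of_finite (v K n d)

theorem finrank_tensorSpace : finrank K (TensorSpace K n d) = n ^ d := by
  rw [finrank_eq_card_basis (v K n d)]
  simp [card_I]

/-- The concatenation of a word in nonnegative letters and a word in positive letters. -/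
def cat (n d i : ℕ) (μ : Fin i → I ((n + 1) / 2)) (ν : Fin (d - i) → I (n / 2)) : Fin d → I n :=
  fun p => if hp : p.val < i then nonnegEmb n (μ ⟨p, hp⟩)
    else posEmb n (ν ⟨p - i, by omega⟩)

/-- The embedding of `V(⌈n/2⌉)^{⊗ i} ⊗ V(⌊n/2⌋)^{⊗ (d - i)}` into `V(n)^{⊗ d}`. -/
def emb (K : Type*) [Field K] (n d i : ℕ) :
    TensorSpace K ((n + 1) / 2) i ⊗[K] TensorSpace K (n / 2) (d - i) →ₗ[K] TensorSpace K n d :=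
  ((v K ((n + 1) / 2) i).tensorProduct (v K (n / 2) (d - i))).constr K fun p =>
    v K n d (cat n d i p.1 p.2)

theorem emb_apply (i : ℕ) (μ : Fin i → I ((n + 1) / 2)) (ν : Fin (d - i) → I (n / 2)) :
    emb K n d i (v K _ i μ ⊗ₜ v K _ (d - i) ν) = v K n d (cat n d i μ ν) := by
  rw [emb, ← Basis.tensorProduct_apply, Basis.constr_basis]

theorem comp_swap_eq {α : Type*} {μ : Fin d → α} {a b : Fin d} {ν : Fin d → α}
    (ha : ν a = μ b) (hb : ν b = μ a) (h : ∀ p, p ≠ a → p ≠ b → ν p = μ p) :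
    μ ∘ Equiv.swap a b = ν := by
  funext p
  by_cases h1 : p = a
  · subst h1; simp [ha]
  · by_cases h2 : p = b
    · subst h2; simp [hb]
    · rw [Function.comp_apply, Equiv.swap_apply_of_ne_of_ne h1 h2, h p h1 h2]

theorem opT_emb_left {i k : ℕ} (hi : i ≤ d) (hk : k + 1 < i)
    (z : TensorSpace K ((n + 1) / 2) i ⊗[K] TensorSpace K (n / 2) (d - i)) :
    opT q Q n d (k + 1) (emb K n d i z) =
      emb K n d i (TensorProduct.map (swapOp q ⟨k, by omega⟩ ⟨k + 1, hk⟩) LinearMap.id z) := by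
  have hkd : k + 1 < d := by omega
  suffices h1 : opT q Q n d (k + 1) ∘ₗ emb K n d i = emb K n d i ∘ₗ
      TensorProduct.map (swapOp q ⟨k, by omega⟩ ⟨k + 1, hk⟩) LinearMap.id from
    congrArg (fun f : _ →ₗ[K] _ => f z) h1
  refine ((v K ((n + 1) / 2) i).tensorProduct (v K (n / 2) (d - i))).ext fun ⟨μ, ν⟩ => ?_
  rw [Basis.tensorProduct_apply, LinearMap.comp_apply, LinearMap.comp_apply, TensorProduct.map_tmul,
    emb_apply, opT_succ hkd, LinearMap.id_apply]
  have ea : cat n d i μ ν ⟨k, by omega⟩ = nonnegEmb n (μ ⟨k, by omega⟩) := by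
    rw [cat, dif_pos (by simp; omega)]
  have eb : cat n d i μ ν ⟨k + 1, hkd⟩ = nonnegEmb n (μ ⟨k + 1, hk⟩) := by
    rw [cat, dif_pos (by simpa using hk)]
  have ec : cat n d i μ ν ∘ Equiv.swap ⟨k, by omega⟩ ⟨k + 1, hkd⟩ =
      cat n d i (μ ∘ Equiv.swap ⟨k, by omega⟩ ⟨k + 1, hk⟩) ν := by
    refine comp_swap_eq ?_ ?_ fun p h1 h2 => ?_
    · rw [eb, cat, dif_pos (by simp; omega)]; simp
    · rw [ea, cat, dif_pos (by simpa using hk)]; simp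
    · unfold cat
      split_ifs with h3
      · rw [Function.comp_apply, Equiv.swap_apply_of_ne_of_ne] <;>
          simp only [ne_eq, Fin.ext_iff] at h1 h2 ⊢ <;> omega
      · rfl
  rcases lt_trichotomy (μ ⟨k, by omega⟩ : ℤ) (μ ⟨k + 1, hk⟩) with h1 | h1 | h1
  · rw [swapOp_lt _ _ _ _ (by rw [ea, eb]; exact nonnegEmb_lt.mpr h1), swapOp_lt _ _ _ _ h1,
      emb_apply, ec]
  · rw [swapOp_eq _ _ _ _ (by rw [ea, eb, Subtype.ext h1]), swapOp_eq _ _ _ _ h1,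
      ← TensorProduct.smul_tmul', map_smul, emb_apply, ec]
  · rw [swapOp_gt _ _ _ _ (by rw [ea, eb]; exact nonnegEmb_lt.mpr h1), swapOp_gt _ _ _ _ h1,
      TensorProduct.add_tmul, ← TensorProduct.smul_tmul', map_add, map_smul, emb_apply, emb_apply, ec]

theorem opT_emb_right {i k : ℕ} (hk : i + k + 1 < d)
    (z : TensorSpace K ((n + 1) / 2) i ⊗[K] TensorSpace K (n / 2) (d - i)) :
    opT q Q n d (i + k + 1) (emb K n d i z) =
      emb K n d i (TensorProduct.map LinearMap.id
        (swapOp q ⟨k, by omega⟩ ⟨k + 1, by omega⟩) z) := by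
  have hk1 : k < d - i := by omega
  have hk2 : k + 1 < d - i := by omega
  suffices h1 : opT q Q n d (i + k + 1) ∘ₗ emb K n d i = emb K n d i ∘ₗ
      TensorProduct.map LinearMap.id (swapOp q ⟨k, hk1⟩ ⟨k + 1, hk2⟩) from
    congrArg (fun f : _ →ₗ[K] _ => f z) h1
  refine ((v K ((n + 1) / 2) i).tensorProduct (v K (n / 2) (d - i))).ext fun ⟨μ, ν⟩ => ?_
  rw [Basis.tensorProduct_apply, LinearMap.comp_apply, LinearMap.comp_apply, TensorProduct.map_tmul,
    emb_apply, opT_succ hk, LinearMap.id_apply]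
  have cat_right : ∀ (ν : Fin (d - i) → I (n / 2)) l (hl : i + l < d),
      cat n d i μ ν ⟨i + l, hl⟩ = posEmb n (ν ⟨l, by omega⟩) := by
    intro ν l hl
    rw [cat, dif_neg (by simp)]
    congr 2
    simp
  have ea := cat_right ν k (by omega)
  have eb : cat n d i μ ν ⟨i + k + 1, hk⟩ = posEmb n (ν ⟨k + 1, hk2⟩) := cat_right ν (k + 1) hk
  have ec : cat n d i μ ν ∘ Equiv.swap ⟨i + k, by omega⟩ ⟨i + k + 1, hk⟩ =
      cat n d i μ (ν ∘ Equiv.swap ⟨k, hk1⟩ ⟨k + 1, hk2⟩) := by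
    refine comp_swap_eq ?_ ?_ fun p h1 h2 => ?_
    · rw [eb, cat_right]; simp
    · rw [ea, show cat n d i μ _ ⟨i + k + 1, hk⟩ = _ from cat_right _ (k + 1) hk]; simp
    · unfold cat
      split_ifs with h3
      · rfl
      · rw [Function.comp_apply, Equiv.swap_apply_of_ne_of_ne] <;>
          simp only [ne_eq, Fin.ext_iff] at h1 h2 ⊢ <;> omega
  rcases lt_trichotomy (ν ⟨k, hk1⟩ : ℤ) (ν ⟨k + 1, hk2⟩) with h1 | h1 | h1
  · rw [swapOp_lt _ _ _ _ (by rw [ea, eb]; exact posEmb_lt.mpr h1), swapOp_lt _ _ _ _ h1,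
      emb_apply, ec]
  · rw [swapOp_eq _ _ _ _ (by rw [ea, eb, Subtype.ext h1]), swapOp_eq _ _ _ _ h1,
      TensorProduct.tmul_smul, map_smul, emb_apply, ec]
  · rw [swapOp_gt _ _ _ _ (by rw [ea, eb]; exact posEmb_lt.mpr h1), swapOp_gt _ _ _ _ h1,
      TensorProduct.tmul_add, TensorProduct.tmul_smul, map_add, map_smul, emb_apply, emb_apply, ec]

/-- A subspace stable under the Hecke algebra that contains the basis vectors of the words whose
zeros precede their positive letters is the whole tensor space. -/
theorem eq_top_of_sorted_mem {G : Submodule K (TensorSpace K n d)}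
    (hG : ∀ j < d, ∀ z ∈ G, opT q Q n d j z ∈ G)
    (hs : ∀ k ≤ d, ∀ μ : Fin d → I n, (∀ p : Fin d, p.val < k → (μ p : ℤ) = 0) →
      (∀ p : Fin d, k ≤ p.val → 0 < (μ p : ℤ)) → v K n d μ ∈ G) : G = ⊤ := by
  have hq : (q : K) ≠ 0 := q.ne_zero
  have hQ : (Q : K) ≠ 0 := Q.ne_zero
  -- membership is invariant under place permutations and sign changes
  have hswap1 : ∀ k (hk : k + 1 < d) (μ : Fin d → I n), v K n d μ ∈ G →
      v K n d (μ ∘ sw k hk) ∈ G := by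
    intro k hk μ hμ
    have h1 := hG _ hk _ hμ
    rw [opT_succ hk] at h1
    rcases lt_trichotomy (μ ⟨k, by omega⟩ : ℤ) (μ ⟨k + 1, hk⟩) with h2 | h2 | h2
    · rwa [swapOp_lt _ _ _ _ h2] at h1
    · rw [swapOp_eq _ _ _ _ h2] at h1
      have := Submodule.smul_mem G (q : K) h1
      rwa [smul_smul, mul_inv_cancel₀ hq, one_smul] at this
    · rw [swapOp_gt _ _ _ _ h2] at h1
      have := Submodule.sub_mem G h1 (Submodule.smul_mem G ((q : K)⁻¹ - q) hμ)
      rwa [add_sub_cancel_right] at this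
  have hsign0 : ∀ (hd : 0 < d) (μ : Fin d → I n), v K n d μ ∈ G →
      v K n d (Function.update μ ⟨0, hd⟩ (neg (μ ⟨0, hd⟩))) ∈ G := by
    intro hd μ hμ
    have h1 := hG _ hd _ hμ
    rw [opT_zero hd] at h1
    rcases lt_trichotomy (μ ⟨0, hd⟩ : ℤ) 0 with h2 | h2 | h2
    · rw [signOp_neg _ _ _ h2] at h1
      have := Submodule.sub_mem G h1 (Submodule.smul_mem G ((Q : K)⁻¹ - Q) hμ)
      rwa [add_sub_cancel_right] at this
    · rw [signOp_zero _ _ _ h2] at h1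
      have := Submodule.smul_mem G (Q : K) h1
      rwa [smul_smul, mul_inv_cancel₀ hQ, one_smul] at this
    · rwa [signOp_pos _ _ _ h2] at h1
  have hperm : ∀ (σ : Equiv.Perm (Fin d)) (μ : Fin d → I n), v K n d μ ∈ G →
      v K n d (μ ∘ σ) ∈ G := by
    intro σ
    obtain _ | d := d
    · intro μ hμ
      rwa [show μ ∘ σ = μ from funext fun p => p.elim0]
    · have hσ : σ ∈ Submonoid.closure
          (Set.range fun i : Fin d => Equiv.swap i.castSucc i.succ) := by
        rw [Equiv.Perm.mclosure_swap_castSucc_succ]; trivial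
      induction hσ using Submonoid.closure_induction with
      | mem σ hσ =>
        obtain ⟨i, rfl⟩ := hσ
        exact hswap1 i (by omega)
      | one => exact fun μ hμ => hμ
      | mul σ τ _ _ h1 h2 =>
        intro μ hμ
        rw [Equiv.Perm.coe_mul, ← Function.comp_assoc]
        exact h2 _ (h1 _ hμ)
  have hsign : ∀ (p : Fin d) (μ : Fin d → I n), v K n d μ ∈ G →
      v K n d (Function.update μ p (neg (μ p))) ∈ G := by
    intro p μ hμ
    have hd : 0 < d := p.pos
    have h1 := hperm (Equiv.swap ⟨0, hd⟩ p) _ (hsign0 hd _ (hperm (Equiv.swap ⟨0, hd⟩ p) μ hμ))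
    convert h1 using 2
    refine (comp_swap_eq ?_ ?_ fun r h2 h3 => ?_).symm
    · by_cases h0 : (⟨0, hd⟩ : Fin d) = p
      · subst h0; simp
      · simp [h0, Function.update_of_ne, Ne.symm h0]
    · simp
    · simp [Function.update_of_ne, h2, h3, Equiv.swap_apply_of_ne_of_ne]
  have hnonneg : ∀ (s : Finset (Fin d)) (μ : Fin d → I n), (∀ p ∉ s, 0 ≤ (μ p : ℤ)) →
      (∀ ν : Fin d → I n, (∀ p, 0 ≤ (ν p : ℤ)) → v K n d ν ∈ G) → v K n d μ ∈ G := by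
    intro s
    induction s using Finset.induction_on with
    | empty => exact fun μ h1 h2 => h2 μ fun p => h1 p (by simp)
    | insert a s ha ih =>
      intro μ h1 h2
      by_cases h3 : 0 ≤ (μ a : ℤ)
      · refine ih μ (fun p hp => ?_) h2
        by_cases hpa : p = a
        · rwa [hpa]
        · exact h1 p (by simp [hpa, hp])
      · have h4 := hsign a _ (ih (Function.update μ a (neg (μ a))) (fun p hp => ?_) h2)
        · simpa using h4
        · by_cases hpa : p = a
          · subst hpa; simp; omega
          · rw [Function.update_of_ne hpa]; exact h1 p (by simp [hpa, hp])
  have hsorted : ∀ ν : Fin d → I n, (∀ p, 0 ≤ (ν p : ℤ)) → v K n d ν ∈ G := by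
    intro ν hν
    set f : Fin d → ℤ := fun p => ν p with hfdef
    have hmono := Tuple.monotone_sort f
    have h1 : v K n d (ν ∘ Tuple.sort f) ∈ G := by
      by_cases hz : ∀ p, (ν (Tuple.sort f p) : ℤ) = 0
      · exact hs d le_rfl _ (fun p _ => hz p) fun p hp => absurd p.2 (by omega)
      · push Not at hz
        have hex : ∃ i, ∃ hi : i < d, (ν (Tuple.sort f ⟨i, hi⟩) : ℤ) ≠ 0 :=
          let ⟨p, hp⟩ := hz; ⟨p, p.2, hp⟩
        classical
        obtain ⟨hid, hi⟩ := Nat.find_spec hex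
        refine hs (Nat.find hex) hid.le _ (fun p hp => ?_) fun p hp => ?_
        · have := Nat.find_min hex hp
          push Not at this
          exact this p.2
        · have h2 : (ν (Tuple.sort f ⟨Nat.find hex, hid⟩) : ℤ) ≤ ν (Tuple.sort f p) := hmono hp
          have h3 := hν (Tuple.sort f ⟨Nat.find hex, hid⟩)
          rw [Function.comp_apply]
          omega
    have h2 := hperm (Tuple.sort f)⁻¹ _ h1
    rwa [Function.comp_assoc, ← Equiv.Perm.coe_mul, mul_inv_cancel, Equiv.Perm.coe_one,
      Function.comp_id] at h2
  rw [eq_top_iff, ← (v K n d).span_eq, Submodule.span_le]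
  rintro _ ⟨μ, rfl⟩
  exact hnonneg Finset.univ μ (by simp) hsorted

end Words
section Closure

open Module

variable {K : Type*} [Field K] {d : ℕ} {q Q : Kˣ}
  {M : Type*} [AddCommGroup M] [Module K M] {T : ℕ → End K M}

/-- The smallest subspace containing `W` and stable under the Jucys–Murphy elements. -/
def jmClosure (d : ℕ) (T : ℕ → End K M) (W : Submodule K M) : Submodule K M :=
  sInf {W' | W ≤ W' ∧ ∀ j < d, ∀ w ∈ W', jm T j w ∈ W'}

theorem le_jmClosure (W : Submodule K M) : W ≤ jmClosure d T W :=
  le_sInf fun _ hW' => hW'.1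

theorem jmClosure_le {W W' : Submodule K M} (h1 : W ≤ W')
    (h2 : ∀ j < d, ∀ w ∈ W', jm T j w ∈ W') : jmClosure d T W ≤ W' :=
  sInf_le ⟨h1, h2⟩

theorem jm_mem_jmClosure {W : Submodule K M} {j : ℕ} (hj : j < d) {w : M}
    (hw : w ∈ jmClosure d T W) : jm T j w ∈ jmClosure d T W := by
  simp only [jmClosure, Submodule.mem_sInf] at hw ⊢
  exact fun W' hW' => hW'.2 j hj w (hw W' hW')

namespace IsHeckeB

variable (h : IsHeckeB q Q d T)
include h

theorem T_mem_jmClosure {W : Submodule K M} {k : ℕ} (hk : k + 1 < d)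
    (hW : ∀ w ∈ W, T (k + 1) w ∈ W) {w : M} (hw : w ∈ jmClosure d T W) :
    T (k + 1) w ∈ jmClosure d T W := by
  suffices h1 : jmClosure d T W ≤
      jmClosure d T W ⊓ (jmClosure d T W).comap (T (k + 1)) from (h1 hw).2
  refine jmClosure_le (le_inf (le_jmClosure W) fun w hw => le_jmClosure W (hW w hw)) ?_
  rintro j hj w ⟨hw, hw'⟩
  refine ⟨jm_mem_jmClosure hj hw, ?_⟩
  change T (k + 1) w ∈ jmClosure d T W at hw'
  change (T (k + 1) * jm T j) w ∈ jmClosure d T W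
  by_cases h1 : j = k
  · subst h1
    rw [h.T_mul_jm hk]
    exact Submodule.sub_mem _ (jm_mem_jmClosure hk hw')
      (Submodule.smul_mem _ _ (jm_mem_jmClosure hk hw))
  · by_cases h2 : j = k + 1
    · subst h2
      rw [h.T_mul_jm_succ hk]
      exact Submodule.add_mem _ (Submodule.smul_mem _ _ (jm_mem_jmClosure hk hw))
        (jm_mem_jmClosure (by omega) hw')
    · rw [(h.T_commute_jm hk hj h1 h2).eq]
      exact jm_mem_jmClosure hj hw'

theorem intw_mem_jmClosure {W : Submodule K M} {k : ℕ} (hk : k + 1 < d)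
    (hW : ∀ w ∈ W, T (k + 1) w ∈ W) {w : M} (hw : w ∈ jmClosure d T W) :
    intw q T k w ∈ jmClosure d T W := by
  rw [intw, LinearMap.add_apply, End.mul_apply, LinearMap.smul_apply]
  exact Submodule.add_mem _ (h.T_mem_jmClosure hk hW (Submodule.sub_mem _
    (jm_mem_jmClosure (by omega) hw) (jm_mem_jmClosure hk hw)))
    (Submodule.smul_mem _ _ (jm_mem_jmClosure hk hw))

variable [FiniteDimensional K M] (hf : IsUnit (fB q Q d))
include hf

/-- The eigenvalues of the trivial representation have only plus signs. -/
theorem sign_of_eigen {k : ℕ} (hk : k ≤ d) {m : M}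
    (hm : ∀ j < k, jm T j m = ev q Q true (-j) • m) {δ : Fin d → Bool}
    (hδ : proj (h.isInternal_sgnSp hf) δ m ≠ 0) : ∀ p : Fin d, p.val < k → δ p = true := by
  set W : Submodule K M := sgnSp q Q T δ ⊓
    ⨅ j : Fin k, End.eigenspace (jm T j) (ev q Q true (-(j : ℤ))) with hW
  have hmW : proj (h.isInternal_sgnSp hf) δ m ∈ W := by
    refine ⟨proj_mem _ _ _, ?_⟩
    simp only [SetLike.mem_coe, Submodule.mem_iInf, End.mem_eigenspace_iff]
    intro j
    rw [← h.proj_jm hf δ (by omega), hm j j.2, map_smul]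
  obtain ⟨u, hu, hu0, x, hx⟩ := h.exists_eigenvector
    ((Submodule.ne_bot_iff W).mpr ⟨_, hmW, hδ⟩) (by
      rintro j hj w ⟨hw, hw'⟩
      refine ⟨h.jm_mem_sgnSp hw hj, ?_⟩
      simp only [SetLike.mem_coe, Submodule.mem_iInf, End.mem_eigenspace_iff] at hw' ⊢
      intro i
      rw [← End.mul_apply, (h.jm_commute (by omega) hj).eq, End.mul_apply, hw' i, map_smul])
  have hadm := h.adm_of_eigenvector hf hu.1 hu0 hx
  rintro ⟨p, hpd⟩
  induction p using Nat.strong_induction_on with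
  | _ p ih =>
    intro hp
    by_contra hne
    obtain ⟨c, hc, hxc⟩ := hadm ⟨p, hpd⟩
    have hfalse : δ ⟨p, hpd⟩ = false := by simpa using hne
    have hcnt : cnt δ false p = 0 := by
      rw [cnt, Finset.card_eq_zero, Finset.filter_eq_empty_iff]
      rintro j - ⟨h1, h2⟩
      rw [ih j h1 j.2 (lt_trans h1 hp)] at h2
      exact absurd h2 (by simp)
    simp only at hc
    rw [hfalse, hcnt] at hc
    have hc0 : c = 0 := by simpa using hc
    rw [hfalse, hc0] at hxc
    have h1 := hu.2
    simp only [SetLike.mem_coe, Submodule.mem_iInf, End.mem_eigenspace_iff] at h1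
    have h2 := h1 ⟨p, hp⟩
    rw [hx ⟨p, hpd⟩] at h2
    have h3 := smul_left_injective K hu0 h2
    rw [hxc] at h3
    refine ev_ne hf (by simp) ?_ h3
    simp only [zero_sub, _root_.neg_neg, Nat.abs_cast]
    exact_mod_cast hpd

end IsHeckeB
end Closure

section Surjectivity

open Module

variable {K : Type*} [Field K] {q Q : Kˣ} {n d : ℕ}

/-- The zeros of `μ` are its first `k` letters, and its other letters are positive. -/
def IsSorted (k : ℕ) (μ : Fin d → I n) : Prop :=
  (∀ p : Fin d, p.val < k → (μ p : ℤ) = 0) ∧ ∀ p : Fin d, k ≤ p.val → 0 < (μ p : ℤ)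

/-- The span of the basis vectors of the sorted words with `k` zeros. -/
def sortedSpan (K : Type*) [Field K] (n d k : ℕ) : Submodule K (TensorSpace K n d) :=
  Submodule.span K (v K n d '' {μ | IsSorted k μ})

theorem IsSorted.comp_sw {k l : ℕ} {μ : Fin d → I n} (hμ : IsSorted k μ) (hl : l + 1 < d)
    (hkl : k ≤ l) : IsSorted k (μ ∘ sw l hl) := by
  refine ⟨fun p hp => ?_, fun p hp => ?_⟩
  · rw [Function.comp_apply, sw_apply_of_lt hl (by omega)]
    exact hμ.1 p hp
  · refine hμ.2 _ ?_
    simp only [sw, Equiv.swap_apply_def]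
    split_ifs with h1 h2 <;> (try simp only [Fin.ext_iff] at *) <;> omega

theorem opT_mem_sortedSpan {k l : ℕ} (hl : l + 1 < d) (hkl : k ≤ l) {w : TensorSpace K n d}
    (hw : w ∈ sortedSpan K n d k) : opT q Q n d (l + 1) w ∈ sortedSpan K n d k := by
  suffices h1 : sortedSpan K n d k ≤ (sortedSpan K n d k).comap (opT q Q n d (l + 1)) from h1 hw
  rw [sortedSpan, Submodule.span_le]
  rintro _ ⟨μ, hμ, rfl⟩
  have h1 : v K n d μ ∈ sortedSpan K n d k := Submodule.subset_span ⟨μ, hμ, rfl⟩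
  have h2 : v K n d (μ ∘ sw l hl) ∈ sortedSpan K n d k :=
    Submodule.subset_span ⟨_, hμ.comp_sw hl hkl, rfl⟩
  rw [SetLike.mem_coe, Submodule.mem_comap, opT_succ hl]
  rcases lt_trichotomy (μ ⟨l, by omega⟩ : ℤ) (μ ⟨l + 1, hl⟩) with h3 | h3 | h3
  · rw [swapOp_lt _ _ _ _ h3]; exact h2
  · rw [swapOp_eq _ _ _ _ h3]; exact Submodule.smul_mem _ _ h2
  · rw [swapOp_gt _ _ _ _ h3]; exact Submodule.add_mem _ h2 (Submodule.smul_mem _ _ h1)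

theorem jm_apply_of_isSorted {k : ℕ} (hk : k ≤ d) {μ : Fin d → I n} (hμ : IsSorted k μ) :
    ∀ j < k, jm (opT q Q n d) j (v K n d μ) = ev q Q true (-j) • v K n d μ := by
  intro j
  induction j with
  | zero =>
    intro h0
    have hd : 0 < d := by omega
    have h1 : (μ ⟨0, hd⟩ : ℤ) = 0 := hμ.1 _ h0
    change opT q Q n d 0 _ = _
    rw [opT_zero hd, signOp_zero _ _ _ h1,
      show neg (μ ⟨0, hd⟩) = μ ⟨0, hd⟩ from Subtype.ext (by simp; omega), Function.update_eq_self]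
    simp [ev]
  | succ j ih =>
    intro hj
    have hjd : j + 1 < d := by omega
    have h1 : (μ ⟨j, by omega⟩ : ℤ) = 0 := hμ.1 _ (by simp; omega)
    have h2 : (μ ⟨j + 1, hjd⟩ : ℤ) = 0 := hμ.1 _ hj
    have h3 : μ ∘ Equiv.swap ⟨j, by omega⟩ ⟨j + 1, hjd⟩ = μ :=
      comp_swap_eq (Subtype.ext (h1.trans h2.symm)) (Subtype.ext (h2.trans h1.symm))
        fun _ _ _ => rfl
    have h4 : opT q Q n d (j + 1) (v K n d μ) = (q : K)⁻¹ • v K n d μ := by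
      rw [opT_succ hjd, swapOp_eq _ _ _ _ (h1.trans h2.symm), h3]
    rw [jm, End.mul_apply, End.mul_apply, h4, map_smul, ih (by omega), map_smul, map_smul, h4,
      smul_smul, smul_smul]
    congr 1
    have hq : (q : K) ≠ 0 := q.ne_zero
    rw [show (-((j + 1 : ℕ) : ℤ)) = -(j : ℤ) + (-1) by push_cast; ring, ← ev_mul_zpow,
      show (q : K) ^ (2 * (-1) : ℤ) = (q : K)⁻¹ * (q : K)⁻¹ by
        rw [mul_neg, mul_one, zpow_neg, zpow_two, mul_inv]]
    ring

theorem v_mem_range_emb {i k : ℕ} (hki : k ≤ i) {μ : Fin d → I n} (hi : i ≤ d)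
    (hμ : IsSorted k μ) : v K n d μ ∈ LinearMap.range (emb K n d i) := by
  have h1 : ∀ p : Fin d, 0 ≤ (μ p : ℤ) := by
    intro p
    rcases Nat.lt_or_ge p.val k with h | h
    · exact (hμ.1 p h).ge
    · exact (hμ.2 p h).le
  choose f hf using fun p => exists_nonnegEmb (h1 p)
  choose g hg using fun p : {p : Fin d // k ≤ p.val} => exists_posEmb (hμ.2 p p.2)
  refine ⟨v K _ i (fun p => f ⟨p, by omega⟩) ⊗ₜ
    v K _ (d - i) (fun p => g ⟨⟨i + p, by omega⟩, by simp; omega⟩), ?_⟩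
  rw [emb_apply]
  congr 1
  funext p
  unfold cat
  split_ifs with hp
  · exact hf p
  · rw [hg]
    congr 1
    exact Fin.ext (by simp; omega)

variable (hf : IsUnit (fB q Q d))

/-- The image of `V(⌈n/2⌉)^{⊗ i} ⊗ V(⌊n/2⌋)^{⊗ (d - i)}` in the dominant sign space. -/
def embDom (hf : IsUnit (fB q Q d)) (n i : ℕ) :
    TensorSpace K ((n + 1) / 2) i ⊗[K] TensorSpace K (n / 2) (d - i) →ₗ[K] TensorSpace K n d :=
  proj ((isHeckeB_opT (n := n)).isInternal_sgnSp hf) (dom d i) ∘ₗ emb K n d i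

theorem opT_embDom_left {i k : ℕ} (hi : i ≤ d) (hk : k + 1 < i)
    (z : TensorSpace K ((n + 1) / 2) i ⊗[K] TensorSpace K (n / 2) (d - i)) :
    opT q Q n d (k + 1) (embDom hf n i z) =
      embDom hf n i (TensorProduct.map (swapOp q ⟨k, by omega⟩ ⟨k + 1, hk⟩) LinearMap.id z) := by
  rw [embDom, LinearMap.comp_apply, LinearMap.comp_apply, ← opT_emb_left (q := q) (Q := Q) hi hk]
  exact (isHeckeB_opT.proj_T hf (by omega) (dom_eq_dom (by omega) (by omega)) _).symm

theorem opT_embDom_right {i k : ℕ} (hk : i + k + 1 < d)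
    (z : TensorSpace K ((n + 1) / 2) i ⊗[K] TensorSpace K (n / 2) (d - i)) :
    opT q Q n d (i + k + 1) (embDom hf n i z) =
      embDom hf n i (TensorProduct.map LinearMap.id
        (swapOp q ⟨k, by omega⟩ ⟨k + 1, by omega⟩) z) := by
  rw [embDom, LinearMap.comp_apply, LinearMap.comp_apply, ← opT_emb_right (q := q) (Q := Q) hk]
  exact (isHeckeB_opT.proj_T hf hk (dom_eq_dom hk (by omega)) _).symm

/-- The subspaces spanned by the images of the tensor products. -/
def embRange (hf : IsUnit (fB q Q d)) (n : ℕ) (δ : Fin d → Bool) :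
    Submodule K (TensorSpace K n d) :=
  LinearMap.range (embDom hf n (cnt δ true d))

theorem embRange_dom {i : ℕ} (hi : i ≤ d) :
    embRange hf n (dom d i) = LinearMap.range (embDom hf n i) := by
  rw [embRange, cnt_dom hi]

theorem embRange_le (i : ℕ) (hi : i ≤ d) :
    embRange hf n (dom d i) ≤ sgnSp q Q (opT q Q n d) (dom d i) := by
  rw [embRange_dom hf hi]
  rintro _ ⟨z, rfl⟩
  exact proj_mem (isHeckeB_opT.isInternal_sgnSp hf) _ _

theorem opT_mem_embRange (i : ℕ) (hi : i ≤ d) (k : ℕ) (hk : k + 1 < d) (hki : k + 1 ≠ i)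
    (z : TensorSpace K n d) (hz : z ∈ embRange hf n (dom d i)) :
    opT q Q n d (k + 1) z ∈ embRange hf n (dom d i) := by
  rw [embRange_dom hf hi] at hz ⊢
  obtain ⟨w, rfl⟩ := hz
  rcases Nat.lt_or_ge (k + 1) i with h1 | h1
  · rw [opT_embDom_left hf hi h1]
    exact ⟨_, rfl⟩
  · obtain ⟨l, rfl⟩ : ∃ l, k = i + l := ⟨k - i, by omega⟩
    rw [opT_embDom_right hf hk]
    exact ⟨_, rfl⟩

theorem proj_mem_fam_embRange {k : ℕ} (hk : k ≤ d) {δ : Fin d → Bool} {g : TensorSpace K n d}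
    (hg : g ∈ jmClosure d (opT q Q n d) (sortedSpan K n d k)) :
    proj (isHeckeB_opT.isInternal_sgnSp hf) δ g ∈
      fam q (opT q Q n d) (embRange hf n) δ := by
  have h : IsHeckeB q Q d (opT q Q n d) := isHeckeB_opT
  induction hn : plusSum δ using Nat.strong_induction_on generalizing δ g with
  | _ N ih =>
    subst hn
    by_cases hδ : ∀ p : Fin d, p.val < k → δ p = true
    · rcases exists_isDesc_or δ with ⟨l, hl⟩ | ⟨i, hi, rfl⟩
      · obtain ⟨l1, l2, l3⟩ := id hl
        have hkl : k ≤ l := by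
          by_contra hlt
          rw [hδ _ (by simp; omega)] at l2
          exact absurd l2 (by simp)
        have hne : δ ⟨l, by omega⟩ ≠ δ ⟨l + 1, l1⟩ := by rw [l2, l3]; simp
        have h1 := ih _ (plusSum_comp_sw_lt hl)
          (h.intw_mem_jmClosure l1 (fun w hw => opT_mem_sortedSpan l1 hkl hw) hg) rfl
        rw [h.proj_intw hf] at h1
        have h2 : intw q (opT q Q n d) l (intw q (opT q Q n d) l
            (proj (h.isInternal_sgnSp hf) δ g)) ∈ fam q (opT q Q n d) (embRange hf n) δ := by
          rw [h.fam_of_isDesc _ hl]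
          exact ⟨_, h1, rfl⟩
        have hle := h.fam_le hf (embRange_le hf) δ
        have h3 := h.map_intw_sq hf l1 hne hle
          (h.jm_mem_fam hf (embRange_le hf) (opT_mem_embRange hf) δ)
        have h4 := h2
        rw [← h3] at h4
        obtain ⟨y, hy, e⟩ := h4
        have h5 := injOn_of_map_eq (h.map_intw_sq hf l1 hne le_rfl fun j hj w hw =>
          h.jm_mem_sgnSp hw hj) (y - proj (h.isInternal_sgnSp hf) δ g)
          (Submodule.sub_mem _ (hle hy) (proj_mem _ _ _))
          (by rw [map_sub, e, End.mul_apply, sub_self])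
        rwa [← sub_eq_zero.mp h5]
      · rw [fam_of_not_isDesc]
        · have hki : k ≤ i := by
            by_contra hlt
            have := hδ ⟨i, by omega⟩ (by simp; omega)
            simp at this
          suffices h1 : jmClosure d (opT q Q n d) (sortedSpan K n d k) ≤
              (embRange hf n (dom d i)).comap (proj (h.isInternal_sgnSp hf) (dom d i)) from h1 hg
          refine jmClosure_le ?_ fun j hj w hw => ?_
          · rw [sortedSpan, Submodule.span_le]
            rintro _ ⟨μ, hμ, rfl⟩
            obtain ⟨z, hz⟩ := v_mem_range_emb (K := K) hki hi hμ
            rw [SetLike.mem_coe, Submodule.mem_comap, ← hz, embRange_dom hf hi]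
            exact ⟨z, rfl⟩
          · rw [Submodule.mem_comap, h.proj_jm hf _ hj]
            exact h.jm_mem_of_dominant hf (embRange_le hf i hi) (opT_mem_embRange hf i hi) j hj _ hw
        · rintro ⟨k, hk, h1, h2⟩
          simp at h1 h2
          omega
    · have h0 : proj (h.isInternal_sgnSp hf) δ g = 0 := by
        suffices h1 : jmClosure d (opT q Q n d) (sortedSpan K n d k) ≤
            LinearMap.ker (proj (h.isInternal_sgnSp hf) δ) from h1 hg
        refine jmClosure_le ?_ fun j hj w hw => ?_
        · rw [sortedSpan, Submodule.span_le]
          rintro _ ⟨μ, hμ, rfl⟩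
          rw [SetLike.mem_coe, LinearMap.mem_ker]
          by_contra hne
          exact hδ (h.sign_of_eigen hf hk (jm_apply_of_isSorted hk hμ) hne)
        · rw [LinearMap.mem_ker] at hw ⊢
          rw [h.proj_jm hf _ hj, hw, map_zero]
      rw [h0]
      exact Submodule.zero_mem _

theorem iSup_fam_embRange : ⨆ δ, fam q (opT q Q n d) (embRange hf n) δ = ⊤ := by
  have h : IsHeckeB q Q d (opT q Q n d) := isHeckeB_opT
  refine eq_top_of_sorted_mem (q := q) (Q := Q) (fun j hj z hz =>
    h.T_mem_iSup_fam hf (embRange_le hf) (opT_mem_embRange hf) hj hz) fun k hk μ h1 h2 => ?_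
  rw [← sum_proj (h.isInternal_sgnSp hf) (v K n d μ)]
  refine Submodule.sum_mem _ fun δ _ => Submodule.mem_iSup_of_mem δ ?_
  exact proj_mem_fam_embRange hf hk (le_jmClosure _ (Submodule.subset_span ⟨μ, ⟨h1, h2⟩, rfl⟩))

theorem fam_embRange_eq (δ : Fin d → Bool) :
    fam q (opT q Q n d) (embRange hf n) δ = sgnSp q Q (opT q Q n d) δ := by
  have h : IsHeckeB q Q d (opT q Q n d) := isHeckeB_opT
  refine le_antisymm (h.fam_le hf (embRange_le hf) δ) fun m hm => ?_
  have h1 := h.proj_mem_fam hf (embRange_le hf) δ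
    (z := m) (by rw [iSup_fam_embRange hf]; exact Submodule.mem_top)
  rwa [proj_self _ hm] at h1

theorem range_embDom {i : ℕ} (hi : i ≤ d) :
    LinearMap.range (embDom hf n i) = sgnSp q Q (opT q Q n d) (dom d i) := by
  rw [← fam_embRange_eq hf, fam_of_not_isDesc, embRange_dom hf hi]
  rintro ⟨k, hk, h1, h2⟩
  simp at h1 h2
  omega

include hf in
theorem finrank_sgnSp_le (δ : Fin d → Bool) :
    finrank K (sgnSp q Q (opT q Q n d) δ) ≤
      ((n + 1) / 2) ^ cnt δ true d * (n / 2) ^ (d - cnt δ true d) := by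
  have h : IsHeckeB q Q d (opT q Q n d) := isHeckeB_opT
  rw [← fam_embRange_eq hf]
  induction hn : plusSum δ using Nat.strong_induction_on generalizing δ with
  | _ N ih =>
    subst hn
    rcases exists_isDesc_or δ with ⟨l, hl⟩ | ⟨i, hi, rfl⟩
    · rw [h.fam_of_isDesc _ hl]
      refine (Submodule.finrank_map_le _ _).trans ?_
      have := ih _ (plusSum_comp_sw_lt hl) _ rfl
      rwa [cnt_comp_sw _ _ _ (by have := hl.1; omega)] at this
    · rw [fam_of_not_isDesc]
      · refine (LinearMap.finrank_range_le _).trans ?_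
        rw [finrank_tensorProduct, finrank_tensorSpace, finrank_tensorSpace]
      · rintro ⟨k, hk, h1, h2⟩
        simp at h1 h2
        omega

theorem sum_signs (a b d : ℕ) :
    ∑ δ : Fin d → Bool, a ^ cnt δ true d * b ^ (d - cnt δ true d) = (a + b) ^ d := by
  have h1 : ∀ δ : Fin d → Bool, a ^ cnt δ true d * b ^ (d - cnt δ true d) =
      ∏ p : Fin d, if δ p = true then a else b := by
    intro δ
    rw [Finset.prod_ite, Finset.prod_const, Finset.prod_const]
    have e1 : cnt δ true d = (Finset.univ.filter fun p => δ p = true).card := by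
      unfold cnt; congr 1; ext p; simp
    have e2 := Finset.card_filter_add_card_filter_not (s := (Finset.univ : Finset (Fin d)))
      (fun p => δ p = true)
    rw [Finset.card_univ, Fintype.card_fin] at e2
    rw [e1]
    congr 2
    omega
  rw [Finset.sum_congr rfl fun δ _ => h1 δ]
  have h2 := Finset.prod_univ_sum (fun _ : Fin d => (Finset.univ : Finset Bool))
    (fun _ s => if s = true then a else b)
  simp only [Fintype.piFinset_univ] at h2
  rw [← h2]
  simp

include hf in
theorem finrank_sgnSp (δ : Fin d → Bool) :
    finrank K (sgnSp q Q (opT q Q n d) δ) =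
      ((n + 1) / 2) ^ cnt δ true d * (n / 2) ^ (d - cnt δ true d) := by
  have h : IsHeckeB q Q d (opT q Q n d) := isHeckeB_opT
  have h1 : ∑ δ : Fin d → Bool, finrank K (sgnSp q Q (opT q Q n d) δ) = n ^ d := by
    rw [← finrank_tensorSpace (K := K), ← Module.finrank_directSum]
    exact (LinearEquiv.ofBijective _
      (bijective_coeLinearMap (h.isInternal_sgnSp hf))).finrank_eq
  have h2 : ∑ δ : Fin d → Bool, finrank K (sgnSp q Q (opT q Q n d) δ) =
      ∑ δ : Fin d → Bool, ((n + 1) / 2) ^ cnt δ true d * (n / 2) ^ (d - cnt δ true d) := by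
    rw [h1, sum_signs]
    congr 1
    omega
  exact (Finset.sum_eq_sum_iff_of_le fun δ _ => finrank_sgnSp_le hf δ).mp h2 δ (Finset.mem_univ δ)

theorem injective_of_finrank_range_eq {M N : Type*} [AddCommGroup M] [Module K M]
    [FiniteDimensional K M] [AddCommGroup N] [Module K N] (e : M →ₗ[K] N)
    (he : finrank K (LinearMap.range e) = finrank K M) : Function.Injective e := by
  rw [← LinearMap.ker_eq_bot, ← Submodule.finrank_eq_zero]
  have h1 := LinearMap.finrank_range_add_finrank_ker e
  omega

theorem injective_embDom {i : ℕ} (hi : i ≤ d) : Function.Injective (embDom hf n i) := by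
  refine injective_of_finrank_range_eq
    (M := TensorSpace K ((n + 1) / 2) i ⊗[K] TensorSpace K (n / 2) (d - i))
    (N := TensorSpace K n d) (embDom hf n i) ?_
  rw [range_embDom hf hi, finrank_sgnSp hf, cnt_dom hi, finrank_tensorProduct, finrank_tensorSpace,
    finrank_tensorSpace]

end Surjectivity
section Commutants

open Module

variable {K : Type*} [Field K]

theorem endRight_lift {X M : Type*} [AddCommGroup M] [Module K M] (f : X → End K M)
    {r : FreeAlgebra K X → FreeAlgebra K X → Prop}
    (hr : ∀ ⦃x y⦄, r x y → FreeAlgebra.lift K (fun x => MulOpposite.op (f x)) x =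
      FreeAlgebra.lift K (fun x => MulOpposite.op (f x)) y) :
    endRight (RingQuot.liftAlgHom K
      ⟨FreeAlgebra.lift K fun x => MulOpposite.op (f x), hr⟩) =
      Subalgebra.centralizer K (Set.range f) := by
  ext φ
  rw [Subalgebra.mem_centralizer_iff]
  constructor
  · rintro hφ _ ⟨x, rfl⟩
    ext m
    have h1 := hφ (RingQuot.mkAlgHom K r (FreeAlgebra.ι K x)) m
    rw [RingQuot.liftAlgHom_mkAlgHom_apply, FreeAlgebra.lift_ι_apply] at h1
    exact h1.symm
  · intro hφ a
    obtain ⟨a, rfl⟩ := RingQuot.mkAlgHom_surjective K r a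
    rw [RingQuot.liftAlgHom_mkAlgHom_apply]
    induction a using FreeAlgebra.induction with
    | grade0 c => intro m; simp [Module.algebraMap_end_apply]
    | grade1 x =>
      intro m
      rw [FreeAlgebra.lift_ι_apply]
      exact (LinearMap.congr_fun (hφ _ ⟨x, rfl⟩) m).symm
    | mul a b ha hb =>
      intro m
      rw [map_mul, MulOpposite.unop_mul, End.mul_apply, End.mul_apply, hb, ha]
    | add a b ha hb =>
      intro m
      rw [map_add, MulOpposite.unop_add, LinearMap.add_apply, LinearMap.add_apply, map_add, ha, hb]

theorem schurA_eq_centralizer (q : Kˣ) (n d : ℕ) :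
    SchurA q n d = Subalgebra.centralizer K (Set.range (opA q n d)) :=
  endRight_lift _ _

theorem schurB_eq_centralizer (q Q : Kˣ) (n d : ℕ) :
    SchurB q Q n d = Subalgebra.centralizer K (Set.range (opB q Q n d)) :=
  endRight_lift _ _

theorem mem_schurB_iff {q Q : Kˣ} {n d : ℕ} {φ : End K (TensorSpace K n d)} :
    φ ∈ SchurB q Q n d ↔ ∀ j < d, ∀ m, φ (opT q Q n d j m) = opT q Q n d j (φ m) := by
  rw [schurB_eq_centralizer, Subalgebra.mem_centralizer_iff]
  constructor
  · intro h j hj m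
    have h1 := LinearMap.congr_fun (h _ ⟨⟨j, hj⟩, rfl⟩) m
    rw [opT, dif_pos hj]
    exact h1.symm
  · rintro h _ ⟨j, rfl⟩
    refine LinearMap.ext fun m => ?_
    have h1 := h j j.2 m
    rw [opT, dif_pos j.2] at h1
    exact h1.symm

/-- The commutant of a tensor product of algebras is the tensor product of the commutants. -/
theorem centralizer_union_tensorProduct {A B : Type*} [Ring A] [Algebra K A] [Ring B] [Algebra K B]
    (S : Set A) (T : Set B) :
    Subalgebra.centralizer K ((Algebra.TensorProduct.includeLeft : A →ₐ[K] A ⊗[K] B) '' S ∪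
      (Algebra.TensorProduct.includeRight : B →ₐ[K] A ⊗[K] B) '' T) =
    (Algebra.TensorProduct.map (Subalgebra.centralizer K S).val
      (Subalgebra.centralizer K T).val).range := by
  apply le_antisymm
  · intro z hz
    rw [Subalgebra.mem_centralizer_iff] at hz
    have h1 : z ∈ Subalgebra.centralizer K
        ((Algebra.TensorProduct.includeLeft : A →ₐ[K] A ⊗[K] B) '' S) := by
      rw [Subalgebra.mem_centralizer_iff]
      exact fun g hg => hz g (Or.inl hg)
    rw [Subalgebra.centralizer_coe_image_includeLeft_eq_center_tensorProduct] at h1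
    obtain ⟨w, rfl⟩ := h1
    have hinj : Function.Injective (Algebra.TensorProduct.map (Subalgebra.centralizer K S).val
        (AlgHom.id K B)) :=
      Module.Flat.rTensor_preserves_injective_linearMap (M := B)
        (Subalgebra.centralizer K S).val.toLinearMap Subtype.val_injective
    have h2 : w ∈ Subalgebra.centralizer K ((Algebra.TensorProduct.includeRight :
        B →ₐ[K] Subalgebra.centralizer K S ⊗[K] B) '' T) := by
      rw [Subalgebra.mem_centralizer_iff]
      rintro _ ⟨t, ht, rfl⟩
      apply hinj
      have := hz (1 ⊗ₜ t) (Or.inr ⟨t, ht, rfl⟩)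
      simpa using this
    rw [Subalgebra.centralizer_coe_image_includeRight_eq_center_tensorProduct] at h2
    obtain ⟨u, rfl⟩ := h2
    refine ⟨u, ?_⟩
    change _ = (Algebra.TensorProduct.map (Subalgebra.centralizer K S).val (AlgHom.id K B)).comp
      (Algebra.TensorProduct.map (AlgHom.id K _) (Subalgebra.centralizer K T).val) u
    rw [← Algebra.TensorProduct.map_comp]
    rfl
  · rintro _ ⟨u, rfl⟩
    rw [Subalgebra.mem_centralizer_iff]
    induction u with
    | zero => intro g _; simp
    | add u w hu hw =>
      intro g hg
      change g * (Algebra.TensorProduct.map _ _) (u + w) = (Algebra.TensorProduct.map _ _) (u + w) * g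
      rw [map_add, mul_add, add_mul]
      exact congrArg₂ _ (hu g hg) (hw g hg)
    | tmul a b =>
      rintro _ (⟨s, hs, rfl⟩ | ⟨t, ht, rfl⟩)
      · have := (Subalgebra.mem_centralizer_iff K).mp a.2 s hs
        simp [this]
      · have := (Subalgebra.mem_centralizer_iff K).mp b.2 t ht
        simp [this]

variable {M N : Type*} [AddCommGroup M] [Module K M] [FiniteDimensional K M]
  [AddCommGroup N] [Module K N] [FiniteDimensional K N]

theorem bijective_endTensorEnd :
    Function.Bijective (endTensorEndAlgHom (R := K) (S := K) (A := K) (M := M) (N := N)) := by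
  convert (homTensorHomEquiv K M N M N).bijective using 1
  funext x
  rw [homTensorHomEquiv_apply]
  rfl

/-- The action of a tensor product of algebras of endomorphisms on the tensor product. -/
def tensorEnd (A : Subalgebra K (End K M)) (B : Subalgebra K (End K N)) :
    A ⊗[K] B →ₐ[K] End K (M ⊗[K] N) :=
  (endTensorEndAlgHom (R := K) (S := K) (A := K) (M := M) (N := N)).comp
    (Algebra.TensorProduct.map A.val B.val)

theorem injective_tensorEnd (A : Subalgebra K (End K M)) (B : Subalgebra K (End K N)) :
    Function.Injective (tensorEnd A B) := by
  refine bijective_endTensorEnd.1.comp ?_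
  exact TensorProduct.map_injective_of_flat_flat A.val.toLinearMap B.val.toLinearMap
    Subtype.val_injective Subtype.val_injective

theorem mem_range_tensorEnd_iff {S : Set (End K M)} {T : Set (End K N)} {ψ : End K (M ⊗[K] N)} :
    ψ ∈ (tensorEnd (Subalgebra.centralizer K S) (Subalgebra.centralizer K T)).range ↔
      (∀ s ∈ S, TensorProduct.map s LinearMap.id ∘ₗ ψ = ψ ∘ₗ TensorProduct.map s LinearMap.id) ∧
      ∀ t ∈ T, TensorProduct.map LinearMap.id t ∘ₗ ψ = ψ ∘ₗ TensorProduct.map LinearMap.id t := by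
  obtain ⟨z, rfl⟩ := (bijective_endTensorEnd (K := K) (M := M) (N := N)).2 ψ
  have h1 : endTensorEndAlgHom (R := K) (S := K) (A := K) (M := M) (N := N) z ∈
      (tensorEnd (Subalgebra.centralizer K S) (Subalgebra.centralizer K T)).range ↔
      z ∈ (Algebra.TensorProduct.map (Subalgebra.centralizer K S).val
      (Subalgebra.centralizer K T).val).range := by
    constructor
    · rintro ⟨u, hu⟩
      exact ⟨u, bijective_endTensorEnd.1 hu⟩
    · rintro ⟨u, rfl⟩
      exact ⟨u, rfl⟩
  rw [h1, ← centralizer_union_tensorProduct, Subalgebra.mem_centralizer_iff]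
  simp only [Set.mem_union, or_imp, forall_and, Set.forall_mem_image]
  refine and_congr (forall₂_congr fun s _ => ?_) (forall₂_congr fun t _ => ?_)
  · rw [← bijective_endTensorEnd.1.eq_iff, map_mul, map_mul]
    rfl
  · rw [← bijective_endTensorEnd.1.eq_iff, map_mul, map_mul]
    rfl

end Commutants

section Restriction

open Module

variable {K : Type*} [Field K] {M N : Type*} [AddCommGroup M] [Module K M]
  [AddCommGroup N] [Module K N]

theorem exists_restriction {e : N →ₗ[K] M} (he : Function.Injective e)
    {S : Subalgebra K (End K M)} (hS : ∀ φ ∈ S, ∀ w, φ (e w) ∈ LinearMap.range e) :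
    ∃ ρ : S →ₐ[K] End K N, ∀ φ w, e (ρ φ w) = (φ : End K M) (e w) := by
  obtain ⟨g, hg⟩ := e.exists_leftInverse_of_injective (LinearMap.ker_eq_bot.mpr he)
  have hge : ∀ w, g (e w) = w := fun w => LinearMap.congr_fun hg w
  have key : ∀ (φ : S) (w : N), e (g ((φ : End K M) (e w))) = (φ : End K M) (e w) := by
    intro φ w
    obtain ⟨u, hu⟩ := hS φ φ.2 w
    rw [← hu, hge]
  refine ⟨AlgHom.ofLinearMap
    { toFun := fun φ => g ∘ₗ (φ : End K M) ∘ₗ e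
      map_add' := fun φ ψ => by ext; simp
      map_smul' := fun c φ => by ext; simp } ?_ ?_, key⟩
  · ext w
    exact hge w
  · intro φ ψ
    ext w
    change g ((φ : End K M) ((ψ : End K M) (e w))) =
      g ((φ : End K M) (e (g ((ψ : End K M) (e w)))))
    rw [key]

/-- Two families of homomorphisms into the same algebras, one jointly injective and the other
injective in each factor, with the same image in the product. -/
theorem nonempty_algEquiv_pi {ι A : Type*} {B E : ι → Type*} [Semiring A] [Algebra K A]
    [∀ i, Semiring (B i)] [∀ i, Algebra K (B i)] [∀ i, Semiring (E i)] [∀ i, Algebra K (E i)]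
    (ρ : ∀ i, A →ₐ[K] E i) (τ : ∀ i, B i →ₐ[K] E i)
    (hρ : ∀ a a', (∀ i, ρ i a = ρ i a') → a = a') (hτ : ∀ i, Function.Injective (τ i))
    (hle : ∀ a i, ρ i a ∈ (τ i).range) (hge : ∀ b : ∀ i, B i, ∃ a, ∀ i, ρ i a = τ i (b i)) :
    Nonempty (A ≃ₐ[K] ∀ i, B i) := by
  have hG : Function.Injective (AlgHom.pi ρ) := fun a a' h => hρ a a' fun i => congrFun h i
  let H : (∀ i, B i) →ₐ[K] ∀ i, E i := AlgHom.pi fun i => (τ i).comp (Pi.evalAlgHom K B i)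
  have hH : Function.Injective H := fun b b' h => funext fun i => hτ i (congrFun h i)
  have hrange : (AlgHom.pi ρ).range = H.range := by
    ext ψ
    constructor
    · rintro ⟨a, rfl⟩
      choose b hb using hle a
      exact ⟨b, funext hb⟩
    · rintro ⟨b, rfl⟩
      obtain ⟨a, ha⟩ := hge b
      exact ⟨a, funext ha⟩
  exact ⟨(AlgEquiv.ofInjective _ hG).trans
    ((Subalgebra.equivOfEq _ _ hrange).trans (AlgEquiv.ofInjective H hH).symm)⟩

end Restriction

section Decomposition

open Module

variable {K : Type*} [Field K] {q Q : Kˣ} {n d : ℕ}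

theorem apply_embDom_mem_range (hf : IsUnit (fB q Q d)) {i : ℕ} (hi : i ≤ d)
    {φ : End K (TensorSpace K n d)} (hφ : φ ∈ SchurB q Q n d)
    (w : TensorSpace K ((n + 1) / 2) i ⊗[K] TensorSpace K (n / 2) (d - i)) :
    φ (embDom hf n i w) ∈ LinearMap.range (embDom hf n i) := by
  have h1 : embDom hf n i w ∈ LinearMap.range (embDom hf n i) := ⟨w, rfl⟩
  rw [range_embDom hf hi] at h1 ⊢
  exact map_mem_sgnSp (jm_semiconj (mem_schurB_iff.mp hφ)) h1

theorem exists_restriction_embDom (hf : IsUnit (fB q Q d)) (n : ℕ) {i : ℕ} (hi : i ≤ d) :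
    ∃ ρ : SchurB q Q n d →ₐ[K]
        End K (TensorSpace K ((n + 1) / 2) i ⊗[K] TensorSpace K (n / 2) (d - i)),
      ∀ φ w, embDom hf n i (ρ φ w) = (φ : End K (TensorSpace K n d)) (embDom hf n i w) :=
  exists_restriction (N := TensorSpace K ((n + 1) / 2) i ⊗[K] TensorSpace K (n / 2) (d - i))
    (M := TensorSpace K n d) (injective_embDom hf hi)
    fun _ hφ => apply_embDom_mem_range hf hi hφ

theorem mem_range_tensorEnd_schurA_iff (hf : IsUnit (fB q Q d)) {i : ℕ} (hi : i ≤ d)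
    {ψ : End K (TensorSpace K ((n + 1) / 2) i ⊗[K] TensorSpace K (n / 2) (d - i))} :
    ψ ∈ (tensorEnd (SchurA q ((n + 1) / 2) i) (SchurA q (n / 2) (d - i))).range ↔
      ∀ k, k + 1 < d → k + 1 ≠ i → ∀ w w', opT q Q n d (k + 1) (embDom hf n i w) =
        embDom hf n i w' → opT q Q n d (k + 1) (embDom hf n i (ψ w)) = embDom hf n i (ψ w') := by
  have hinj := injective_embDom (n := n) hf hi
  rw [schurA_eq_centralizer, schurA_eq_centralizer, mem_range_tensorEnd_iff]
  constructor
  · rintro ⟨hl, hr⟩ k hk hki w w' hw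
    rcases Nat.lt_or_ge (k + 1) i with h1 | h1
    · rw [opT_embDom_left hf hi h1] at hw ⊢
      rw [← hinj hw]
      exact congrArg _ (LinearMap.congr_fun (hl _ ⟨⟨k, by omega⟩, rfl⟩) w)
    · obtain ⟨l, rfl⟩ : ∃ l, k = i + l := ⟨k - i, by omega⟩
      rw [opT_embDom_right hf hk] at hw ⊢
      rw [← hinj hw]
      exact congrArg _ (LinearMap.congr_fun (hr _ ⟨⟨l, by omega⟩, rfl⟩) w)
  · intro h
    constructor
    · rintro _ ⟨k, rfl⟩
      have hk : k.val + 1 < i := by omega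
      refine LinearMap.ext fun w => hinj ?_
      have h1 := h k (by omega) (by omega) w _ (opT_embDom_left hf hi hk w)
      rw [opT_embDom_left hf hi hk] at h1
      exact h1
    · rintro _ ⟨k, rfl⟩
      have hk : i + k.val + 1 < d := by omega
      refine LinearMap.ext fun w => hinj ?_
      have h1 := h (i + k) hk (by omega) w _ (opT_embDom_right hf hk w)
      rw [opT_embDom_right hf hk] at h1
      exact h1

theorem exists_mem_schurB (hf : IsUnit (fB q Q d))
    (ψ : (i : Fin (d + 1)) →
      End K (TensorSpace K ((n + 1) / 2) i ⊗[K] TensorSpace K (n / 2) (d - i)))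
    (hψ : ∀ i : Fin (d + 1),
      ψ i ∈ (tensorEnd (SchurA q ((n + 1) / 2) i) (SchurA q (n / 2) (d - i))).range) :
    ∃ φ ∈ SchurB q Q n d, ∀ (i : Fin (d + 1)) w, φ (embDom hf n i w) = embDom hf n i (ψ i w) := by
  have hle : ∀ i : Fin (d + 1), (i : ℕ) ≤ d := fun i => by omega
  have hex : ∀ i : Fin (d + 1), ∃ g : End K (TensorSpace K n d),
      ∀ w, g (embDom hf n i w) = embDom hf n i (ψ i w) := by
    intro i
    obtain ⟨g, hg⟩ := LinearMap.exists_leftInverse_of_injective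
      (V := TensorSpace K ((n + 1) / 2) i ⊗[K] TensorSpace K (n / 2) (d - i))
      (V' := TensorSpace K n d) (embDom hf n i)
      (LinearMap.ker_eq_bot.mpr (injective_embDom hf (hle i)))
    exact ⟨embDom hf n i ∘ₗ ψ i ∘ₗ g, fun w =>
      congrArg (fun u => embDom hf n i (ψ i u)) (LinearMap.congr_fun hg w)⟩
  choose g hg using hex
  have hψ' := fun i => (mem_range_tensorEnd_schurA_iff hf (hle i)).mp (hψ i)
  obtain ⟨φ, h1, h2⟩ := (isHeckeB_opT (q := q) (Q := Q) (n := n)).exists_extension hf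
    (ψ := fun i => if h : i < d + 1 then g ⟨i, h⟩ else 0)
    (by
      intro i hi m hm
      rw [← range_embDom hf hi] at hm ⊢
      obtain ⟨w, rfl⟩ := hm
      rw [dif_pos (by omega), hg ⟨i, by omega⟩ w]
      exact ⟨_, rfl⟩)
    (by
      intro i hi k hk hki m hm
      have hT := isHeckeB_opT.T_mem_sgnSp hf hk (dom_eq_dom hk hki) hm
      rw [← range_embDom hf hi] at hm hT
      obtain ⟨w, rfl⟩ := hm
      obtain ⟨w', hw'⟩ := hT
      rw [dif_pos (by omega), ← hw', hg ⟨i, by omega⟩ w, hg ⟨i, by omega⟩ w']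
      exact (hψ' ⟨i, by omega⟩ k hk hki w w' hw'.symm).symm)
  refine ⟨φ, mem_schurB_iff.mpr h1, fun i w => ?_⟩
  rw [h2 i (hle i) _ (by rw [← range_embDom hf (hle i)]; exact ⟨w, rfl⟩), dif_pos i.2]
  exact hg i w

end Decomposition

end QSchur

end

open QSchur in
theorem theorem3p1 {K : Type*} [Field K] (q Q : Kˣ) (n d : ℕ)
    (hf : IsUnit (QSchur.fB q Q d)) :
    Nonempty (QSchur.SchurB q Q n d ≃ₐ[K]
      ((i : Fin (d + 1)) →
        QSchur.SchurA q ((n + 1) / 2) (i : ℕ) ⊗[K] QSchur.SchurA q (n / 2) (d - (i : ℕ)))) := by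
  have hle : ∀ i : Fin (d + 1), (i : ℕ) ≤ d := fun i => by omega
  choose ρ hρ using fun i : Fin (d + 1) => exists_restriction_embDom hf n (hle i)
  refine nonempty_algEquiv_pi
    (B := fun i : Fin (d + 1) =>
      SchurA q ((n + 1) / 2) (i : ℕ) ⊗[K] SchurA q (n / 2) (d - (i : ℕ)))
    (E := fun i : Fin (d + 1) => Module.End K
      (TensorSpace K ((n + 1) / 2) (i : ℕ) ⊗[K] TensorSpace K (n / 2) (d - (i : ℕ)))) ρ
    (fun i => tensorEnd (SchurA q ((n + 1) / 2) i) (SchurA q (n / 2) (d - i))) ?_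
    (fun i => injective_tensorEnd _ _) ?_ ?_
  · intro φ φ' h
    refine Subtype.ext (isHeckeB_opT.eq_of_eqOn_dom hf (mem_schurB_iff.mp φ.2)
      (mem_schurB_iff.mp φ'.2) fun i hi m hm => ?_)
    rw [← range_embDom hf hi] at hm
    obtain ⟨w, rfl⟩ := hm
    have h1 := hρ ⟨i, by omega⟩ φ w
    rw [h, hρ] at h1
    exact h1.symm
  · intro φ i
    rw [mem_range_tensorEnd_schurA_iff hf (hle i)]
    intro k hk _ w w' hw
    rw [hρ, hρ, ← hw, mem_schurB_iff.mp φ.2 _ hk]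
  · intro z
    obtain ⟨φ, hφ, h1⟩ := exists_mem_schurB hf
      (fun i => tensorEnd (SchurA q ((n + 1) / 2) i) (SchurA q (n / 2) (d - i)) (z i))
      fun i => ⟨z i, rfl⟩
    refine ⟨⟨φ, hφ⟩, fun i => LinearMap.ext fun w => injective_embDom hf (hle i) ?_⟩
    exact (hρ i ⟨φ, hφ⟩ w).trans (h1 i w)
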